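/- Let $K$ be a field of characteristic $0$, let $q\in K^*$ be not a root of unity, and let $n>1$ be an integer. Let $\mathcal O_q(M_n)$ be the $K$-algebra generated by $Y_{i,\alpha}$, $1\le i,\alpha\le n$, subject to the relations $$Y_{i,\beta}Y_{i,\alpha}=q^{-1}Y_{i,\alpha}Y_{i,\beta}\ (\alpha<\beta),\qquad Y_{j,\alpha}Y_{i,\alpha}=q^{-1}Y_{i,\alpha}Y_{j,\alpha}\ (i<j),$$ $$Y_{j,\beta}Y_{i,\alpha}=Y_{i,\alpha}Y_{j,\beta}\ (i<j,\ \alpha>\beta),\qquad Y_{j,\beta}Y_{i,\alpha}=Y_{i,\alpha}Y_{j,\beta}-(q-q^{-1})Y_{i,\beta}Y_{j,\alpha}\ (i<j,\ \alpha<\beta),$$ let $\Delta_n=\sum_{\sigma\in S_n}(-q)^{\ell(\sigma)}Y_{1,\sigma(1)}\cdots Y_{n,\sigma(n)}$ be the quantum determinant, where $\ell(\sigma)$ is the number of inversions of $\sigma$, and let $A=\mathcal O_q(GL_n)$ be the localisation of $\mathcal O_q(M_n)$ at the powers of $\Delta_n$. Let $D_{i,*}$ and $D_{*,\alpha}$ be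 the $K$-linear derivations of $A$ determined by $D_{i,*}(Y_{j,\beta})=\delta_{ij}Y_{j,\beta}$ and $D_{*,\alpha}(Y_{j,\beta})=\delta_{\alpha\beta}Y_{j,\beta}$, and set $$D_j=D_{*,n+1-j}\ (1\le j\le n-1),\qquad D_n=D_{1,*}+D_{*,1}-\sum_{i=1}^nD_{i,*},\qquad D_j=D_{j-n+1,*}\ (n+1\le j\le 2n-1).$$ For $x\in A$ let $\mathrm{ad}_x$ be the inner derivation $a\mapsto xa-ax$. Let $\mathrm{Der}(A)$ be the module of $K$-linear derivations of $A$ over the centre $Z(A)$, let $\mathrm{InnDer}(A)=\{\mathrm{ad}_x\mid x\in A\}$, and let $\mathrm{HH}^1(A)=\mathrm{Der}(A)/\mathrm{InnDer}(A)$. Then: 1. $Z(A)=K[\Delta_n^{\pm1}]$, the Laurent polynomial algebra in $\Delta_n$ (that is, $Z(A)$ is generated by $\Delta_n^{\pm1}$ and $\Delta_n$ is transcendental over $K$), and every derivation $D\in\mathrm{Der}(A)$ can be written as $$D=\mathrm{ad}_x+\mu_1D_1+\dots+\mu_{2n-1}D_{2n-1}$$ with $\mathrm{ad}_x\in\mathrm{InnDer}(A)$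 and $\mu_1,\dots,\mu_{2n-1}\in Z(A)$, where the derivation $\mathrm{ad}_x$ and the coefficients $\mu_i$ are uniquely determined by $D$. 2. $\mathrm{HH}^1(A)$ is a free $Z(A)$-module of rank $2n-1$, with basis the classes of $D_1,\dots,D_{2n-1}$. -/

import Mathlib

namespace QuantumGL

noncomputable section

open scoped DualNumber

/-! ### Derivations, inner derivations and the first Hochschild cohomology group -/

section Derivations

variable (K A : Type*) [Field K] [Ring A] [Algebra K A]

/-- The `K`-linear derivations of a (not necessarily commutative) `K`-algebra `A`, as a submodule
over the centre of `A`, which acts on linear maps by `(z • D) a = z * D a`. -/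
def derSubmodule : Submodule (Subalgebra.center K A) (A →ₗ[K] A) where
  carrier := {D | ∀ a b : A, D (a * b) = D a * b + a * D b}
  add_mem' {D E} hD hE a b := by
    simp only [LinearMap.add_apply, hD a b, hE a b, add_mul, mul_add]
    abel
  zero_mem' a b := by simp
  smul_mem' z D hD a b := by
    have hz : a * (z : A) = z * a := (Subalgebra.mem_center_iff.1 z.2 a)
    simp only [LinearMap.smul_apply, Subalgebra.smul_def, smul_eq_mul, hD a b, mul_add]
    rw [← mul_assoc, ← mul_assoc (z : A) a, ← hz, mul_assoc a]

/-- The `K`-linear derivations of `A`. -/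
def Der : Type _ := derSubmodule K A

instance : AddCommGroup (Der K A) := inferInstanceAs (AddCommGroup (derSubmodule K A))

instance : Module (Subalgebra.center K A) (Der K A) :=
  inferInstanceAs (Module (Subalgebra.center K A) (derSubmodule K A))

variable {K A}

instance : CoeFun (Der K A) fun _ => A → A := ⟨fun D => D.1⟩

theorem Der.ext {D E : Der K A} (h : ∀ a, D a = E a) : D = E :=
  Subtype.ext (LinearMap.ext h)

theorem Der.leibniz (D : Der K A) (a b : A) : D (a * b) = D a * b + a * D b := D.2 a b

theorem Der.add_apply (D E : Der K A) (a : A) : (D + E) a = D a + E a := rfl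

theorem Der.smul_apply (z : Subalgebra.center K A) (D : Der K A) (a : A) :
    (z • D) a = (z : A) * D a := rfl

variable (K)

/-- The inner derivation `ad_x`, `a ↦ x * a - a * x`. -/
def ad (x : A) : Der K A :=
  ⟨LinearMap.mulLeft K x - LinearMap.mulRight K x, fun a b => by
    simp only [LinearMap.sub_apply, LinearMap.mulLeft_apply, LinearMap.mulRight_apply]
    noncomm_ring⟩

theorem ad_apply (x a : A) : ad K x a = x * a - a * x := rfl

variable (A)

/-- The inner derivations `{ad_x | x ∈ A}`, as a submodule of the derivations. -/
def InnDer : Submodule (Subalgebra.center K A) (Der K A) where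
  carrier := Set.range (ad K)
  add_mem' := by
    rintro _ _ ⟨x, rfl⟩ ⟨y, rfl⟩
    refine ⟨x + y, Der.ext fun a => ?_⟩
    simp only [Der.add_apply, ad_apply]
    noncomm_ring
  zero_mem' := ⟨0, Der.ext fun a => by rw [ad_apply, zero_mul, mul_zero, sub_zero]; rfl⟩
  smul_mem' := by
    rintro z _ ⟨x, rfl⟩
    refine ⟨z * x, Der.ext fun a => ?_⟩
    have hz : a * (z : A) = z * a := (Subalgebra.mem_center_iff.1 z.2 a)
    simp only [ad_apply, Der.smul_apply, mul_sub]
    rw [← mul_assoc a, hz, mul_assoc, mul_assoc]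

/-- `HH¹(A) = Der(A) / InnDer(A)`, a module over the centre of `A`. -/
abbrev HH1 : Type _ := Der K A ⧸ InnDer K A

/-- The class in `HH¹(A)` of a derivation of `A`. -/
def HH1.mk : Der K A →ₗ[Subalgebra.center K A] HH1 K A := (InnDer K A).mkQ

end Derivations

/-! ### Quantum matrices and the quantum determinant -/

section QuantumMatrices

variable {K : Type*} [Field K] (q : K) {n : ℕ}

/-- The number of inversions of a permutation. -/
def invCount (σ : Equiv.Perm (Fin n)) : ℕ :=
  (Finset.univ.filter fun p : Fin n × Fin n => p.1 < p.2 ∧ σ p.2 < σ p.1).card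

/-- The quantum determinant `∑_σ (-q)^{ℓ(σ)} Y_{1,σ(1)} ⋯ Y_{n,σ(n)}` of a square array `Y`
of elements of a `K`-algebra. -/
def qdet {A : Type*} [Ring A] [Algebra K A] (Y : Fin n → Fin n → A) : A :=
  ∑ σ : Equiv.Perm (Fin n), (-q) ^ invCount σ • (List.ofFn fun i => Y i (σ i)).prod

/-- The defining relations of quantum matrices, imposed on an array `Y` of elements of an
algebra: `QMatRel q Y l r` says that `l = r` is one of the relations. -/
inductive QMatRel {A : Type*} [Ring A] [Algebra K A] (Y : Fin n → Fin n → A) : A → A → Prop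
  | row {i α β : Fin n} (h : α < β) : QMatRel Y (Y i β * Y i α) (q⁻¹ • (Y i α * Y i β))
  | col {i j α : Fin n} (h : i < j) : QMatRel Y (Y j α * Y i α) (q⁻¹ • (Y i α * Y j α))
  | anti {i j α β : Fin n} (h : i < j) (h' : β < α) : QMatRel Y (Y j β * Y i α) (Y i α * Y j β)
  | diag {i j α β : Fin n} (h : i < j) (h' : α < β) :
      QMatRel Y (Y j β * Y i α) (Y i α * Y j β - (q - q⁻¹) • (Y i β * Y j α))

variable (n)

/-- `O_q(M_n)`: the `K`-algebra generated by the `Y_{i,α}` subject to the quantum matrix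
relations. -/
abbrev OqM : Type _ :=
  RingQuot (QMatRel q fun i α : Fin n => FreeAlgebra.ι K (i, α))

/-- The generators `Y_{i,α}` of `O_q(M_n)`. -/
def YM (i α : Fin n) : OqM q n := RingQuot.mkAlgHom K _ (FreeAlgebra.ι K (i, α))

/-- The generators `Y_{i,α}` of the free algebra on the `Y_{i,α}` and one further generator. -/
def freeY (i α : Fin n) : FreeAlgebra K (Option (Fin n × Fin n)) :=
  FreeAlgebra.ι K (some (i, α))

/-- The relations of `O_q(GL_n)`: those of quantum matrices for the `Y_{i,α}`, and those making
the extra generator a two-sided inverse of the quantum determinant. -/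
inductive GLRel : FreeAlgebra K (Option (Fin n × Fin n)) →
    FreeAlgebra K (Option (Fin n × Fin n)) → Prop
  | mat {l r} (h : QMatRel q (freeY n) l r) : GLRel l r
  | det_mul : GLRel (qdet q (freeY n) * FreeAlgebra.ι K none) 1
  | mul_det : GLRel (FreeAlgebra.ι K none * qdet q (freeY n)) 1

/-- `O_q(GL_n)`: the localisation of `O_q(M_n)` at the powers of the quantum determinant, i.e.
`O_q(M_n)` with an inverse of the quantum determinant adjoined (see `existsUnique_lift` for the
universal property). -/
def OqGL : Type _ := RingQuot (GLRel q n)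

instance : Ring (OqGL q n) := inferInstanceAs (Ring (RingQuot (GLRel q n)))

instance : Algebra K (OqGL q n) := inferInstanceAs (Algebra K (RingQuot (GLRel q n)))

/-- The quotient map from the free algebra onto `O_q(GL_n)`. -/
def mkGL : FreeAlgebra K (Option (Fin n × Fin n)) →ₐ[K] OqGL q n :=
  RingQuot.mkAlgHom K (GLRel q n)

/-- The generators `Y_{i,α}` of `O_q(GL_n)`. -/
def YGL (i α : Fin n) : OqGL q n := mkGL q n (freeY n i α)

/-- The quantum determinant `Δ_n` in `O_q(GL_n)`. -/
def detGL : OqGL q n := qdet q (YGL q n)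

/-- The inverse of the quantum determinant in `O_q(GL_n)`. -/
def detInvGL : OqGL q n := mkGL q n (FreeAlgebra.ι K none)

variable {n}

theorem map_qdet {A B : Type*} [Ring A] [Algebra K A] [Ring B] [Algebra K B] (f : A →ₐ[K] B)
    (Y : Fin n → Fin n → A) : f (qdet q Y) = qdet q fun i α => f (Y i α) := by
  simp only [qdet, map_sum, map_smul, map_list_prod, List.map_ofFn, Function.comp_def]

theorem QMatRel.map {A B : Type*} [Ring A] [Algebra K A] [Ring B] [Algebra K B] (f : A →ₐ[K] B)
    {Y : Fin n → Fin n → A} {l r : A} (h : QMatRel q Y l r) :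
    QMatRel q (fun i α => f (Y i α)) (f l) (f r) := by
  cases h with
  | row h => simpa using QMatRel.row (q := q) (Y := fun i α => f (Y i α)) h
  | col h => simpa using QMatRel.col (q := q) (Y := fun i α => f (Y i α)) h
  | anti h h' => simpa using QMatRel.anti (q := q) (Y := fun i α => f (Y i α)) h h'
  | diag h h' => simpa using QMatRel.diag (q := q) (Y := fun i α => f (Y i α)) h h'

theorem detGL_mul_detInvGL : detGL q n * detInvGL q n = 1 := by
  have h := RingQuot.mkAlgHom_rel K (GLRel.det_mul (q := q) (n := n))
  rwa [map_mul, map_one, map_qdet] at h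

theorem detInvGL_mul_detGL : detInvGL q n * detGL q n = 1 := by
  have h := RingQuot.mkAlgHom_rel K (GLRel.mul_det (q := q) (n := n))
  rwa [map_mul, map_one, map_qdet] at h

theorem YGL_rel {l r : OqGL q n} (h : QMatRel q (YGL q n) l r) : l = r := by
  have key : ∀ {l r}, QMatRel q (freeY n) l r →
      mkGL q n l = mkGL q n r :=
    fun h => RingQuot.mkAlgHom_rel K (GLRel.mat h)
  cases h with
  | row h => simpa [YGL] using key (QMatRel.row h)
  | col h => simpa [YGL] using key (QMatRel.col h)
  | anti h h' => simpa [YGL] using key (QMatRel.anti h h')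
  | diag h h' => simpa [YGL] using key (QMatRel.diag h h')

/-- An algebra homomorphism out of `O_q(GL_n)` from a quantum matrix whose quantum determinant
has inverse `t`. -/
def liftGL {B : Type*} [Ring B] [Algebra K B] (y : Fin n → Fin n → B) (t : B)
    (hy : ∀ l r, QMatRel q y l r → l = r) (h₁ : qdet q y * t = 1) (h₂ : t * qdet q y = 1) :
    OqGL q n →ₐ[K] B :=
  RingQuot.liftAlgHom K ⟨FreeAlgebra.lift K fun o => o.elim t fun p => y p.1 p.2, by
    intro l r h
    cases h with
    | mat h =>
      have h' := h.map q
        (FreeAlgebra.lift K fun (o : Option (Fin n × Fin n)) => o.elim t fun p => y p.1 p.2)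
      exact hy _ _ (by simpa [freeY] using h')
    | det_mul => simpa [freeY, map_qdet] using h₁
    | mul_det => simpa [freeY, map_qdet] using h₂⟩

theorem liftGL_YGL {B : Type*} [Ring B] [Algebra K B] (y : Fin n → Fin n → B) (t : B)
    (hy : ∀ l r, QMatRel q y l r → l = r) (h₁ : qdet q y * t = 1) (h₂ : t * qdet q y = 1)
    (i α : Fin n) : liftGL q y t hy h₁ h₂ (YGL q n i α) = y i α := by
  exact (RingQuot.liftAlgHom_mkAlgHom_apply K _ _ _).trans (by simp [freeY])

theorem liftGL_detInvGL {B : Type*} [Ring B] [Algebra K B] (y : Fin n → Fin n → B) (t : B)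
    (hy : ∀ l r, QMatRel q y l r → l = r) (h₁ : qdet q y * t = 1) (h₂ : t * qdet q y = 1) :
    liftGL q y t hy h₁ h₂ (detInvGL q n) = t := by
  exact (RingQuot.liftAlgHom_mkAlgHom_apply K _ _ _).trans (by simp)

/-- Two homomorphisms out of `O_q(GL_n)` that agree on the `Y_{i,α}` are equal. -/
theorem algHom_ext_GL {B : Type*} [Ring B] [Algebra K B] {f g : OqGL q n →ₐ[K] B}
    (h : ∀ i α, f (YGL q n i α) = g (YGL q n i α)) : f = g := by
  have hdet : f (detGL q n) = g (detGL q n) := by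
    simp only [detGL, map_qdet, h]
  have hinv : f (detInvGL q n) = g (detInvGL q n) := by
    refine left_inv_eq_right_inv (a := f (detGL q n)) ?_ ?_
    · rw [← map_mul, detInvGL_mul_detGL, map_one]
    · rw [hdet, ← map_mul, detGL_mul_detInvGL, map_one]
  apply RingQuot.ringQuot_ext'
  apply FreeAlgebra.hom_ext
  funext o
  rcases o with _ | ⟨i, α⟩
  · exact hinv
  · exact h i α

/-- The localisation map `O_q(M_n) → O_q(GL_n)`. -/
def toGL : OqM q n →ₐ[K] OqGL q n :=
  RingQuot.liftAlgHom K ⟨FreeAlgebra.lift K fun p => YGL q n p.1 p.2, by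
    intro l r h
    exact YGL_rel q (by simpa using h.map q (FreeAlgebra.lift K fun p => YGL q n p.1 p.2))⟩

theorem toGL_YM (i α : Fin n) : toGL q (YM q n i α) = YGL q n i α := by
  simp [toGL, YM]

theorem isUnit_toGL_qdet : IsUnit (toGL q (qdet q (YM q n))) := by
  rw [map_qdet]
  simp only [toGL_YM]
  exact ⟨⟨_, _, detGL_mul_detInvGL q, detInvGL_mul_detGL q⟩, rfl⟩

/-- The universal property of the localisation of `O_q(M_n)` at the powers of the quantum
determinant. -/
theorem existsUnique_lift {B : Type*} [Ring B] [Algebra K B] (f : OqM q n →ₐ[K] B)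
    (hf : IsUnit (f (qdet q (YM q n)))) : ∃! g : OqGL q n →ₐ[K] B, g.comp (toGL q) = f := by
  obtain ⟨u, hu⟩ := hf
  rw [map_qdet] at hu
  refine ⟨liftGL q (fun i α => f (YM q n i α)) (↑u⁻¹ : B) ?_ ?_ ?_, ?_, ?_⟩
  · intro l r h
    have key : ∀ {l r}, QMatRel q (fun i α : Fin n => FreeAlgebra.ι K (i, α)) l r →
        f (RingQuot.mkAlgHom K _ l) = f (RingQuot.mkAlgHom K _ r) :=
      fun h => congrArg f (RingQuot.mkAlgHom_rel K h)
    cases h with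
    | row h => simpa [YM] using key (QMatRel.row h)
    | col h => simpa [YM] using key (QMatRel.col h)
    | anti h h' => simpa [YM] using key (QMatRel.anti h h')
    | diag h h' => simpa [YM] using key (QMatRel.diag h h')
  · rw [← hu, Units.mul_inv]
  · rw [← hu, Units.inv_mul]
  · apply RingQuot.ringQuot_ext'
    apply FreeAlgebra.hom_ext
    funext p
    change liftGL q _ _ _ _ _ (toGL q (YM q n p.1 p.2)) = f (YM q n p.1 p.2)
    rw [toGL_YM, liftGL_YGL]
  · intro g hg
    apply algHom_ext_GL
    intro i α
    rw [liftGL_YGL, ← hg, AlgHom.comp_apply, toGL_YM]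

/-! ### The row and column derivations -/

section DualNumbers

variable {A : Type*} [Ring A] [Algebra K A]

/-- The element `1 + cε` of the dual numbers. -/
def oneAddEps (c : K) : A[ε] := TrivSqZeroExt.inl 1 + TrivSqZeroExt.inr (c • 1)

theorem oneAddEps_mul_inl (c : K) (a : A) :
    oneAddEps c * (TrivSqZeroExt.inl a : A[ε])
      = TrivSqZeroExt.inl a + TrivSqZeroExt.inr (c • a) := by
  ext <;> simp [oneAddEps]

theorem scaled_mul (c d : K) (a b : A) :
    (oneAddEps c * TrivSqZeroExt.inl a : A[ε]) * (oneAddEps d * TrivSqZeroExt.inl b)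
      = oneAddEps (c + d) * TrivSqZeroExt.inl (a * b) := by
  simp only [oneAddEps_mul_inl]
  ext <;> simp [add_smul, add_comm]

theorem scaled_smul (c k : K) (a : A) :
    k • (oneAddEps c * TrivSqZeroExt.inl a : A[ε]) = oneAddEps c * TrivSqZeroExt.inl (k • a) := by
  simp only [oneAddEps_mul_inl]
  ext <;> simp [smul_comm k c]

theorem scaled_list_prod {ι : Type*} (l : List ι) (c : ι → K) (a : ι → A) :
    (l.map fun i => (oneAddEps (c i) * TrivSqZeroExt.inl (a i) : A[ε])).prod
      = oneAddEps (l.map c).sum * TrivSqZeroExt.inl (l.map a).prod := by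
  induction l with
  | nil => ext <;> simp [oneAddEps]
  | cons i l ih => simp only [List.map_cons, List.prod_cons, List.sum_cons, ih, scaled_mul]

theorem scaled_qdet (a b : Fin n → K) (Y : Fin n → Fin n → A) :
    qdet q (fun i α => (oneAddEps (a i + b α) * TrivSqZeroExt.inl (Y i α) : A[ε]))
      = oneAddEps (∑ i, a i + ∑ i, b i) * TrivSqZeroExt.inl (qdet q Y) := by
  have hs : ∀ σ : Equiv.Perm (Fin n),
      ((List.finRange n).map fun i => a i + b (σ i)).sum = ∑ i, a i + ∑ i, b i := by
    intro σ
    rw [← Equiv.sum_comp σ b, ← Finset.sum_add_distrib, ← List.ofFn_eq_map, List.sum_ofFn]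
  have hsum : (TrivSqZeroExt.inl (qdet q Y) : A[ε]) = ∑ σ : Equiv.Perm (Fin n),
      TrivSqZeroExt.inl ((-q) ^ invCount σ • (List.ofFn fun i => Y i (σ i)).prod) :=
    map_sum (TrivSqZeroExt.inlHom A A) _ _
  rw [hsum, Finset.mul_sum]
  refine Finset.sum_congr rfl fun σ _ => ?_
  rw [List.ofFn_eq_map, List.ofFn_eq_map, scaled_list_prod, hs, scaled_smul]

end DualNumbers

/-- The homomorphism `O_q(GL_n) → O_q(GL_n)[ε]`, `Y_{i,α} ↦ (1 + (a_i + b_α)ε) Y_{i,α}`. -/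
def weightHom (a b : Fin n → K) : OqGL q n →ₐ[K] (OqGL q n)[ε] :=
  liftGL q (fun i α => oneAddEps (a i + b α) * TrivSqZeroExt.inl (YGL q n i α))
    (oneAddEps (-(∑ i, a i + ∑ i, b i)) * TrivSqZeroExt.inl (detInvGL q n))
    (by
      intro l r h
      cases h with
      | @row i α β h =>
        rw [scaled_mul, scaled_mul, scaled_smul, ← YGL_rel q (.row h)]
        congr 2; ring
      | @col i j α h =>
        rw [scaled_mul, scaled_mul, scaled_smul, ← YGL_rel q (.col h)]
        congr 2; ring
      | @anti i j α β h h' =>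
        rw [scaled_mul, scaled_mul, ← YGL_rel q (.anti h h')]
        congr 2; ring
      | @diag i j α β h h' =>
        have e₁ : a i + b α + (a j + b β) = a j + b β + (a i + b α) := by ring
        have e₂ : a i + b β + (a j + b α) = a j + b β + (a i + b α) := by ring
        rw [scaled_mul, scaled_mul, scaled_mul, scaled_smul, YGL_rel q (.diag h h'), e₁, e₂,
          ← mul_sub, TrivSqZeroExt.inl_sub])
    (by
      rw [scaled_qdet, scaled_mul, add_neg_cancel]
      change _ * TrivSqZeroExt.inl (detGL q n * _) = _
      rw [detGL_mul_detInvGL]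
      ext <;> simp [oneAddEps])
    (by
      rw [scaled_qdet, scaled_mul, neg_add_cancel]
      change _ * TrivSqZeroExt.inl (_ * detGL q n) = _
      rw [detInvGL_mul_detGL]
      ext <;> simp [oneAddEps])

theorem fst_weightHom (a b : Fin n → K) (x : OqGL q n) :
    TrivSqZeroExt.fst (weightHom q a b x) = x := by
  have h : (TrivSqZeroExt.fstHom K (OqGL q n) (OqGL q n)).comp (weightHom q a b)
      = AlgHom.id K (OqGL q n) := by
    apply algHom_ext_GL
    intro i α
    simp [weightHom, liftGL_YGL, oneAddEps]
  exact DFunLike.congr_fun h x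

/-- The derivation of `O_q(GL_n)` with `Y_{i,α} ↦ (a_i + b_α) Y_{i,α}` (see `weightDer_YGL`). -/
def weightDer (a b : Fin n → K) : Der K (OqGL q n) :=
  ⟨{  toFun := fun x => TrivSqZeroExt.snd (weightHom q a b x)
      map_add' := fun x y => by rw [map_add, TrivSqZeroExt.snd_add]
      map_smul' := fun c x => by rw [map_smul, TrivSqZeroExt.snd_smul, RingHom.id_apply] },
    fun x y => by
      change TrivSqZeroExt.snd (weightHom q a b (x * y)) = _
      rw [map_mul, DualNumber.snd_mul, fst_weightHom, fst_weightHom, add_comm]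
      rfl⟩

theorem weightDer_YGL (a b : Fin n → K) (i α : Fin n) :
    weightDer q a b (YGL q n i α) = (a i + b α) • YGL q n i α := by
  change TrivSqZeroExt.snd (weightHom q a b (YGL q n i α)) = _
  rw [weightHom, liftGL_YGL, oneAddEps_mul_inl]
  simp

/-- A derivation of `O_q(GL_n)` is determined by its values on the `Y_{i,α}`; in particular the
derivations below are the unique extensions of the corresponding derivations of `O_q(M_n)`. -/
theorem der_ext {D E : Der K (OqGL q n)}
    (h : ∀ i α, D (YGL q n i α) = E (YGL q n i α)) : D = E := by
  have one : ∀ F : Der K (OqGL q n), F 1 = 0 := fun F => by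
    simpa using F.leibniz 1 1
  let φ : Der K (OqGL q n) → (OqGL q n →ₐ[K] (OqGL q n)[ε]) := fun F =>
    AlgHom.ofLinearMap
      { toFun := fun x => TrivSqZeroExt.inl x + TrivSqZeroExt.inr (F x)
        map_add' := fun x y => by ext <;> simp [map_add F.1]
        map_smul' := fun c x => by ext <;> simp [map_smul F.1] }
      (by ext <;> simp [one])
      (fun x y => by ext <;> simp [F.leibniz, add_comm])
  have hφ : φ D = φ E := algHom_ext_GL q fun i α => by simp [φ, h]
  refine Der.ext fun a => ?_
  simpa [φ] using congrArg TrivSqZeroExt.snd (DFunLike.congr_fun hφ a)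

/-- The row derivation `D_{i,*}`, which fixes the generators in row `i` and kills the others. -/
def rowDer (i : Fin n) : Der K (OqGL q n) := weightDer q (Pi.single i 1) 0

/-- The column derivation `D_{*,α}`, which fixes the generators in column `α` and kills the
others. -/
def colDer (α : Fin n) : Der K (OqGL q n) := weightDer q 0 (Pi.single α 1)

theorem rowDer_YGL (i j β : Fin n) :
    rowDer q i (YGL q n j β) = if i = j then YGL q n j β else 0 := by
  rw [rowDer, weightDer_YGL]
  by_cases h : i = j
  · subst h; simp
  · simp [h]

theorem colDer_YGL (α j β : Fin n) :
    colDer q α (YGL q n j β) = if α = β then YGL q n j β else 0 := by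
  rw [colDer, weightDer_YGL]
  by_cases h : α = β
  · subst h; simp
  · simp [h]

/-- The derivations `D_1, …, D_{2n-1}`; the index `j : Fin (2n-1)` stands for `D_{j+1}`, and rows
and columns are numbered from `0`. With `J = j + 1` and rows and columns numbered from `1`, this
is `D_J = D_{*,n+1-J}` for `J < n`, `D_n = D_{1,*} + D_{*,1} - ∑ᵢ D_{i,*}`, and
`D_J = D_{J-n+1,*}` for `J > n`. -/
def derD (j : Fin (2 * n - 1)) : Der K (OqGL q n) :=
  have hj : (j : ℕ) < 2 * n - 1 := j.isLt
  if (j : ℕ) + 1 < n then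
    colDer q ⟨n - 1 - j, by omega⟩
  else if (j : ℕ) + 1 = n then
    rowDer q ⟨0, by omega⟩ + colDer q ⟨0, by omega⟩ - ∑ i, rowDer q i
  else
    rowDer q ⟨j + 1 - n, by omega⟩

end QuantumMatrices

end

end QuantumGL

/-! Number rows and columns from 0 and give `Y_{i,α}` the degree `i * α`. Since `(j - i) * (β - α) >
0` for `i < j` and `α < β`, the correction term of the `diag` relation has smaller degree than the
rest. For this filtration quantum matrices thus degenerate to a quantum affine space, whose
generators commute up to powers of `q`. The whole argument compares leading terms there and inducts
on the degree; denominators are cleared by powers of the central element `Δ`.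

The comparison needs independence of the ordered monomials. A model by weighted shifts is built as a
Gauss product (lower triangular, diagonal, transposed lower triangular) of mutually commuting
bidiagonal quantum matrices. Distinct monomials have distinct leading shifts in it
(`linearIndependent_mono`), and `Δ` acts as an unweighted shift, hence is central (`detGL_commute`).

Exponent vectors whose monomials are central in the graded algebra are constant along diagonals and
change sign when a diagonal is continued from the last row to the first (`IsCentralExp.diag_succ`,
`IsCentralExp.wrap`). The nonnegative ones are the multiples of the exponent of `Δ`; with `q` not a
root of unity this gives the centre.

For a derivation of degree at most `d`, the relations force the part of its symbol at a noncentral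
exponent to be that of an inner derivation, which can be subtracted (`HasDeg.exists_ad`). What
remains is `Y_p ↦ θ_p Δ^N Y_p`, together with possible terms at central exponents having a single
entry `-1`, which must be at an off-diagonal corner. The graded algebra restricts neither. The
restriction comes from the correction term: the `diag` relation of an adjacent `2 × 2` block, read
one degree lower (`HasDeg.block_coef`), removes the corner terms for `n > 2` and shows `θ_{i,α} +
θ_{i',α'} = θ_{i,α'} + θ_{i',α}` for blocks off the main diagonal. On the main diagonal, and at the
corners for `n = 2`, unknown lower terms interfere. There the derivation is transported to a quantum
torus in which the block embeds, and a specialisation yields the missing linear identity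
(`der_block_relation`).

Hence `θ_{i,α} = a_i + b_α`, and modulo inner derivations and lower degree the derivation is `Δ^N`
times a weight derivation, itself a combination of the `D_j`. Induction gives generation.
Conversely, if `[x, Y_p] = ν_p Y_p` with central `ν_p`, leading terms strip powers of `Δ` from `x`
until nothing is left, so every `ν_p` vanishes (`eq_zero_of_ad_eq_mul`); this gives uniqueness and
the basis of `HH¹`. -/

namespace QuantumGL

noncomputable section

/-! ### The quantum matrix relations in `R`-matrix form -/

section QMat

variable {K : Type*} [Field K] (q : K) {n : ℕ} {A : Type*} [Ring A] [Algebra K A]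

/-- An array satisfying the quantum matrix relations. -/
def IsQMat (Y : Fin n → Fin n → A) : Prop := ∀ l r, QMatRel q Y l r → l = r

/-- The diagonal coefficients of the Hecke-type `R`-matrix. -/
def rcoef (i j : Fin n) : K := if i = j then q else if i < j then q - q⁻¹ else 0

/-- The Hecke-type `R`-matrix acting on a function of two indices. -/
def rmat (i j : Fin n) (f : Fin n → Fin n → A) : A :=
  rcoef q i j • f i j + if i = j then 0 else f j i

/-- The four families of relations are one identity: applying `R` to the row indices of `Y ⊗ Y`
equals applying it to the column indices. In this form closure under products is formal. The proof
inspects the nine relative positions of two entries. -/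
theorem isQMat_iff (hq₀ : q ≠ 0) (Y : Fin n → Fin n → A) :
    IsQMat q Y ↔ ∀ i j α β, rmat q i j (fun k l => Y k α * Y l β)
      = rmat q α β (fun a b => Y i a * Y j b) := by
  constructor
  · intro h i j α β
    rcases lt_trichotomy i j with hij | rfl | hij <;> rcases lt_trichotomy α β with hab | rfl | hab
    · have e := h _ _ (.anti hij hab)
      simp [rmat, rcoef, hij, hij.ne, hab, hab.ne, e]
    · have e := h _ _ (.col (α := α) hij)
      simp [rmat, rcoef, hij, hij.ne, e, sub_smul]
    · have e := h _ _ (.diag hij hab)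
      simp [rmat, rcoef, hij, hij.ne, hab.not_gt, hab.ne', e]
    · have e := h _ _ (.row (i := i) hab)
      simp [rmat, rcoef, hab, hab.ne, e, sub_smul]
    · simp [rmat, rcoef]
    · have e := h _ _ (.row (i := i) hab)
      simp [rmat, rcoef, hab.not_gt, hab.ne', e, smul_smul, hq₀]
    · have e := h _ _ (.diag hij hab)
      have e' := h _ _ (.anti hij hab)
      simp [rmat, rcoef, hij.not_gt, hij.ne', hab, hab.ne, e, e']
    · have e := h _ _ (.col (α := α) hij)
      simp [rmat, rcoef, hij.not_gt, hij.ne', e, smul_smul, hq₀]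
    · have e := h _ _ (.anti hij hab)
      simp [rmat, rcoef, hij.not_gt, hij.ne', hab.not_gt, hab.ne', e]
  · intro h l r hr
    cases hr with
    | @row i α β hab =>
      have e := h i i β α
      simp only [rmat, rcoef, hab.not_gt, hab.ne', if_true, if_false, zero_smul, zero_add,
        add_zero] at e
      rw [← e, smul_smul, inv_mul_cancel₀ hq₀, one_smul]
    | @col i j α hij =>
      have e := h j i α α
      simp only [rmat, rcoef, hij.not_gt, hij.ne', if_true, if_false, zero_smul, zero_add,
        add_zero] at e
      rw [e, smul_smul, inv_mul_cancel₀ hq₀, one_smul]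
    | @anti i j α β hij hab =>
      have e := h i j β α
      simp only [rmat, rcoef, hij, hij.ne, hab, hab.ne, if_true, if_false] at e
      exact add_left_cancel e
    | @diag i j α β hij hab =>
      have e := h i j β α
      simp only [rmat, rcoef, hij, hij.ne, hab.not_gt, hab.ne', if_true, if_false, zero_smul,
        zero_add] at e
      rw [← e]; abel

/-- As a matrix indexed by pairs, `R` is symmetric, so it can be moved from one factor of a
contraction to the other. -/
theorem sum_rmat_mul (f g : Fin n → Fin n → A) :
    ∑ k, ∑ l, rmat q k l f * g k l = ∑ k, ∑ l, f k l * rmat q k l g := by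
  simp only [rmat, add_mul, mul_add, Finset.sum_add_distrib, smul_mul_assoc, mul_smul_comm]
  congr 1
  rw [Finset.sum_comm]
  refine Finset.sum_congr rfl fun k _ => Finset.sum_congr rfl fun l _ => ?_
  by_cases h : k = l
  · simp [h]
  · simp [h, Ne.symm h]

theorem rmat_sum_mul (i j : Fin n) (F : Fin n → Fin n → Fin n → Fin n → A)
    (g : Fin n → Fin n → A) :
    rmat q i j (fun k l => ∑ a, ∑ b, F k l a b * g a b)
      = ∑ a, ∑ b, rmat q i j (fun k l => F k l a b) * g a b := by
  simp only [rmat, Finset.smul_sum, add_mul, Finset.sum_add_distrib, smul_mul_assoc]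
  by_cases h : i = j <;> simp [h]

theorem rmat_sum_mul' (i j : Fin n) (F : Fin n → Fin n → Fin n → Fin n → A)
    (g : Fin n → Fin n → A) :
    rmat q i j (fun k l => ∑ a, ∑ b, g a b * F a b k l)
      = ∑ a, ∑ b, g a b * rmat q i j (fun k l => F a b k l) := by
  simp only [rmat, Finset.smul_sum, mul_add, Finset.sum_add_distrib, mul_smul_comm]
  by_cases h : i = j <;> simp [h]

variable {q}

/-- The product of two quantum matrices with mutually commuting entries is a quantum matrix. -/
theorem IsQMat.mul (hq₀ : q ≠ 0) {X Z : Fin n → Fin n → A} (hX : IsQMat q X) (hZ : IsQMat q Z)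
    (hc : ∀ i j k l, Commute (X i j) (Z k l)) :
    IsQMat q (fun i α => ∑ k, X i k * Z k α) := by
  rw [isQMat_iff q hq₀] at hX hZ ⊢
  have hW : ∀ i j α β, (∑ k, X i k * Z k α) * (∑ l, X j l * Z l β)
      = ∑ k, ∑ l, (X i k * X j l) * (Z k α * Z l β) := by
    intro i j α β
    rw [Finset.sum_mul_sum]
    refine Finset.sum_congr rfl fun k _ => Finset.sum_congr rfl fun l _ => ?_
    rw [mul_assoc, mul_assoc, ← mul_assoc (Z k α), ← (hc j l k α).eq, mul_assoc]
  intro i j α β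
  simp only [hW]
  rw [rmat_sum_mul q i j (fun k l a b => X k a * X l b),
    rmat_sum_mul' q α β (fun a b k l => Z a k * Z b l)]
  -- The relation for `X` turns `R` on outer rows into `R` on contracted indices, and the relation
  -- for `Z` does the same from the other side; symmetry of `R` identifies the two.
  simp only [hX, ← hZ]
  exact sum_rmat_mul q (fun a b => X i a * X j b) (fun a b => Z a α * Z b β)

theorem IsQMat.transpose {Y : Fin n → Fin n → A} (hY : IsQMat q Y) :
    IsQMat q (fun i α => Y α i) := by
  intro l r h
  cases h with
  | row h => exact hY _ _ (.col h)
  | col h => exact hY _ _ (.row h)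
  | anti h h' => exact (hY _ _ (.anti h' h)).symm
  | diag h h' => rw [hY _ _ (.diag h' h), hY _ _ (.anti h' h)]

end QMat

/-! ### Inversions and the quantum determinant -/

section Det

variable {n : ℕ}

/-- The number of inversions of a map between ordered finite sets. -/
def invMap (f : Fin n → Fin n) : ℕ :=
  (Finset.univ.filter fun p : Fin n × Fin n => p.1 < p.2 ∧ f p.2 < f p.1).card

theorem swap_adj_lt {k k' x y : Fin n} (hk : (k' : ℕ) = k + 1) (hxy : x < y)
    (hne : ¬(x = k ∧ y = k')) : Equiv.swap k k' x < Equiv.swap k k' y := by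
  simp only [Equiv.swap_apply_def, Fin.lt_def, Fin.ext_iff] at *
  split_ifs <;> omega

/-- An adjacent transposition preserves the order of every pair except `(k, k')`. Transporting pairs
along it therefore matches inversions, and `(k, k')` itself is the one new inversion. -/
theorem invMap_comp_swap {k k' : Fin n} (hk : (k' : ℕ) = k + 1) {f : Fin n → Fin n}
    (hf : f k < f k') : invMap (f ∘ Equiv.swap k k') = invMap f + 1 := by
  have hkk : k < k' := by rw [Fin.lt_def]; omega
  set s := Equiv.swap k k'
  have hss : ∀ x, s (s x) = x := Equiv.swap_apply_self k k'
  unfold invMap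
  have hset : (Finset.univ.filter fun p : Fin n × Fin n =>
        p.1 < p.2 ∧ (f ∘ s) p.2 < (f ∘ s) p.1)
      = insert (k, k') ((Finset.univ.filter fun p : Fin n × Fin n =>
        p.1 < p.2 ∧ f p.2 < f p.1).map (s.prodCongr s).toEmbedding) := by
    ext ⟨x, y⟩
    simp only [Finset.mem_filter, Finset.mem_univ, true_and, Finset.mem_insert, Finset.mem_map,
      Prod.exists, Function.comp_apply, Equiv.coe_toEmbedding, Equiv.prodCongr_apply,
      Prod.map_apply, Prod.mk.injEq]
    constructor
    · rintro ⟨h1, h2⟩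
      by_cases hne : x = k ∧ y = k'
      · exact Or.inl hne
      · exact Or.inr ⟨s x, s y, ⟨swap_adj_lt hk h1 hne, h2⟩, hss x, hss y⟩
    · rintro (⟨rfl, rfl⟩ | ⟨a, b, ⟨h1, h2⟩, rfl, rfl⟩)
      · exact ⟨hkk, by simpa [s] using hf⟩
      · refine ⟨swap_adj_lt hk h1 ?_, by simpa [hss] using h2⟩
        rintro ⟨rfl, rfl⟩
        exact absurd h2 hf.not_gt
  rw [hset, Finset.card_insert_of_notMem, Finset.card_map]
  simp only [Finset.mem_map, Finset.mem_filter, Finset.mem_univ, true_and, Prod.exists,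
    Equiv.coe_toEmbedding, Equiv.prodCongr_apply, Prod.map_apply, Prod.mk.injEq, not_exists,
    not_and]
  intro a b h1 ha hb
  have : a = k' := by rw [← hss a, ha]; simp [s]
  have : b = k := by rw [← hss b, hb]; simp [s]
  subst_vars
  exact absurd h1.1 hkk.not_gt

theorem finRange_split {k k' : Fin n} (hk : (k' : ℕ) = k + 1) :
    ∃ l₁ l₂ : List (Fin n), List.finRange n = l₁ ++ k :: k' :: l₂ ∧
      (∀ x ∈ l₁, x ≠ k ∧ x ≠ k') ∧ (∀ x ∈ l₂, x ≠ k ∧ x ≠ k') := by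
  have e : List.finRange n = (List.finRange n).take k ++ k :: k' :: (List.finRange n).drop (k' +
      1) := by
    conv_lhs => rw [← List.take_append_drop k (List.finRange n)]
    rw [List.drop_eq_getElem_cons (by simp), ← hk, List.drop_eq_getElem_cons (by simp)]
    simp
  refine ⟨_, _, e, ?_⟩
  have hd := List.nodup_finRange n
  rw [e] at hd
  simp only [List.nodup_append, List.nodup_cons, List.mem_cons] at hd
  obtain ⟨-, ⟨h1, h2, -⟩, h3⟩ := hd
  push Not at h1
  exact ⟨fun x hx => ⟨h3 x hx k (.inl rfl), h3 x hx k' (.inr (.inl rfl))⟩,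
    fun x hx => ⟨fun h => h1.2 (h ▸ hx), fun h => h2 (h ▸ hx)⟩⟩

variable {K : Type*} [Field K] {q : K} {A : Type*} [Ring A] [Algebra K A]

variable (q) in
/-- The quantum determinant of the array with rows `Y (f 0), Y (f 1), …`. -/
def qdetRows (Y : Fin n → Fin n → A) (f : Fin n → Fin n) : A :=
  ∑ σ : Equiv.Perm (Fin n), (-q) ^ invCount σ • (List.ofFn fun i => Y (f i) (σ i)).prod

/-- Pairing `σ` with `σ * swap k k'` collects the sum into `2 × 2` quantum minors on the rows in
positions `k, k'`. The outer factors `P` and `S` do not see these two rows, so one choice serves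
every `g`. -/
theorem qdetRows_pair (Y : Fin n → Fin n → A) {k k' : Fin n} (hk : (k' : ℕ) = k + 1)
    (f : Fin n → Fin n) :
    ∃ P S : Equiv.Perm (Fin n) → A,
      (∀ g : Fin n → Fin n, (∀ x, x ≠ k → x ≠ k' → g x = f x) →
      qdetRows q Y g = ∑ σ ∈ Finset.univ.filter (fun σ : Equiv.Perm (Fin n) => σ k < σ k'),
        (-q) ^ invCount σ • (P σ * (Y (g k) (σ k) * Y (g k') (σ k')
          - q • (Y (g k) (σ k') * Y (g k') (σ k))) * S σ)) := by
  obtain ⟨l₁, l₂, hl, h₁, h₂⟩ := finRange_split hk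
  have hkk : k ≠ k' := fun h => by rw [h] at hk; omega
  refine ⟨fun σ => (l₁.map fun i => Y (f i) (σ i)).prod,
    fun σ => (l₂.map fun i => Y (f i) (σ i)).prod, fun g hg => ?_⟩
  set s := Equiv.swap k k'
  have hprod : ∀ σ : Equiv.Perm (Fin n), (List.ofFn fun i => Y (g i) (σ i)).prod
      = (l₁.map fun i => Y (f i) (σ i)).prod * (Y (g k) (σ k) * Y (g k') (σ k'))
        * (l₂.map fun i => Y (f i) (σ i)).prod := by
    intro σ
    rw [List.ofFn_eq_map, hl, List.map_append, List.prod_append, List.map_cons, List.map_cons,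
      List.prod_cons, List.prod_cons,
      List.map_congr_left (g := fun i => Y (f i) (σ i)) (l := l₁)
        (fun x hx => by rw [hg x (h₁ x hx).1 (h₁ x hx).2]),
      List.map_congr_left (g := fun i => Y (f i) (σ i)) (l := l₂)
        (fun x hx => by rw [hg x (h₂ x hx).1 (h₂ x hx).2])]
    simp only [mul_assoc]
  have hs : ∀ (l : List (Fin n)), (∀ x ∈ l, x ≠ k ∧ x ≠ k') → ∀ σ : Equiv.Perm (Fin n),
      (l.map fun i => Y (f i) ((σ * s) i)) = l.map fun i => Y (f i) (σ i) := by
    intro l hl σ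
    refine List.map_congr_left fun x hx => ?_
    rw [Equiv.Perm.mul_apply, Equiv.swap_apply_of_ne_of_ne (hl x hx).1 (hl x hx).2]
  unfold qdetRows
  rw [← Finset.sum_filter_add_sum_filter_not _ (fun σ : Equiv.Perm (Fin n) => σ k < σ k')]
  have hbij : ∑ σ ∈ Finset.univ.filter (fun σ : Equiv.Perm (Fin n) => ¬ σ k < σ k'),
        (-q) ^ invCount σ • (List.ofFn fun i => Y (g i) (σ i)).prod
      = ∑ σ ∈ Finset.univ.filter (fun σ : Equiv.Perm (Fin n) => σ k < σ k'),
        (-q) ^ invCount (σ * s) • (List.ofFn fun i => Y (g i) ((σ * s) i)).prod := by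
    refine Finset.sum_nbij' (fun σ => σ * s) (fun σ => σ * s) ?_ ?_ ?_ ?_ ?_
    · intro σ hσ
      simp only [Finset.mem_filter, Finset.mem_univ, true_and, not_lt] at hσ ⊢
      simp only [s, Equiv.Perm.mul_apply, Equiv.swap_apply_left, Equiv.swap_apply_right]
      exact lt_of_le_of_ne hσ (fun h => hkk (σ.injective h).symm)
    · intro σ hσ
      simp only [Finset.mem_filter, Finset.mem_univ, true_and, not_lt] at hσ ⊢
      simp only [s, Equiv.Perm.mul_apply, Equiv.swap_apply_left, Equiv.swap_apply_right]
      exact hσ.le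
    · intro σ _; simp [s, mul_assoc]
    · intro σ _; simp [s, mul_assoc]
    · intro σ _; simp [s, mul_assoc]
  rw [hbij, ← Finset.sum_add_distrib]
  refine Finset.sum_congr rfl fun σ hσ => ?_
  simp only [Finset.mem_filter, Finset.mem_univ, true_and] at hσ
  have hinv : invCount (σ * s) = invCount σ + 1 := invMap_comp_swap hk hσ
  rw [hprod, hprod, hinv, hs l₁ h₁, hs l₂ h₂]
  simp only [s, Equiv.Perm.mul_apply, Equiv.swap_apply_left, Equiv.swap_apply_right]
  rw [pow_succ, mul_smul, ← smul_add, neg_smul, mul_sub, sub_mul, mul_smul_comm, smul_mul_assoc,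
    sub_eq_add_neg]

/-- By the `anti` and `diag` relations, interchanging the rows of a `2 × 2` quantum minor multiplies
it by `-q`. -/
theorem qdetRows_comp_swap {Y : Fin n → Fin n → A} (hq₀ : q ≠ 0) (hY : IsQMat q Y)
    {k k' : Fin n} (hk : (k' : ℕ) = k + 1)
    {f : Fin n → Fin n} (hf : f k < f k') :
    qdetRows q Y (f ∘ Equiv.swap k k') = (-q) • qdetRows q Y f := by
  obtain ⟨P, S, h⟩ := qdetRows_pair (q := q) Y hk f
  rw [h f fun _ _ _ => rfl, h (f ∘ Equiv.swap k k') fun x h1 h2 => by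
    rw [Function.comp_apply, Equiv.swap_apply_of_ne_of_ne h1 h2], Finset.smul_sum]
  refine Finset.sum_congr rfl fun σ hσ => ?_
  simp only [Finset.mem_filter, Finset.mem_univ, true_and] at hσ
  simp only [Function.comp_apply, Equiv.swap_apply_left, Equiv.swap_apply_right]
  have e1 := hY _ _ (.anti hf hσ)
  have e2 := hY _ _ (.diag hf hσ)
  have e3 : ∀ u v : A, u - q • (v - (q - q⁻¹) • u) = (-q) • (v - q • u) := by
    intro u v
    match_scalars
    · field_simp; ring
    · ring
  rw [e1, e2, e3, smul_comm (-q), mul_smul_comm, smul_mul_assoc]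

/-- With equal rows each `2 × 2` minor vanishes by the `row` relation. -/
theorem qdetRows_eq_zero {Y : Fin n → Fin n → A} (hq₀ : q ≠ 0) (hY : IsQMat q Y)
    {k k' : Fin n} (hk : (k' : ℕ) = k + 1)
    {f : Fin n → Fin n} (hf : f k = f k') : qdetRows q Y f = 0 := by
  obtain ⟨P, S, h⟩ := qdetRows_pair (q := q) Y hk f
  rw [h f fun _ _ _ => rfl]
  refine Finset.sum_eq_zero fun σ hσ => ?_
  simp only [Finset.mem_filter, Finset.mem_univ, true_and] at hσ
  rw [hf, hY _ _ (.row (i := f k') hσ), smul_smul, mul_inv_cancel₀ hq₀, one_smul, sub_self,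
    mul_zero, zero_mul, smul_zero]

/-- Bubble sort: each descent of `f` is removed at the cost of a factor `-q`. A map without descents
is the identity or takes equal values at two neighbours. -/
theorem qdetRows_eq {Y : Fin n → Fin n → A} (hq₀ : q ≠ 0) (hY : IsQMat q Y) (f : Fin n → Fin n) :
    qdetRows q Y f = if Function.Injective f then (-q) ^ invMap f • qdet q Y else 0 := by
  induction hm : invMap f using Nat.strong_induction_on generalizing f with
  | _ m ih =>
  by_cases hdesc : ∃ k k' : Fin n, (k' : ℕ) = k + 1 ∧ f k' < f k
  · obtain ⟨k, k', hk, hlt⟩ := hdesc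
    set g := f ∘ Equiv.swap k k' with hg
    have hgf : g ∘ Equiv.swap k k' = f := by
      ext x; simp [hg]
    have hgk : g k < g k' := by simpa [hg] using hlt
    have hinv := invMap_comp_swap hk hgk
    rw [hgf, hm] at hinv
    rw [← hgf, qdetRows_comp_swap hq₀ hY hk hgk, ih (invMap g) (by omega) g rfl]
    have hinj : Function.Injective (g ∘ Equiv.swap k k') ↔ Function.Injective g :=
      Equiv.injective_comp _ _
    simp only [hinj]
    split_ifs
    · rw [hinv, pow_succ', mul_smul]
    · simp
  · push Not at hdesc
    have hmono : Monotone f := by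
      rcases n with _ | n
      · exact fun x => x.elim0
      · refine Fin.monotone_iff_le_succ.2 fun i => hdesc _ _ (by simp)
    by_cases hadj : ∃ k k' : Fin n, (k' : ℕ) = k + 1 ∧ f k = f k'
    · obtain ⟨k, k', hk, he⟩ := hadj
      rw [qdetRows_eq_zero hq₀ hY hk he, if_neg]
      intro hi
      have := hi he
      rw [this] at hk; omega
    · push Not at hadj
      have hstrict : StrictMono f := by
        rcases n with _ | n
        · exact fun x => x.elim0
        · exact Fin.strictMono_iff_lt_succ.2 fun i =>
            lt_of_le_of_ne (hdesc _ _ (by simp)) (hadj _ _ (by simp))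
      have hid : f = id := by
        have : (⟨f, hstrict.monotone⟩ : Fin n →o Fin n) = OrderHom.id := by
          have := Subsingleton.elim (α := Fin n ≃o Fin n)
            (StrictMono.orderIsoOfSurjective f hstrict
              (Finite.surjective_of_injective hstrict.injective)) (OrderIso.refl _)
          ext x
          exact congrArg Fin.val (DFunLike.congr_fun this x)
        exact congrArg DFunLike.coe this
      subst hid
      have : invMap (id : Fin n → Fin n) = 0 := by
        unfold invMap
        rw [Finset.card_eq_zero, Finset.filter_eq_empty_iff]
        rintro ⟨x, y⟩ - ⟨h1, h2⟩
        exact absurd h1 h2.not_gt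
      rw [← hm, this, if_pos Function.injective_id, pow_zero, one_smul]
      rfl

theorem prod_ofFn_sum {ι : Type*} [Fintype ι] [DecidableEq ι] {m : ℕ} (g : Fin m → ι → A) :
    (List.ofFn fun i => ∑ k, g i k).prod = ∑ f : Fin m → ι,
        (List.ofFn fun i => g i (f i)).prod := by
  induction m with
  | zero => simp
  | succ m ih =>
    rw [List.ofFn_succ, List.prod_cons, ih, ← (Fin.consEquiv fun _ => ι).sum_comp,
      Fintype.sum_prod_type, Finset.sum_mul_sum]
    simp [Fin.consEquiv]

theorem prod_ofFn_mul {m : ℕ} (g h : Fin m → A) (hc : ∀ i j, Commute (g i) (h j)) :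
    (List.ofFn fun i => g i * h i).prod = (List.ofFn g).prod * (List.ofFn h).prod := by
  induction m with
  | zero => simp
  | succ m ih =>
    simp only [List.ofFn_succ, List.prod_cons]
    rw [ih _ _ fun i j => hc _ _]
    have : Commute (h 0) (List.ofFn fun i : Fin m => g i.succ).prod := by
      refine Commute.list_prod_right _ _ fun x hx => ?_
      obtain ⟨i, rfl⟩ := (List.mem_ofFn' _ _).1 hx
      exact (hc _ _).symm
    rw [mul_assoc, mul_assoc, ← mul_assoc (h 0), this.eq, mul_assoc]

/-- Multiplicativity of the quantum determinant. -/
theorem qdet_mul (hq₀ : q ≠ 0) {X Z : Fin n → Fin n → A} (hZ : IsQMat q Z)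
    (hc : ∀ i j k l, Commute (X i j) (Z k l)) :
    qdet q (fun i α => ∑ k, X i k * Z k α) = qdet q X * qdet q Z := by
  have h1 : qdet q (fun i α => ∑ k, X i k * Z k α)
      = ∑ f : Fin n → Fin n, (List.ofFn fun i => X i (f i)).prod * qdetRows q Z f := by
    unfold qdet qdetRows
    simp only [prod_ofFn_sum, Finset.smul_sum, Finset.mul_sum]
    rw [Finset.sum_comm]
    refine Finset.sum_congr rfl fun f _ => Finset.sum_congr rfl fun σ _ => ?_
    rw [prod_ofFn_mul _ _ fun i j => hc _ _ _ _, mul_smul_comm]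
  rw [h1]
  simp only [qdetRows_eq hq₀ hZ]
  unfold qdet
  rw [Finset.sum_mul]
  symm
  -- In the expansion over all maps `f`, only the injective ones survive, and these are the
  -- permutations.
  refine Finset.sum_of_injOn (fun σ : Equiv.Perm (Fin n) => (σ : Fin n → Fin n))
    (fun σ _ τ _ h => DFunLike.coe_injective h) (fun _ _ => Finset.mem_coe.2 (Finset.mem_univ _))
        ?_ ?_
  · intro f _ hf
    rw [if_neg, mul_zero]
    intro hinj
    exact hf ⟨Equiv.ofBijective f (Finite.injective_iff_bijective.1 hinj), by simp, rfl⟩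
  · intro σ _
    rw [if_pos σ.injective, mul_smul_comm, smul_mul_assoc]
    rfl

theorem perm_eq_one_of_le {σ : Equiv.Perm (Fin n)} (h : ∀ i, σ i ≤ i) : σ = 1 := by
  ext i
  induction hi : (i : ℕ) using Nat.strong_induction_on generalizing i with
  | _ m ih =>
  rcases (h i).lt_or_eq with hlt | heq
  · have := ih (σ i) (by rw [← hi]; exact hlt) (σ i) rfl
    have h2 : σ (σ i) = σ i := Fin.ext this
    have := σ.injective h2
    simp [this, hi]
  · simp [heq, hi]

theorem invCount_one : invCount (1 : Equiv.Perm (Fin n)) = 0 := by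
  unfold invCount
  rw [Finset.card_eq_zero, Finset.filter_eq_empty_iff]
  rintro ⟨x, y⟩ - ⟨h1, h2⟩
  exact absurd h1 h2.not_gt

theorem qdet_eq_of_forall (Y : Fin n → Fin n → A)
    (h : ∀ σ : Equiv.Perm (Fin n), σ ≠ 1 → ∃ i, Y i (σ i) = 0) :
    qdet q Y = (List.ofFn fun i => Y i i).prod := by
  unfold qdet
  rw [Finset.sum_eq_single 1]
  · simp [invCount_one]
  · intro σ _ hσ
    obtain ⟨i, hi⟩ := h σ hσ
    rw [List.prod_eq_zero, smul_zero]
    rw [← hi]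
    exact (List.mem_ofFn' _ _).2 ⟨i, rfl⟩
  · simp

theorem qdet_lower (Y : Fin n → Fin n → A) (h : ∀ i j, i < j → Y i j = 0) :
    qdet q Y = (List.ofFn fun i => Y i i).prod := by
  refine qdet_eq_of_forall Y fun σ hσ => ?_
  by_contra! hc
  exact hσ (perm_eq_one_of_le fun i => not_lt.1 fun hi => hc i (h _ _ hi))

theorem qdet_upper (Y : Fin n → Fin n → A) (h : ∀ i j, j < i → Y i j = 0) :
    qdet q Y = (List.ofFn fun i => Y i i).prod := by
  refine qdet_eq_of_forall Y fun σ hσ => ?_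
  by_contra! hc
  have : σ⁻¹ = 1 := perm_eq_one_of_le fun i => not_lt.1 fun hi =>
    hc (σ⁻¹ i) (h _ _ (by simpa using hi))
  exact hσ (inv_eq_one.1 this)

end Det

/-! ### Weighted shift operators -/

section Shift

variable {K : Type*} [Field K] {Γ : Type*} [AddCommGroup Γ]

/-- The weighted shift `γ ↦ w γ • (γ + δ)` on finitely supported functions. -/
def wshift (δ : Γ) (w : Γ → K) : Module.End K (Γ →₀ K) :=
  Finsupp.lsum K fun γ => w γ • Finsupp.lsingle (γ + δ)

@[simp]
theorem wshift_single (δ : Γ) (w : Γ → K) (γ : Γ) (c : K) :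
    wshift δ w (Finsupp.single γ c) = Finsupp.single (γ + δ) (w γ * c) := by
  simp [wshift]

theorem wshift_apply (δ : Γ) (w : Γ → K) (v : Γ →₀ K) (γ : Γ) :
    wshift δ w v γ = w (γ - δ) * v (γ - δ) := by
  classical
  induction v using Finsupp.induction_linear with
  | zero => simp
  | add f g hf hg => simp [hf, hg, mul_add]
  | single a b =>
    rw [wshift_single, Finsupp.single_apply, Finsupp.single_apply]
    by_cases h : a + δ = γ
    · have h' : a = γ - δ := eq_sub_of_add_eq h
      simp [h']
    · have h' : a ≠ γ - δ := fun e => h (by rw [e, sub_add_cancel])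
      simp [h, h']

theorem wshift_mul (δ δ' : Γ) (w w' : Γ → K) :
    wshift δ w * wshift δ' w' = wshift (δ' + δ) (fun γ => w (γ + δ') * w' γ) := by
  refine Finsupp.lhom_ext fun γ c => ?_
  rw [Module.End.mul_apply, wshift_single, wshift_single, wshift_single, add_assoc, mul_assoc]

theorem wshift_congr {δ δ' : Γ} {w w' : Γ → K} (h : δ = δ') (hw : ∀ γ, w γ = w' γ) :
    wshift δ w = wshift δ' w' := by
  rw [h, funext hw]

theorem smul_wshift (c : K) (δ : Γ) (w : Γ → K) : c • wshift δ w = wshift δ fun γ => c * w γ := by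
  refine Finsupp.lhom_ext fun γ d => ?_
  rw [LinearMap.smul_apply, wshift_single, wshift_single, Finsupp.smul_single, smul_eq_mul,
    mul_assoc]

theorem wshift_one : wshift (0 : Γ) (fun _ => (1 : K)) = 1 := by
  refine Finsupp.lhom_ext fun γ d => ?_
  simp

theorem wshift_commute {δ δ' : Γ} {w w' : Γ → K}
    (h : ∀ γ, w (γ + δ') * w' γ = w' (γ + δ) * w γ) : Commute (wshift δ w) (wshift δ' w') := by
  rw [Commute, SemiconjBy, wshift_mul, wshift_mul]
  exact wshift_congr (add_comm _ _) h

/-- Functions supported in cost at least `c`. -/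
def costGE (K : Type*) [Field K] (κ : Γ →+ ℤ) (c : ℤ) : Submodule K (Γ →₀ K) :=
  Finsupp.supported K K {γ | c ≤ κ γ}

theorem costGE_anti (κ : Γ →+ ℤ) {c d : ℤ} (h : c ≤ d) : costGE K κ d ≤ costGE K κ c :=
  Finsupp.supported_mono fun _ hγ => h.trans hγ

theorem single_mem_costGE (κ : Γ →+ ℤ) {γ : Γ} {c : ℤ} (h : c ≤ κ γ) (a : K) :
    Finsupp.single γ a ∈ costGE K κ c :=
  Finsupp.single_mem_supported K a h

/-- `T` raises the cost by at least `c`. -/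
def Raises (κ : Γ →+ ℤ) (T : Module.End K (Γ →₀ K)) (c : ℤ) : Prop :=
  ∀ γ, T (Finsupp.single γ 1) ∈ costGE K κ (κ γ + c)

theorem Raises.apply_mem {κ : Γ →+ ℤ} {T : Module.End K (Γ →₀ K)} {c : ℤ} (h : Raises κ T c)
    {d : ℤ} {v : Γ →₀ K} (hv : v ∈ costGE K κ d) : T v ∈ costGE K κ (d + c) := by
  rw [← Finsupp.sum_single v, Finsupp.sum, map_sum]
  refine Submodule.sum_mem _ fun γ hγ => ?_
  rw [← mul_one (v γ), ← smul_eq_mul, ← Finsupp.smul_single, map_smul]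
  have : d ≤ κ γ := hv hγ
  exact Submodule.smul_mem _ _ (costGE_anti κ (by omega) (h γ))

theorem Raises.mono {κ : Γ →+ ℤ} {T : Module.End K (Γ →₀ K)} {c d : ℤ} (h : Raises κ T d)
    (hcd : c ≤ d) : Raises κ T c := fun γ => costGE_anti κ (by omega) (h γ)

theorem Raises.zero {κ : Γ →+ ℤ} (c : ℤ) : Raises κ (0 : Module.End K (Γ →₀ K)) c :=
  fun _ => Submodule.zero_mem _

theorem Raises.sum {κ : Γ →+ ℤ} {ι : Type*} (s : Finset ι) {T : ι → Module.End K (Γ →₀ K)}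
    {c : ℤ} (h : ∀ i ∈ s, Raises κ (T i) c) : Raises κ (∑ i ∈ s, T i) c := fun γ => by
  rw [LinearMap.sum_apply]
  exact Submodule.sum_mem _ fun i hi => h i hi γ

/-- `T` shifts by `δ`, with nonzero weights, up to terms of higher cost. -/
def Leads (κ : Γ →+ ℤ) (T : Module.End K (Γ →₀ K)) (δ : Γ) : Prop :=
  ∀ γ, ∃ u : K, u ≠ 0 ∧
    T (Finsupp.single γ 1) - Finsupp.single (γ + δ) u ∈ costGE K κ (κ γ + κ δ + 1)

theorem Leads.raises {κ : Γ →+ ℤ} {T : Module.End K (Γ →₀ K)} {δ : Γ} (h : Leads κ T δ) :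
    Raises κ T (κ δ) := fun γ => by
  obtain ⟨u, -, hu⟩ := h γ
  have := Submodule.add_mem _ (costGE_anti κ (by omega : κ γ + κ δ ≤ _) hu)
    (single_mem_costGE (K := K) κ (by simp : κ γ + κ δ ≤ κ (γ + δ)) u)
  simpa using this

/-- The weights multiply, so they stay nonzero, and each of the two error terms has cost at least
one above that of the combined shift. -/
theorem Leads.mul {κ : Γ →+ ℤ} {S T : Module.End K (Γ →₀ K)} {δ ε : Γ} (hS : Leads κ S δ)
    (hT : Leads κ T ε) : Leads κ (S * T) (δ + ε) := fun γ => by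
  obtain ⟨u, hu0, hu⟩ := hT γ
  obtain ⟨v, hv0, hv⟩ := hS (γ + ε)
  refine ⟨u * v, mul_ne_zero hu0 hv0, ?_⟩
  have h1 := hS.raises.apply_mem hu
  have h2 := Submodule.smul_mem _ u hv
  rw [map_sub] at h1
  rw [smul_sub, ← map_smul, Finsupp.smul_single, Finsupp.smul_single, smul_eq_mul, mul_one,
    smul_eq_mul] at h2
  have h3 := Submodule.add_mem _ (costGE_anti κ (by simp; omega :
    κ γ + κ (δ + ε) + 1 ≤ _) h1) (costGE_anti κ (by simp; omega :
    κ γ + κ (δ + ε) + 1 ≤ _) h2)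
  rw [Module.End.mul_apply, add_comm δ, ← add_assoc]
  convert h3 using 1
  · simp [add_comm, add_left_comm]
  · abel

theorem Leads.add {κ : Γ →+ ℤ} {S T : Module.End K (Γ →₀ K)} {δ : Γ} (hS : Leads κ S δ)
    (hT : Raises κ T (κ δ + 1)) : Leads κ (S + T) δ := fun γ => by
  obtain ⟨u, hu0, hu⟩ := hS γ
  refine ⟨u, hu0, ?_⟩
  have := Submodule.add_mem _ hu (costGE_anti κ (by omega) (hT γ))
  rwa [LinearMap.add_apply, add_sub_right_comm]

theorem leads_wshift (κ : Γ →+ ℤ) (δ : Γ) {w : Γ → K} (hw : ∀ γ, w γ ≠ 0) :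
    Leads κ (wshift δ w) δ := fun γ => ⟨w γ, hw γ, by simp⟩

theorem leads_one (κ : Γ →+ ℤ) : Leads κ (1 : Module.End K (Γ →₀ K)) 0 :=
  fun γ => ⟨1, one_ne_zero, by simp⟩

end Shift

/-! ### A faithful representation by weighted shifts -/

section PathModel

variable {K : Type*} [Field K] (q : K) (n : ℕ)

/-- The variables of the path model: step variables and diagonal variables. -/
abbrev PathVar : Type := (Bool × ℕ × ℕ) ⊕ ℕ

/-- The exponents of the path model. -/
abbrev PathExp : Type := PathVar →₀ ℤ

/-- The cost of exponents: a step at stage `k` costs `k + 1`. -/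
def pathCost : PathExp →+ ℤ :=
  Finsupp.liftAddHom fun v => AddMonoidHom.mulRight (v.elim (fun x => (x.2.1 : ℤ) + 1) fun _ => 0)

theorem pathCost_step (b : Bool) (k j : ℕ) (c : ℤ) :
    pathCost (Finsupp.single (.inl (b, k, j)) c) = c * (k + 1) := by
  simp [pathCost]

theorem pathCost_diag (j : ℕ) (c : ℤ) : pathCost (Finsupp.single (.inr j) c) = 0 := by
  simp [pathCost]

/-- The boundary-adjusted coordinates at a stage. -/
def stageCoord (b : Bool) (k j : ℕ) (γ : PathExp) : ℤ :=
  if 0 < j ∧ j < n then γ (.inl (b, k, j)) else 0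

/-- The lower bidiagonal quantum matrix at stage `k`. -/
def bidiag (b : Bool) (k : ℕ) (i j : Fin n) : Module.End K (PathExp →₀ K) :=
  if i = j then wshift 0 fun γ => q ^ (stageCoord n b k (j + 1) γ - stageCoord n b k j γ)
  else if (i : ℕ) = j + 1 then wshift (Finsupp.single (.inl (b, k, (j : ℕ) + 1)) 1) fun _ => 1
  else 0

variable {q n}

theorem stageCoord_add (b : Bool) (k j : ℕ) (γ δ : PathExp) :
    stageCoord n b k j (γ + δ) = stageCoord n b k j γ + stageCoord n b k j δ := by
  unfold stageCoord; split_ifs <;> simp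

theorem stageCoord_single (b b' : Bool) (k k' j j' : ℕ) (hj : 0 < j') (hj' : j' < n) :
    stageCoord n b k j (Finsupp.single (.inl (b', k', j')) 1)
      = if b = b' ∧ k = k' ∧ j = j' then 1 else 0 := by
  unfold stageCoord
  by_cases h : b = b' ∧ k = k' ∧ j = j'
  · obtain ⟨rfl, rfl, rfl⟩ := h
    simp [hj, hj']
  · rw [if_neg h]
    split_ifs
    · rw [Finsupp.single_apply, if_neg]
      rintro h'
      simp only [Sum.inl.injEq, Prod.mk.injEq] at h'
      exact h ⟨h'.1.symm, h'.2.1.symm, h'.2.2.symm⟩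
    · rfl

theorem bidiag_diag (b : Bool) (k : ℕ) (j : Fin n) : bidiag q n b k j j =
    wshift 0 fun γ => q ^ (stageCoord n b k (j + 1) γ - stageCoord n b k j γ) := by
  simp [bidiag]

theorem bidiag_step (b : Bool) (k : ℕ) {i j : Fin n} (h : (i : ℕ) = j + 1) : bidiag q n b k i j =
    wshift (Finsupp.single (.inl (b, k, (j : ℕ) + 1)) 1) fun _ => 1 := by
  have : i ≠ j := fun e => by rw [e] at h; omega
  simp [bidiag, this, h]

theorem bidiag_zero (b : Bool) (k : ℕ) {i j : Fin n} (h : i ≠ j) (h' : (i : ℕ) ≠ j + 1) :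
    bidiag q n b k i j = 0 := by
  simp [bidiag, h, h']

theorem bidiag_cases (b : Bool) (k : ℕ) (i j : Fin n) :
    i = j ∨ (i : ℕ) = j + 1 ∨ bidiag q n b k i j = 0 := by
  by_cases h : i = j
  · exact .inl h
  · by_cases h' : (i : ℕ) = j + 1
    · exact .inr (.inl h')
    · exact .inr (.inr (bidiag_zero b k h h'))

/-- The weight of the diagonal entry `i` reads only the two step variables adjacent to it, so it
`q`-commutes nontrivially only with the steps of the same stage in its column and in its row. -/
theorem bidiag_diag_step (hq₀ : q ≠ 0) (b b' : Bool) (k k' : ℕ) (i : Fin n) {l m : Fin n}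
    (h : (l : ℕ) = m + 1) :
    bidiag q n b k i i * bidiag q n b' k' l m
      = q ^ ((if b = b' ∧ k = k' ∧ i = m then 1 else 0)
        - (if b = b' ∧ k = k' ∧ i = l then 1 else 0) : ℤ)
        • (bidiag q n b' k' l m * bidiag q n b k i i) := by
  rw [bidiag_diag, bidiag_step b' k' h, wshift_mul, wshift_mul, smul_wshift]
  have hm : (m : ℕ) + 1 < n := h ▸ l.2
  refine wshift_congr (add_comm _ _) fun γ => ?_
  have hp : 0 < (m : ℕ) + 1 := Nat.succ_pos _
  rw [stageCoord_add, stageCoord_add, stageCoord_single _ _ _ _ _ _ hp hm,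
    stageCoord_single _ _ _ _ _ _ hp hm, one_mul, mul_one, ← zpow_add₀ hq₀]
  congr 1
  simp only [Fin.ext_iff, h, Nat.add_right_cancel_iff]
  ring

theorem bidiag_commute_diag (b b' : Bool) (k k' : ℕ) (i j : Fin n) :
    Commute (bidiag q n b k i i) (bidiag q n b' k' j j) := by
  rw [bidiag_diag, bidiag_diag]
  exact wshift_commute fun γ => by simp [mul_comm]

theorem bidiag_commute_step (b b' : Bool) (k k' : ℕ) {i j l m : Fin n} (h : (i : ℕ) = j + 1)
    (h' : (l : ℕ) = m + 1) : Commute (bidiag q n b k i j) (bidiag q n b' k' l m) := by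
  rw [bidiag_step _ _ h, bidiag_step _ _ h']
  exact wshift_commute fun γ => rfl

theorem bidiag_commute (hq₀ : q ≠ 0) {b b' : Bool} {k k' : ℕ} (h : ¬(b = b' ∧ k = k'))
    (i j l m : Fin n) : Commute (bidiag q n b k i j) (bidiag q n b' k' l m) := by
  have key : ∀ {b b' : Bool} {k k' : ℕ}, ¬(b = b' ∧ k = k') → ∀ (i : Fin n) {l m : Fin n},
      (l : ℕ) = m + 1 → Commute (bidiag q n b k i i) (bidiag q n b' k' l m) := by
    intro b b' k k' h i l m hlm
    have h1 : ∀ P : Prop, ¬(b = b' ∧ k = k' ∧ P) := fun P e => h ⟨e.1, e.2.1⟩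
    rw [Commute, SemiconjBy, bidiag_diag_step hq₀ b b' k k' i hlm, if_neg (h1 _), if_neg (h1 _)]
    simp
  rcases bidiag_cases (q := q) b k i j with rfl | hij | hij
  · rcases bidiag_cases (q := q) b' k' l m with rfl | hlm | hlm
    · exact bidiag_commute_diag ..
    · exact key h _ hlm
    · rw [hlm]; exact Commute.zero_right _
  · rcases bidiag_cases (q := q) b' k' l m with rfl | hlm | hlm
    · exact (key (fun e => h ⟨e.1.symm, e.2.symm⟩) _ hij).symm
    · exact bidiag_commute_step _ _ _ _ hij hlm
    · rw [hlm]; exact Commute.zero_right _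
  · rw [hij]; exact Commute.zero_left _

theorem eq_sub_smul_of_eq_zero {A : Type*} [Ring A] [Algebra K A] {x y z : A} {c : K}
    (hz : z = 0) (h : x = y) : x = y - c • z := by
  rw [hz, smul_zero, sub_zero, h]

/-- Two lower bidiagonal positions are never in antidiagonal position (`i < j`, `α < β`, entries
`(i, β)` and `(j, α)`), so the correction term vanishes and the `diag` relation becomes commutation.
-/
theorem isQMat_bidiag (hq₀ : q ≠ 0) (b : Bool) (k : ℕ) : IsQMat q (bidiag q n b k) := by
  have hds : ∀ (i : Fin n) {l m : Fin n}, (l : ℕ) = m + 1 → i ≠ m → i ≠ l →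
      Commute (bidiag q n b k i i) (bidiag q n b k l m) := by
    intro i l m h h1 h2
    rw [Commute, SemiconjBy, bidiag_diag_step hq₀ b b k k i h]
    simp [h1, h2]
  intro l r h
  cases h with
  | @row i α β h =>
    rcases bidiag_cases (q := q) b k i β with rfl | hb | hb
    · rcases bidiag_cases (q := q) b k i α with rfl | ha | ha
      · exact absurd h (lt_irrefl _)
      · rw [bidiag_diag_step hq₀ b b k k i ha]
        simp [h.ne']
      · simp [ha]
    · rw [bidiag_zero b k (j := α) (by rintro rfl; rw [Fin.lt_def] at h; omega)
        (by rw [Fin.lt_def] at h; omega)]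
      simp
    · simp [hb]
  | @col i j α h =>
    rcases bidiag_cases (q := q) b k i α with rfl | hb | hb
    · rcases bidiag_cases (q := q) b k j i with rfl | ha | ha
      · exact absurd h (lt_irrefl _)
      · rw [bidiag_diag_step hq₀ b b k k i ha]
        simp [h.ne, smul_smul, hq₀]
      · simp [ha]
    · rw [bidiag_zero b k (i := j) (by rintro rfl; rw [Fin.lt_def] at h; omega)
        (by rw [Fin.lt_def] at h; omega)]
      simp
    · simp [hb]
  | @anti i j α β h h' =>
    rw [Fin.lt_def] at h h'
    rcases bidiag_cases (q := q) b k i α with rfl | ha | ha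
    · rw [bidiag_zero b k (i := j) (j := β) (by rintro rfl; omega) (by omega)]
      simp
    · rw [bidiag_zero b k (i := j) (j := β) (by rintro rfl; omega) (by omega)]
      simp
    · simp [ha]
  | @diag i j α β h h' =>
    rw [Fin.lt_def] at h h'
    have h0 : bidiag q n b k i β * bidiag q n b k j α = 0 := by
      rcases bidiag_cases (q := q) b k i β with rfl | hb | hb
      · rw [bidiag_zero b k (i := j) (j := α) (by rintro rfl; omega) (by omega), mul_zero]
      · rw [bidiag_zero b k (i := j) (j := α) (by rintro rfl; omega) (by omega), mul_zero]
      · rw [hb, zero_mul]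
    refine eq_sub_smul_of_eq_zero (A := Module.End K (PathExp →₀ K)) h0 ?_
    rcases bidiag_cases (q := q) b k i α with rfl | ha | ha
    · rcases bidiag_cases (q := q) b k j β with rfl | hb | hb
      · exact bidiag_commute_diag ..
      · refine (hds _ hb ?_ ?_).symm.eq <;> rw [Ne, Fin.ext_iff] <;> omega
      · simp [hb]
    · rcases bidiag_cases (q := q) b k j β with rfl | hb | hb
      · refine (hds _ ha ?_ ?_).eq <;> rw [Ne, Fin.ext_iff] <;> omega
      · exact bidiag_commute_step _ _ _ _ hb ha
      · simp [hb]
    · simp [ha]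

theorem prod_ofFn_wshift_zero {Γ : Type*} [AddCommGroup Γ] {m : ℕ} (w : Fin m → Γ → K) :
    (List.ofFn fun i => wshift (0 : Γ) (w i)).prod = wshift 0 fun γ => ∏ i, w i γ := by
  induction m with
  | zero => simp [wshift_one]
  | succ m ih =>
    rw [List.ofFn_succ, List.prod_cons, ih, wshift_mul]
    exact wshift_congr (by simp) fun γ => by simp [Fin.prod_univ_succ]

/-- The exponents on the diagonal telescope to the difference of the two boundary coordinates, which
`stageCoord` sets to zero. -/
theorem qdet_bidiag (hq₀ : q ≠ 0) (b : Bool) (k : ℕ) : qdet q (bidiag q n b k) = 1 := by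
  rw [qdet_lower _ fun i j h => by
    rw [Fin.lt_def] at h
    exact bidiag_zero b k (by rintro rfl; omega) (by omega)]
  simp only [bidiag_diag]
  rw [prod_ofFn_wshift_zero, ← wshift_one]
  refine wshift_congr rfl fun γ => ?_
  rw [Fin.prod_univ_eq_prod_range (fun i => q ^ (stageCoord n b k (i + 1) γ - stageCoord n b k i
      γ)),
    ← zpow_zero q]
  have : ∀ m, ∏ i ∈ Finset.range m, q ^ (stageCoord n b k (i + 1) γ - stageCoord n b k i γ)
      = q ^ (stageCoord n b k m γ - stageCoord n b k 0 γ) := by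
    intro m
    induction m with
    | zero => simp
    | succ m ih => rw [Finset.prod_range_succ, ih, ← zpow_add₀ hq₀]; congr 1; ring
  rw [this]
  simp [stageCoord]

variable (q n)

/-- The product of the first `k` lower bidiagonal matrices. -/
def lowerMat (b : Bool) : ℕ → Fin n → Fin n → Module.End K (PathExp →₀ K)
  | 0 => fun i j => if i = j then 1 else 0
  | k + 1 => fun i j => ∑ l, lowerMat b k i l * bidiag q n b k l j

variable {q n}

theorem lowerMat_commute (hq₀ : q ≠ 0) {b b' : Bool} {k k' : ℕ} (h : b = b' → k ≤ k')
    (i j l m : Fin n) : Commute (lowerMat q n b k i j) (bidiag q n b' k' l m) := by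
  induction k generalizing i j with
  | zero =>
    simp only [lowerMat]
    split_ifs
    · exact Commute.one_left _
    · exact Commute.zero_left _
  | succ k ih =>
    refine Commute.sum_left _ _ _ fun s _ => Commute.mul_left (ih (fun e => by have := h e; omega)
        _ _)
      (bidiag_commute hq₀ ?_ _ _ _ _)
    rintro ⟨e1, e2⟩
    have := h e1; omega

theorem lowerMat_commute_lowerMat (hq₀ : q ≠ 0) {b b' : Bool} (h : b ≠ b') (k k' : ℕ)
    (i j l m : Fin n) : Commute (lowerMat q n b k i j) (lowerMat q n b' k' l m) := by
  induction k' generalizing l m with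
  | zero =>
    simp only [lowerMat]
    split_ifs
    · exact Commute.one_right _
    · exact Commute.zero_right _
  | succ k' ih =>
    exact Commute.sum_right _ _ _ fun s _ => Commute.mul_right (ih _ _)
      (lowerMat_commute hq₀ (fun e => absurd e h) _ _ _ _)

theorem isQMat_one {A : Type*} [Ring A] [Algebra K A] :
    IsQMat q (fun i j : Fin n => if i = j then (1 : A) else 0) := by
  intro l r h
  cases h with
  | @row i α β h =>
    by_cases h1 : i = β
    · subst h1; simp [h.ne']
    · simp [h1]
  | @col i j α h =>
    by_cases h1 : i = α
    · subst h1; simp [h.ne']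
    · simp [h1]
  | @anti i j α β h h' =>
    by_cases h1 : i = α
    · subst h1; simp [(h'.trans h).ne']
    · simp [h1]
  | @diag i j α β h h' =>
    have h0 : (if i = β then (1 : A) else 0) * (if j = α then 1 else 0) = 0 := by
      by_cases h1 : i = β
      · subst h1; simp [(h'.trans h).ne']
      · simp [h1]
    rw [h0, smul_zero, sub_zero]
    split_ifs <;> simp

theorem isQMat_lowerMat (hq₀ : q ≠ 0) (b : Bool) (k : ℕ) : IsQMat q (lowerMat q n b k) := by
  induction k with
  | zero => exact isQMat_one
  | succ k ih =>
    exact ih.mul hq₀ (isQMat_bidiag hq₀ b k) fun _ _ _ _ => lowerMat_commute hq₀ (fun _ => le_rfl)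
        ..

theorem qdet_lowerMat (hq₀ : q ≠ 0) (b : Bool) (k : ℕ) : qdet q (lowerMat q n b k) = 1 := by
  induction k with
  | zero =>
    rw [lowerMat, qdet_lower _ fun i j h => by simp [h.ne]]
    simp
  | succ k ih =>
    rw [lowerMat, qdet_mul hq₀ (isQMat_bidiag hq₀ b k) fun _ _ _ _ =>
      lowerMat_commute hq₀ (fun _ => le_rfl) .., ih, qdet_bidiag hq₀, one_mul]

theorem lowerMat_eq_zero (b : Bool) (k : ℕ) {i j : Fin n} (h : i < j ∨ (j : ℕ) + k < i) :
    lowerMat q n b k i j = 0 := by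
  induction k generalizing i j with
  | zero =>
    simp only [lowerMat]
    rw [if_neg]
    rintro rfl
    rcases h with h | h
    · exact lt_irrefl _ h
    · omega
  | succ k ih =>
    refine Finset.sum_eq_zero fun l _ => ?_
    rcases bidiag_cases (q := q) b k l j with rfl | hl | hl
    · rw [ih (h.imp id fun _ => by omega), zero_mul]
    · rw [ih (h.imp (fun h => by rw [Fin.lt_def] at h ⊢; omega) fun _ => by omega), zero_mul]
    · rw [hl, mul_zero]

/-- The leading exponent of the `(i, j)` entry of `lowerMat`: step down as early as possible. -/
def lowerExp (b : Bool) (i j : ℕ) : PathExp :=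
  ∑ l ∈ Finset.range (i - j), Finsupp.single (.inl (b, l, i - l)) 1

theorem pathCost_lowerExp (b : Bool) (i j : ℕ) :
    pathCost (lowerExp b i j) = ∑ l ∈ Finset.range (i - j), ((l : ℤ) + 1) := by
  simp [lowerExp, map_sum, pathCost_step]

/-- An entry of `lowerMat` is a sum over paths descending from `i` to `j`, with at most one unit
step at each stage. Later steps cost more, so the unique cheapest path steps at the first `i - j`
stages. The induction peels off the last stage. -/
theorem leads_lowerMat (hq₀ : q ≠ 0) (b : Bool) (k : ℕ) {i j : Fin n} (h : j ≤ i)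
    (hk : (i : ℕ) ≤ j + k) : Leads pathCost (lowerMat q n b k i j) (lowerExp b i j) := by
  induction k generalizing j with
  | zero =>
    have : i = j := le_antisymm (by rw [Fin.le_def]; omega) h
    subst this
    simpa [lowerMat, lowerExp] using leads_one (K := K) pathCost
  | succ k ih =>
    have hdiag : Leads (K := K) pathCost (bidiag q n b k j j) 0 := by
      rw [bidiag_diag]; exact leads_wshift _ _ fun γ => zpow_ne_zero _ hq₀
    rw [lowerMat]
    by_cases hlast : (j : ℕ) + 1 < n
    · let j' : Fin n := ⟨j + 1, hlast⟩
      have hstep : Leads (K := K) pathCost (bidiag q n b k j' j)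
          (Finsupp.single (.inl (b, k, (j : ℕ) + 1)) 1) := by
        rw [bidiag_step b k rfl]; exact leads_wshift _ _ fun γ => one_ne_zero
      have hsum : ∑ l, lowerMat q n b k i l * bidiag q n b k l j
          = lowerMat q n b k i j * bidiag q n b k j j
            + lowerMat q n b k i j' * bidiag q n b k j' j := by
        have hne : j ≠ j' := by simp [j', Fin.ext_iff]
        rw [← Finset.sum_pair hne (f := fun l => lowerMat q n b k i l * bidiag q n b k l j)]
        symm
        refine Finset.sum_subset (Finset.subset_univ _) fun l _ hl => ?_
        simp only [Finset.mem_insert, Finset.mem_singleton, not_or] at hl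
        rw [bidiag_zero b k hl.1 fun e => hl.2 (Fin.ext e), mul_zero]
      beta_reduce
      rw [hsum]
      rcases Nat.lt_or_ge (j + k) i with hlt | hge
      -- Here `i = j + k + 1`: a step is needed at every stage, so staying put at the last one
      -- contributes nothing.
      · rw [lowerMat_eq_zero b k (.inr hlt), zero_mul, zero_add]
        have hij : (i : ℕ) = j + k + 1 := by omega
        have h1 := (ih (j := j') (by rw [Fin.le_def]; simp [j']; omega) (by simp [j']; omega)).mul
          hstep
        convert h1 using 1
        rw [lowerExp, lowerExp, show (i : ℕ) - j = k + 1 by omega,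
          show (i : ℕ) - (j' : ℕ) = k by simp [j']; omega, Finset.sum_range_succ]
        rw [show (i : ℕ) - k = j + 1 by omega]
      · have h1 := (ih h hge).mul hdiag
        rw [add_zero] at h1
        refine h1.add ?_
        rcases h.lt_or_eq with hlt | heq
        · have hlt' : (j : ℕ) < i := hlt
          have h2 := ((ih (j := j') (by rw [Fin.le_def]; simp [j']; omega)
            (by simp [j']; omega)).mul hstep).raises
          -- Stepping at the last stage costs `k + 1`, while the cheapest path makes its last step
          -- at stage `i - j - 1 < k`.
          refine h2.mono ?_
          rw [map_add, pathCost_lowerExp, pathCost_lowerExp, pathCost_step,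
            show (i : ℕ) - j = (i - (j' : ℕ)) + 1 by simp [j']; omega, Finset.sum_range_succ]
          have : ((i : ℕ) - (j' : ℕ) : ℕ) + 1 ≤ k := by simp [j']; omega
          omega
        · rw [lowerMat_eq_zero b k (i := i) (j := j') (.inl (by rw [← heq, Fin.lt_def]; simp [j'])),
            zero_mul]
          exact Raises.zero _
    · have hsum : ∑ l, lowerMat q n b k i l * bidiag q n b k l j
          = lowerMat q n b k i j * bidiag q n b k j j := by
        refine Finset.sum_eq_single j (fun l _ hl => ?_) (by simp)
        rw [bidiag_zero b k hl (by omega), mul_zero]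
      have hij : i = j := le_antisymm (by rw [Fin.le_def]; omega) h
      beta_reduce
      rw [hsum]
      have h1 := (ih h (by rw [hij]; omega)).mul hdiag
      rwa [add_zero] at h1

variable (q n)

/-- The diagonal factor of the path model. -/
def diagMat (i j : Fin n) : Module.End K (PathExp →₀ K) :=
  if i = j then wshift (Finsupp.single (.inr (i : ℕ)) 1) fun _ => 1 else 0

/-- The lower triangular times diagonal factor of the path model. -/
def lowerDiag (i j : Fin n) : Module.End K (PathExp →₀ K) :=
  ∑ k, lowerMat q n true n i k * diagMat n k j

/-- The quantum matrix of the path model. -/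
def pathMat (i j : Fin n) : Module.End K (PathExp →₀ K) :=
  ∑ k, lowerDiag q n i k * lowerMat q n false n j k

variable {q n}

theorem diagMat_commute_bidiag (i j : Fin n) (b : Bool) (k : ℕ) (l m : Fin n) :
    Commute (diagMat n i j) (bidiag q n b k l m) := by
  unfold diagMat bidiag
  split_ifs
  · refine wshift_commute fun γ => ?_
    have : ∀ j, stageCoord n b k j (Finsupp.single (.inr (i : ℕ)) 1) = 0 := by
      intro j; simp [stageCoord]
    simp [stageCoord_add, this]
  · exact wshift_commute fun γ => rfl
  all_goals simp

theorem diagMat_commute_lowerMat (i j : Fin n) (b : Bool) (k : ℕ) (l m : Fin n) :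
    Commute (diagMat n i j) (lowerMat q n b k l m) := by
  induction k generalizing l m with
  | zero =>
    simp only [lowerMat]
    split_ifs
    · exact Commute.one_right _
    · exact Commute.zero_right _
  | succ k ih =>
    exact Commute.sum_right _ _ _ fun s _ => Commute.mul_right (ih _ _)
      (diagMat_commute_bidiag ..)

theorem diagMat_commute (i j k l : Fin n) : Commute (diagMat (K := K) n i j) (diagMat n k l) := by
  unfold diagMat
  split_ifs
  · exact wshift_commute fun γ => rfl
  · exact Commute.zero_right _
  · exact Commute.zero_left _
  · exact Commute.zero_left _

theorem isQMat_diagMat : IsQMat q (diagMat (K := K) n) := by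
  intro l r h
  cases h with
  | @row i α β h =>
    by_cases h1 : i = β
    · subst h1; simp [diagMat, h.ne']
    · simp [diagMat, h1]
  | @col i j α h =>
    by_cases h1 : i = α
    · subst h1; simp [diagMat, h.ne']
    · simp [diagMat, h1]
  | @anti i j α β h h' =>
    by_cases h1 : i = α
    · subst h1; simp [diagMat, (h'.trans h).ne']
    · simp [diagMat, h1]
  | @diag i j α β h h' =>
    have h0 : diagMat (K := K) n i β * diagMat n j α = 0 := by
      by_cases h1 : i = β
      · subst h1; simp [diagMat, (h'.trans h).ne']
      · simp [diagMat, h1]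
    refine eq_sub_smul_of_eq_zero (A := Module.End K (PathExp →₀ K)) h0 ?_
    exact (diagMat_commute _ _ _ _).eq

theorem lowerDiag_commute (hq₀ : q ≠ 0) (i j k l : Fin n) :
    Commute (lowerDiag q n i j) (lowerMat q n false n k l) :=
  Commute.sum_left _ _ _ fun _ _ => Commute.mul_left
    (lowerMat_commute_lowerMat hq₀ (by decide) ..) (diagMat_commute_lowerMat ..)

/-- The path matrix is a Gauss product lower × diagonal × transposed lower. The three factors use
disjoint sets of variables and commute entrywise, so closure under products applies twice. -/
theorem isQMat_pathMat (hq₀ : q ≠ 0) : IsQMat q (pathMat q n) := by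
  refine IsQMat.mul (Z := fun i j => lowerMat q n false n j i) hq₀ ?_
    (isQMat_lowerMat hq₀ false n).transpose
    fun _ _ _ _ => lowerDiag_commute hq₀ ..
  exact (isQMat_lowerMat hq₀ true n).mul hq₀ isQMat_diagMat
    fun _ _ _ _ => (diagMat_commute_lowerMat ..).symm

/-- The exponent of the quantum determinant in the path model. -/
def detExp (n : ℕ) : PathExp := ∑ i : Fin n, Finsupp.single (.inr (i : ℕ)) 1

theorem prod_ofFn_wshift_one {Γ : Type*} [AddCommGroup Γ] {m : ℕ} (δ : Fin m → Γ) :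
    (List.ofFn fun i => wshift (δ i) fun _ => (1 : K)).prod = wshift (∑ i, δ i) fun _ => 1 := by
  induction m with
  | zero => simp [wshift_one]
  | succ m ih =>
    rw [List.ofFn_succ, List.prod_cons, ih, wshift_mul]
    exact wshift_congr (by rw [Fin.sum_univ_succ, add_comm]) fun γ => by simp

theorem qdet_pathMat (hq₀ : q ≠ 0) :
    qdet q (pathMat q n) = wshift (detExp n) fun _ => 1 := by
  have h1 : qdet q (fun i j => lowerMat q n false n j i) = 1 := by
    rw [← qdet_lowerMat (n := n) hq₀ false n,
      qdet_lower (lowerMat q n false n) fun i j h => lowerMat_eq_zero _ _ (.inl h),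
      qdet_upper _ fun i j h => lowerMat_eq_zero _ _ (.inl h)]
  have h2 := qdet_mul (X := lowerDiag q n) hq₀ (isQMat_lowerMat (n := n) hq₀ false n).transpose
    fun _ _ _ _ => lowerDiag_commute hq₀ ..
  have h3 := qdet_mul (X := lowerMat q n true n) hq₀ (isQMat_diagMat (K := K) (n := n))
    fun _ _ _ _ => (diagMat_commute_lowerMat ..).symm
  have h4 : qdet q (diagMat (K := K) n) = wshift (detExp n) fun _ => 1 := by
    rw [qdet_lower _ fun i j h => by simp [diagMat, h.ne]]
    simp only [diagMat, if_true]
    exact prod_ofFn_wshift_one _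
  change qdet q (lowerDiag q n) = _ at h3
  change qdet q (pathMat q n) = _ at h2
  rw [h2, h3, h1, h4, qdet_lowerMat hq₀, one_mul, mul_one]

/-- The leading exponent of the `(i, j)` entry of the path matrix. -/
def pathExp (i j : ℕ) : PathExp :=
  lowerExp true i (min i j) + Finsupp.single (.inr (min i j)) 1 + lowerExp false j (min i j)

theorem lowerDiag_eq (i j : Fin n) :
    lowerDiag q n i j = lowerMat q n true n i j * wshift (Finsupp.single (.inr (j :
        ℕ)) 1) fun _ => 1 := by
  unfold lowerDiag
  rw [Finset.sum_eq_single j]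
  · simp [diagMat]
  · intro k _ hk; simp [diagMat, hk]
  · simp

/-- The summand at `k` descends to level `k` from both `i` and `j`. Shorter descents are cheaper, so
the largest admissible level `min i j` dominates. -/
theorem leads_pathMat (hq₀ : q ≠ 0) (i j : Fin n) : Leads pathCost (pathMat q n i j) (pathExp i j)
    := by
  have hterm : ∀ k : Fin n, k ≤ i → k ≤ j →
      Leads pathCost (lowerDiag q n i k * lowerMat q n false n j k)
        (lowerExp true i k + Finsupp.single (.inr (k : ℕ)) 1 + lowerExp false j k) := by
    intro k hi hj
    rw [lowerDiag_eq]
    exact ((leads_lowerMat hq₀ true n hi (by omega)).mul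
      (leads_wshift _ _ fun _ => one_ne_zero)).mul (leads_lowerMat hq₀ false n hj (by omega))
  have hmin : ((min i j : Fin n) : ℕ) = min (i : ℕ) j := by
    rcases le_total i j with h | h
    · rw [min_eq_left h, min_eq_left (Fin.le_def.1 h)]
    · rw [min_eq_right h, min_eq_right (Fin.le_def.1 h)]
  unfold pathMat
  rw [← Finset.add_sum_erase _ _ (Finset.mem_univ (min i j))]
  have hlead := hterm (min i j) (min_le_left _ _) (min_le_right _ _)
  rw [hmin] at hlead
  refine Leads.add hlead (Raises.sum _ fun k hk => ?_)
  have hne := (Finset.mem_erase.1 hk).1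
  by_cases hki : k ≤ i
  · by_cases hkj : k ≤ j
    · refine (hterm k hki hkj).raises.mono ?_
      have hlt : (k : ℕ) < min (i : ℕ) j := by
        rw [← hmin]
        exact Fin.lt_def.1 (lt_of_le_of_ne (le_min hki hkj) hne)
      simp only [pathExp, map_add, pathCost_lowerExp, pathCost_diag]
      have hmono : ∀ a b c : ℕ, c < b → b ≤ a → ∑ l ∈ Finset.range (a - b), ((l : ℤ) + 1) + 1
          ≤ ∑ l ∈ Finset.range (a - c), ((l : ℤ) + 1) := by
        intro a b c h h'
        have : ∑ l ∈ Finset.range (a - b + 1), ((l : ℤ) + 1)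
            ≤ ∑ l ∈ Finset.range (a - c), ((l : ℤ) + 1) :=
          Finset.sum_le_sum_of_subset_of_nonneg (Finset.range_mono (by omega))
            fun l _ _ => by positivity
        rw [Finset.sum_range_succ] at this
        omega
      have h1 := hmono i (min i j) k hlt (min_le_left _ _)
      have h2 := hmono j (min i j) k hlt (min_le_right _ _)
      omega
    · rw [lowerMat_eq_zero false n (i := j) (j := k) (.inl (not_le.1 hkj)), mul_zero]
      exact Raises.zero _
  · rw [lowerDiag_eq, lowerMat_eq_zero true n (i := i) (j := k) (.inl (not_le.1 hki)), zero_mul,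
      zero_mul]
    exact Raises.zero _

end PathModel

/-! ### Independence of the leading exponents -/

section Independence

theorem sum_single_apply_inl (b b' : Bool) (i l x N : ℕ) :
    (∑ k ∈ Finset.range N, Finsupp.single (Sum.inl (b, k, i - k) : PathVar) (1 : ℤ))
      (.inl (b', l, x)) = if b = b' ∧ l < N ∧ i - l = x then 1 else 0 := by
  rw [Finsupp.finsetSum_apply]
  simp only [Finsupp.single_apply, Sum.inl.injEq, Prod.mk.injEq]
  by_cases h : b = b' ∧ l < N ∧ i - l = x
  · rw [if_pos h, Finset.sum_eq_single l]
    · simp [h.1, h.2.2]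
    · intro k _ hk; simp [hk]
    · intro hl; exact absurd (Finset.mem_range.2 h.2.1) hl
  · rw [if_neg h]
    refine Finset.sum_eq_zero fun k hk => if_neg ?_
    rintro ⟨h1, rfl, h3⟩
    exact h ⟨h1, Finset.mem_range.1 hk, h3⟩

theorem pathExp_true (i j l x : ℕ) : pathExp i j (.inl (true, l, x))
    = if i = x + l ∧ j < x then 1 else 0 := by
  simp only [pathExp, lowerExp, Finsupp.add_apply, sum_single_apply_inl]
  simp only [reduceCtorEq, false_and, if_false, add_zero, true_and,
    Finsupp.single_apply]
  congr 1
  rw [eq_iff_iff]; omega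

theorem pathExp_false (i j l x : ℕ) : pathExp i j (.inl (false, l, x))
    = if j = x + l ∧ i < x then 1 else 0 := by
  simp only [pathExp, lowerExp, Finsupp.add_apply, sum_single_apply_inl]
  simp only [reduceCtorEq, false_and, if_false, zero_add, true_and,
    Finsupp.single_apply]
  congr 1
  rw [eq_iff_iff]; omega

theorem pathExp_inr (i j a : ℕ) : pathExp i j (.inr a) = if min i j = a then 1 else 0 := by
  have : ∀ b N, (∑ k ∈ Finset.range N, Finsupp.single (Sum.inl (b, k, i - k) : PathVar) (1 : ℤ))
      (.inr a) = 0 := by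
    intro b N; rw [Finsupp.finsetSum_apply]; exact Finset.sum_eq_zero fun k _ => by simp
  have h' : ∀ b N, (∑ k ∈ Finset.range N, Finsupp.single (Sum.inl (b, k, j - k) : PathVar) (1 : ℤ))
      (.inr a) = 0 := by
    intro b N; rw [Finsupp.finsetSum_apply]; exact Finset.sum_eq_zero fun k _ => by simp
  simp only [pathExp, lowerExp, Finsupp.add_apply, this, h', Finsupp.single_apply, Sum.inr.injEq,
    zero_add, add_zero]

variable {n : ℕ}

/-- The leading exponent of a monomial with exponents `m`. -/
def monoExp (m : Fin n × Fin n → ℤ) : PathExp := ∑ p, m p • pathExp p.1 p.2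

theorem monoExp_apply (m : Fin n × Fin n → ℤ) (v : PathVar) :
    monoExp m v = ∑ p, m p * pathExp p.1 p.2 v := by
  simp [monoExp, Finsupp.finsetSum_apply]

/-- The coordinate at `(true, l, x)` is the sum of `m` over row `x + l`, columns below `x`.
Differencing at fixed row isolates each entry below the diagonal; the `false` variables do the same
above it, and the diagonal variables then give the rest. -/
theorem eq_zero_of_monoExp_eq_zero {m : Fin n × Fin n → ℤ} (h : monoExp m = 0) : m = 0 := by
  have hv : ∀ v, ∑ p, m p * pathExp p.1 p.2 v = 0 := fun v => by
    rw [← monoExp_apply, h]; rfl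
  have hlow : ∀ i j : Fin n, j < i → m (i, j) = 0 := by
    intro i j hij
    rw [Fin.lt_def] at hij
    have h1 := hv (.inl (true, i - j - 1, j + 1))
    have h2 := hv (.inl (true, i - j, j))
    have h3 : ∑ p, m p * (pathExp p.1 p.2 (.inl (true, i - j - 1, j + 1))
        - pathExp p.1 p.2 (.inl (true, i - j, j))) = 0 := by
      simp only [mul_sub, Finset.sum_sub_distrib]; rw [h1, h2]; rfl
    rw [Finset.sum_eq_single (i, j)] at h3
    · simp only [pathExp_true] at h3
      rw [if_pos (by omega), if_neg (by omega)] at h3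
      simpa using h3
    · rintro ⟨i', j'⟩ - hne
      have hne' : ¬ ((i' : ℕ) = i ∧ (j' : ℕ) = j) := fun e => hne (Prod.ext (Fin.ext e.1) (Fin.ext
          e.2))
      simp only [pathExp_true]
      by_cases hc : (i' : ℕ) = i ∧ (j' : ℕ) < j
      · rw [if_pos (by omega), if_pos (by omega)]; simp
      · rw [if_neg (by omega), if_neg (by omega)]; simp
    · simp
  have hup : ∀ i j : Fin n, i < j → m (i, j) = 0 := by
    intro i j hij
    rw [Fin.lt_def] at hij
    have h1 := hv (.inl (false, j - i - 1, i + 1))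
    have h2 := hv (.inl (false, j - i, i))
    have h3 : ∑ p, m p * (pathExp p.1 p.2 (.inl (false, j - i - 1, i + 1))
        - pathExp p.1 p.2 (.inl (false, j - i, i))) = 0 := by
      simp only [mul_sub, Finset.sum_sub_distrib]; rw [h1, h2]; rfl
    rw [Finset.sum_eq_single (i, j)] at h3
    · simp only [pathExp_false] at h3
      rw [if_pos (by omega), if_neg (by omega)] at h3
      simpa using h3
    · rintro ⟨i', j'⟩ - hne
      have hne' : ¬ ((i' : ℕ) = i ∧ (j' : ℕ) = j) := fun e => hne (Prod.ext (Fin.ext e.1) (Fin.ext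
          e.2))
      simp only [pathExp_false]
      by_cases hc : (j' : ℕ) = j ∧ (i' : ℕ) < i
      · rw [if_pos (by omega), if_pos (by omega)]; simp
      · rw [if_neg (by omega), if_neg (by omega)]; simp
    · simp
  funext ⟨i, j⟩
  rcases lt_trichotomy i j with hij | rfl | hij
  · exact hup _ _ hij
  · have h1 := hv (.inr i)
    rw [Finset.sum_eq_single (i, i)] at h1
    · simpa [pathExp_inr] using h1
    · rintro ⟨i', j'⟩ - hne
      rcases lt_trichotomy i' j' with h' | rfl | h'
      · simp [hup _ _ h']
      · rw [pathExp_inr, if_neg, mul_zero]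
        simp only [min_self]
        exact fun e => hne (Prod.ext (Fin.ext e) (Fin.ext e))
      · simp [hlow _ _ h']
    · simp
  · exact hlow _ _ hij

theorem monoExp_injective : Function.Injective (monoExp (n := n)) := by
  intro m m' h
  rw [← sub_eq_zero]
  refine eq_zero_of_monoExp_eq_zero ?_
  rw [← sub_eq_zero] at h
  rw [← h]
  simp [monoExp, sub_smul]

/-- The exponents of a word. -/
def wcount (w : List (Fin n × Fin n)) : Fin n × Fin n → ℤ := fun p => w.count p

theorem wcount_nil : wcount ([] : List (Fin n × Fin n)) = 0 := by
  funext p; simp [wcount]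

theorem wcount_cons (p : Fin n × Fin n) (w : List (Fin n × Fin n)) :
    wcount (p :: w) = wcount w + Pi.single p 1 := by
  funext p'
  simp only [wcount, List.count_cons, Pi.add_apply, Pi.single_apply]
  by_cases h : p = p'
  · simp [h]
  · simp [h, Ne.symm h]

theorem wcount_append (v w : List (Fin n × Fin n)) : wcount (v ++ w) = wcount v + wcount w := by
  funext p; simp [wcount]

theorem wcount_nonneg (w : List (Fin n × Fin n)) (p : Fin n × Fin n) : 0 ≤ wcount w p := by
  simp [wcount]

theorem wcount_eq_iff_perm {v w : List (Fin n × Fin n)} : wcount v = wcount w ↔ v.Perm w := by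
  rw [List.perm_iff_count, funext_iff]
  simp [wcount]

theorem monoExp_add (m m' : Fin n × Fin n → ℤ) : monoExp (m + m') = monoExp m + monoExp m' := by
  simp [monoExp, add_smul, Finset.sum_add_distrib]

theorem monoExp_single (p : Fin n × Fin n) : monoExp (Pi.single p 1) = pathExp p.1 p.2 := by
  unfold monoExp
  rw [Finset.sum_eq_single p]
  · simp
  · intro p' _ h; simp [h]
  · simp

end Independence

/-! ### Words in the generators -/

section Words

variable {K : Type*} [Field K] (q : K) (n : ℕ)

/-- The product of the generators along a word. -/
def word (w : List (Fin n × Fin n)) : OqGL q n := (w.map fun p => YGL q n p.1 p.2).prod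

variable {n}

/-- The degree of a generator. -/
def pdeg (p : Fin n × Fin n) : ℤ := (p.1 : ℤ) * (p.2 : ℤ)

/-- The degree of an exponent vector. -/
def mdeg (m : Fin n × Fin n → ℤ) : ℤ := ∑ p, m p * pdeg p

theorem mdeg_add (m m' : Fin n × Fin n → ℤ) : mdeg (m + m') = mdeg m + mdeg m' := by
  simp [mdeg, add_mul, Finset.sum_add_distrib]

theorem mdeg_sub (m m' : Fin n × Fin n → ℤ) : mdeg (m - m') = mdeg m - mdeg m' := by
  simp [mdeg, sub_mul, Finset.sum_sub_distrib]

theorem mdeg_zero : mdeg (0 : Fin n × Fin n → ℤ) = 0 := by simp [mdeg]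

theorem mdeg_single (p : Fin n × Fin n) : mdeg (Pi.single p 1) = pdeg p := by
  unfold mdeg
  rw [Finset.sum_eq_single p]
  · simp
  · intro p' _ h; simp [h]
  · simp

theorem pdeg_nonneg (p : Fin n × Fin n) : 0 ≤ pdeg p := by unfold pdeg; positivity

theorem mdeg_wcount_nonneg (w : List (Fin n × Fin n)) : 0 ≤ mdeg (wcount w) :=
  Finset.sum_nonneg fun p _ => mul_nonneg (wcount_nonneg w p) (pdeg_nonneg p)

theorem word_nil : word q n [] = 1 := rfl

theorem word_cons (p : Fin n × Fin n) (w : List (Fin n × Fin n)) :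
    word q n (p :: w) = YGL q n p.1 p.2 * word q n w := by simp [word]

theorem word_append (v w : List (Fin n × Fin n)) : word q n (v ++ w) = word q n v * word q n w := by
  simp [word]

theorem word_singleton (p : Fin n × Fin n) : word q n [p] = YGL q n p.1 p.2 := by simp [word]

/-- The span of the words of degree at most `e`. -/
def filt (e : ℤ) : Submodule K (OqGL q n) :=
  Submodule.span K {x | ∃ w, mdeg (wcount w) ≤ e ∧ word q n w = x}

variable {q}

theorem word_mem_filt {w : List (Fin n × Fin n)} {e : ℤ} (h : mdeg (wcount w) ≤ e) :
    word q n w ∈ filt q e := Submodule.subset_span ⟨w, h, rfl⟩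

theorem filt_mono {d e : ℤ} (h : d ≤ e) : filt (n := n) q d ≤ filt q e :=
  Submodule.span_mono fun _ ⟨w, hw, hx⟩ => ⟨w, hw.trans h, hx⟩

theorem filt_neg {e : ℤ} (h : e < 0) : filt (n := n) q e = ⊥ := by
  rw [eq_bot_iff, filt, Submodule.span_le]
  rintro x ⟨w, hw, -⟩
  exact absurd (mdeg_wcount_nonneg w) (by omega)

theorem mul_mem_filt {x y : OqGL q n} {d e : ℤ} (hx : x ∈ filt q d) (hy : y ∈ filt q e) :
    x * y ∈ filt q (d + e) := by
  have h := Submodule.mul_mem_mul hx hy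
  rw [filt, filt, Submodule.span_mul_span] at h
  refine Submodule.span_mono ?_ h
  rintro _ ⟨_, ⟨v, hv, rfl⟩, _, ⟨w, hw, rfl⟩, rfl⟩
  exact ⟨v ++ w, by rw [wcount_append, mdeg_add]; omega, word_append ..⟩

theorem YGL_mem_filt (p : Fin n × Fin n) : YGL q n p.1 p.2 ∈ filt q (pdeg p) := by
  rw [← word_singleton]
  exact word_mem_filt (by rw [wcount_cons, wcount_nil, zero_add, mdeg_single])

theorem one_mem_filt : (1 : OqGL q n) ∈ filt q 0 := by
  rw [← word_nil]
  exact word_mem_filt (by rw [wcount_nil, mdeg_zero])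

/-- The normal ordering exponents of two generators. -/
def cexp (p p' : Fin n × Fin n) : ℤ :=
  if (p.1 = p'.1 ∧ p'.2 < p.2) ∨ (p.2 = p'.2 ∧ p'.1 < p.1) then -1 else 0

/-- Two generators `q`-commute up to terms of lower degree. -/
theorem YGL_swap (hq₀ : q ≠ 0) (p p' : Fin n × Fin n) :
    YGL q n p.1 p.2 * YGL q n p'.1 p'.2
      - q ^ (cexp p p' - cexp p' p) • (YGL q n p'.1 p'.2 * YGL q n p.1 p.2)
      ∈ filt q (pdeg p + pdeg p' - 1) := by
  -- The inequality `(j - i) * (β - α) > 0` is the reason for taking `i * α` as the degree.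
  have hlow : ∀ i j α β : Fin n, i < j → α < β → YGL q n i β * YGL q n j α
      ∈ filt q (pdeg (i, α) + pdeg (j, β) - 1) := by
    intro i j α β hij hab
    refine filt_mono ?_ (mul_mem_filt (YGL_mem_filt (i, β)) (YGL_mem_filt (j, α)))
    have h1 : (i : ℤ) < j := by exact_mod_cast hij
    have h2 : (α : ℤ) < β := by exact_mod_cast hab
    simp only [pdeg]
    nlinarith
  obtain ⟨i, α⟩ := p
  obtain ⟨j, β⟩ := p'
  rcases lt_trichotomy i j with hij | rfl | hij <;> rcases lt_trichotomy α β with hab | rfl | hab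
  · have e := YGL_rel q (.diag hij hab)
    have h1 : cexp (i, α) (j, β) = 0 := by simp [cexp, hij.ne, hab.ne]
    have h2 : cexp (j, β) (i, α) = 0 := by simp [cexp, hij.ne', hab.ne']
    simp only [h1, h2, e, sub_zero, zpow_zero, one_smul, sub_sub_cancel]
    exact Submodule.smul_mem _ _ (hlow _ _ _ _ hij hab)
  · have e := YGL_rel q (.col (α := α) hij)
    have h1 : cexp (i, α) (j, α) = 0 := by simp [cexp, hij.not_gt]
    have h2 : cexp (j, α) (i, α) = -1 := by simp [cexp, hij]
    simp only [h1, h2, e]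
    simp [smul_smul, hq₀]
  · have e := YGL_rel q (.anti hij hab)
    have h1 : cexp (i, α) (j, β) = 0 := by simp [cexp, hij.ne, hab.ne']
    have h2 : cexp (j, β) (i, α) = 0 := by simp [cexp, hij.ne', hab.ne]
    simp [h1, h2, e]
  · have e := YGL_rel q (.row (i := i) hab)
    have h1 : cexp (i, α) (i, β) = 0 := by simp [cexp, hab.not_gt]
    have h2 : cexp (i, β) (i, α) = -1 := by simp [cexp, hab]
    simp only [h1, h2, e]
    simp [smul_smul, hq₀]
  · simp
  · have e := YGL_rel q (.row (i := i) hab)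
    have h1 : cexp (i, β) (i, α) = 0 := by simp [cexp, hab.not_gt]
    have h2 : cexp (i, α) (i, β) = -1 := by simp [cexp, hab]
    simp only [h1, h2, e]
    simp
  · have e := YGL_rel q (.anti hij hab)
    have h1 : cexp (i, α) (j, β) = 0 := by simp [cexp, hij.ne', hab.ne]
    have h2 : cexp (j, β) (i, α) = 0 := by simp [cexp, hij.ne, hab.ne']
    simp [h1, h2, e]
  · have e := YGL_rel q (.col (α := α) hij)
    have h1 : cexp (j, α) (i, α) = 0 := by simp [cexp, hij.not_gt]
    have h2 : cexp (i, α) (j, α) = -1 := by simp [cexp, hij]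
    simp only [h1, h2, e]
    simp
  · have e := YGL_rel q (.diag hij hab)
    have h1 : cexp (i, α) (j, β) = 0 := by simp [cexp, hij.ne', hab.ne']
    have h2 : cexp (j, β) (i, α) = 0 := by simp [cexp, hij.ne, hab.ne]
    simp only [h1, h2, e, sub_zero, zpow_zero, one_smul, sub_sub_cancel_left]
    rw [add_comm]
    exact Submodule.neg_mem _ (Submodule.smul_mem _ _ (hlow _ _ _ _ hij hab))

/-- The normal ordering exponent of a generator followed by a monomial. -/
def cleft (p : Fin n × Fin n) (m : Fin n × Fin n → ℤ) : ℤ := ∑ p', m p' * cexp p p'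

/-- The normal ordering exponent of a monomial followed by a generator. -/
def cright (m : Fin n × Fin n → ℤ) (p : Fin n × Fin n) : ℤ := ∑ p', m p' * cexp p' p

theorem cleft_add (p : Fin n × Fin n) (m m' : Fin n × Fin n → ℤ) :
    cleft p (m + m') = cleft p m + cleft p m' := by
  simp [cleft, add_mul, Finset.sum_add_distrib]

theorem cright_add (p : Fin n × Fin n) (m m' : Fin n × Fin n → ℤ) :
    cright (m + m') p = cright m p + cright m' p := by
  simp [cright, add_mul, Finset.sum_add_distrib]

theorem cleft_single (p p' : Fin n × Fin n) : cleft p (Pi.single p' 1) = cexp p p' := by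
  unfold cleft
  rw [Finset.sum_eq_single p']
  · simp
  · intro p'' _ h; simp [h]
  · simp

theorem cright_single (p p' : Fin n × Fin n) : cright (Pi.single p' 1) p = cexp p' p := by
  unfold cright
  rw [Finset.sum_eq_single p']
  · simp
  · intro p'' _ h; simp [h]
  · simp

/-- The normal ordering exponent of a word. -/
def qexp : List (Fin n × Fin n) → ℤ
  | [] => 0
  | p :: w => cleft p (wcount w) + qexp w

/-- The exponent `qexp` sums `cexp` over ordered pairs of letters, so it can be peeled from either
end. This is what allows multiplication by a generator on the right as well as on the left. -/
theorem qexp_append_singleton (w : List (Fin n × Fin n)) (p : Fin n × Fin n) :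
    qexp (w ++ [p]) = qexp w + cright (wcount w) p := by
  induction w with
  | nil => simp [qexp, wcount_nil, cleft, cright]
  | cons p' w ih =>
    simp only [List.cons_append, qexp, ih, wcount_append, wcount_cons, cleft_add, cright_add,
      wcount_nil, zero_add, cleft_single, cright_single]
    ring

/-- Normally ordered words agree under permutation up to lower degree. -/
theorem word_perm (hq₀ : q ≠ 0) {v w : List (Fin n × Fin n)} (h : v.Perm w) :
    q ^ (-qexp v) • word q n v - q ^ (-qexp w) • word q n w
      ∈ filt q (mdeg (wcount v) - 1) := by
  induction h with
  | nil => simp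
  | @cons p v w hp ih =>
    have hc : wcount v = wcount w := wcount_eq_iff_perm.2 hp
    have : q ^ (-qexp (p :: v)) • word q n (p :: v) - q ^ (-qexp (p :: w)) • word q n (p :: w)
        = q ^ (-cleft p (wcount v)) • (YGL q n p.1 p.2 *
          (q ^ (-qexp v) • word q n v - q ^ (-qexp w) • word q n w)) := by
      simp only [qexp, word_cons, hc, neg_add, zpow_add₀ hq₀, mul_smul, mul_sub, smul_sub,
        mul_smul_comm]
    rw [this]
    refine Submodule.smul_mem _ _ (filt_mono ?_ (mul_mem_filt (YGL_mem_filt p) ih))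
    rw [wcount_cons, mdeg_add, mdeg_single]; omega
  | swap x y w =>
    have h1 : q ^ (-qexp (y :: x :: w)) • word q n (y :: x :: w)
        - q ^ (-qexp (x :: y :: w)) • word q n (x :: y :: w)
        = q ^ (-qexp (y :: x :: w)) • ((YGL q n y.1 y.2 * YGL q n x.1 x.2
          - q ^ (cexp y x - cexp x y) • (YGL q n x.1 x.2 * YGL q n y.1 y.2)) * word q n w) := by
      have he : -qexp (x :: y :: w) = -qexp (y :: x :: w) + (cexp y x - cexp x y) := by
        simp only [qexp, wcount_cons, cleft_add, cleft_single]; ring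
      rw [he, zpow_add₀ hq₀, mul_smul, ← smul_sub, sub_mul, smul_mul_assoc, word_cons, word_cons,
        word_cons, word_cons, mul_assoc, mul_assoc]
    rw [h1]
    refine Submodule.smul_mem _ _ (filt_mono ?_
      (mul_mem_filt (YGL_swap hq₀ y x) (word_mem_filt (w := w) le_rfl)))
    simp only [wcount_cons, mdeg_add, mdeg_single]; omega
  | @trans u v w huv hvw ih1 ih2 =>
    rw [← wcount_eq_iff_perm.2 huv] at ih2
    simpa using Submodule.add_mem _ ih1 ih2

/-- The normally ordered monomial with a given multiset of generators. -/
def mono (q : K) (s : Multiset (Fin n × Fin n)) : OqGL q n :=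
  q ^ (-qexp s.toList) • word q n s.toList

/-- The exponents of a multiset of generators. -/
def scount (s : Multiset (Fin n × Fin n)) : Fin n × Fin n → ℤ := wcount s.toList

theorem scount_coe (w : List (Fin n × Fin n)) :
    scount (w : Multiset (Fin n × Fin n)) = wcount w :=
  wcount_eq_iff_perm.2 (Multiset.coe_eq_coe.1 (Multiset.coe_toList _))

theorem scount_injective : Function.Injective (scount (n := n)) := by
  intro s t h
  rw [← Multiset.coe_toList s, ← Multiset.coe_toList t]
  exact Multiset.coe_eq_coe.2 (wcount_eq_iff_perm.1 h)

theorem mono_mem_filt (s : Multiset (Fin n × Fin n)) : mono q s ∈ filt q (mdeg (scount s)) :=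
  Submodule.smul_mem _ _ (word_mem_filt le_rfl)

theorem word_sub_mono (hq₀ : q ≠ 0) (w : List (Fin n × Fin n)) :
    word q n w - q ^ qexp w • mono q (w : Multiset (Fin n × Fin n))
      ∈ filt q (mdeg (wcount w) - 1) := by
  have h := word_perm (q := q) hq₀
    (Multiset.coe_eq_coe.1 (Multiset.coe_toList (w : Multiset (Fin n × Fin n)))).symm
  have := Submodule.smul_mem _ (q ^ qexp w) h
  rwa [smul_sub, smul_smul, ← zpow_add₀ hq₀, add_neg_cancel, zpow_zero, one_smul] at this

/-- Replacing a word by its normally ordered monomial costs only terms of smaller degree, and there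
is nothing in negative degree. -/
theorem filt_le_span (hq₀ : q ≠ 0) (e : ℤ) :
    filt (n := n) q e ≤ Submodule.span K (mono q '' {s | mdeg (scount s) ≤ e}) := by
  have key : ∀ k : ℕ, ∀ e : ℤ, e < k →
      filt (n := n) q e ≤ Submodule.span K (mono q '' {s | mdeg (scount s) ≤ e}) := by
    intro k
    induction k with
    | zero => intro e he; rw [filt_neg (by simpa using he)]; exact bot_le
    | succ k ih =>
      intro e he
      rw [filt, Submodule.span_le]
      rintro _ ⟨w, hw, rfl⟩
      have h1 := ih (mdeg (wcount w) - 1) (by push_cast at he; omega) (word_sub_mono hq₀ w)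
      have h2 : mono q (w : Multiset (Fin n × Fin n))
          ∈ Submodule.span K (mono q '' {s | mdeg (scount s) ≤ e}) :=
        Submodule.subset_span ⟨_, by rw [Set.mem_ofPred_eq, scount_coe]; exact hw, rfl⟩
      have hsub : {s : Multiset (Fin n × Fin n) | mdeg (scount s) ≤ mdeg (wcount w) - 1}
          ⊆ {s | mdeg (scount s) ≤ e} := by
        intro s hs
        rw [Set.mem_ofPred_eq] at hs ⊢
        omega
      have h3 := Submodule.add_mem _ (Submodule.span_mono (Set.image_mono hsub) h1)
        (Submodule.smul_mem _ (q ^ qexp w) h2)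
      rwa [sub_add_cancel] at h3
  exact key (e.toNat + 1) e (by push_cast; have := Int.self_le_toNat e; omega)

variable (n)

/-- The path representation of `O_q(GL_n)`. -/
def pathRep (hq₀ : q ≠ 0) : OqGL q n →ₐ[K] Module.End K (PathExp →₀ K) :=
  liftGL q (pathMat q n) (wshift (-detExp n) fun _ => 1) (fun l r h => isQMat_pathMat hq₀ l r h)
    (by rw [qdet_pathMat hq₀, wshift_mul, ← wshift_one]; exact wshift_congr (by simp) (by simp))
    (by rw [qdet_pathMat hq₀, wshift_mul, ← wshift_one]; exact wshift_congr (by simp) (by simp))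

variable {n}

theorem pathRep_YGL (hq₀ : q ≠ 0) (i α : Fin n) :
    pathRep n hq₀ (YGL q n i α) = pathMat q n i α := liftGL_YGL ..

theorem leads_word (hq₀ : q ≠ 0) (w : List (Fin n × Fin n)) :
    Leads pathCost (pathRep n hq₀ (word q n w)) (monoExp (wcount w)) := by
  induction w with
  | nil =>
    have : monoExp (wcount ([] : List (Fin n × Fin n))) = 0 := by simp [wcount_nil, monoExp]
    rw [this, word_nil, map_one]
    exact leads_one _
  | cons p w ih =>
    rw [word_cons, map_mul, wcount_cons, monoExp_add, add_comm, monoExp_single]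
    refine Leads.mul ?_ ih
    rw [pathRep_YGL]
    exact leads_pathMat hq₀ _ _

/-- Take a monomial of least cost in the relation. Any other monomial contributes its own leading
exponent, which is different, and terms of strictly larger cost, so nothing cancels the coefficient
at the chosen exponent. -/
theorem eq_zero_of_sum_pathRep_mono (hq₀ : q ≠ 0) {l : Multiset (Fin n × Fin n) →₀ K}
    (hl : ∑ s ∈ l.support, l s • pathRep n hq₀ (mono q s) (Finsupp.single 0 1) = 0) : l = 0 := by
  have hlead : ∀ s : Multiset (Fin n × Fin n), ∃ u : K, u ≠ 0 ∧
      pathRep n hq₀ (mono q s) (Finsupp.single 0 1) - Finsupp.single (monoExp (scount s)) u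
        ∈ costGE K pathCost (pathCost (monoExp (scount s)) + 1) := by
    intro s
    obtain ⟨u, hu, h⟩ := leads_word hq₀ s.toList 0
    refine ⟨q ^ (-qexp s.toList) * u, mul_ne_zero (zpow_ne_zero _ hq₀) hu, ?_⟩
    rw [zero_add, map_zero, zero_add] at h
    have := Submodule.smul_mem _ (q ^ (-qexp s.toList)) h
    rwa [smul_sub, Finsupp.smul_single, smul_eq_mul, ← LinearMap.smul_apply, ← map_smul] at this
  by_contra hne
  obtain ⟨s, hs, hmin⟩ := Finset.exists_min_image l.support
    (fun s => pathCost (monoExp (scount s))) (Finsupp.support_nonempty_iff.2 hne)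
  have h0 := DFunLike.congr_fun hl (monoExp (scount s))
  rw [Finsupp.finsetSum_apply, Finset.sum_eq_single s] at h0
  · obtain ⟨u, hu, h⟩ := hlead s
    have h1 : (pathRep n hq₀ (mono q s) (Finsupp.single 0 1)
        - Finsupp.single (monoExp (scount s)) u) (monoExp (scount s)) = 0 := by
      by_contra hc
      have := h (Finsupp.mem_support_iff.2 hc)
      simp at this
    rw [Finsupp.sub_apply, Finsupp.single_eq_same, sub_eq_zero] at h1
    rw [Finsupp.smul_apply, h1, smul_eq_mul] at h0
    exact (mul_ne_zero (Finsupp.mem_support_iff.1 hs) hu) h0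
  · intro t ht hts
    obtain ⟨u, hu, h⟩ := hlead t
    have h1 : (pathRep n hq₀ (mono q t) (Finsupp.single 0 1)
        - Finsupp.single (monoExp (scount t)) u) (monoExp (scount s)) = 0 := by
      by_contra hc
      have h2 := h (Finsupp.mem_support_iff.2 hc)
      have h3 := hmin t ht
      simp only [Set.mem_ofPred_eq] at h2
      omega
    rw [Finsupp.sub_apply, Finsupp.single_eq_of_ne, sub_zero] at h1
    · rw [Finsupp.smul_apply, h1, smul_zero]
    · exact fun e => hts (scount_injective (monoExp_injective e)).symm
  · intro h; exact absurd hs h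

theorem eq_zero_of_pathRep_sum_mono (hq₀ : q ≠ 0) {l : Multiset (Fin n × Fin n) →₀ K}
    (hl : pathRep n hq₀ (∑ s ∈ l.support, l s • mono q s) = 0) : l = 0 := by
  refine eq_zero_of_sum_pathRep_mono hq₀ ?_
  have := DFunLike.congr_fun hl (Finsupp.single 0 1)
  simpa [map_sum, LinearMap.sum_apply] using this

theorem linearIndependent_mono (hq₀ : q ≠ 0) : LinearIndependent K (mono (n := n) q) := by
  rw [linearIndependent_iff]
  intro l hl
  rw [Finsupp.linearCombination_apply, Finsupp.sum] at hl
  exact eq_zero_of_pathRep_sum_mono hq₀ (by rw [hl, map_zero])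

/-- Faithfulness on combinations of words: identities among them may be checked on operators. -/
theorem eq_zero_of_pathRep_eq_zero (hq₀ : q ≠ 0) {x : OqGL q n} {e : ℤ} (hx : x ∈ filt q e)
    (h : pathRep n hq₀ x = 0) : x = 0 := by
  have h1 : x ∈ Submodule.span K (Set.range (mono q)) :=
    Submodule.span_mono (Set.image_subset_range _ _) (filt_le_span hq₀ e hx)
  obtain ⟨l, rfl⟩ := (Finsupp.mem_span_range_iff_exists_finsupp).1 h1
  rw [Finsupp.sum] at h ⊢
  simp [eq_zero_of_pathRep_sum_mono hq₀ h]

end Words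

/-! ### Coefficients of normally ordered monomials -/

section Coef

variable {K : Type*} [Field K] {q : K} {n : ℕ}

/-- The monomials need not span the localisation, so the coordinates come from an arbitrary linear
left inverse. They are meaningful on the subspaces `filt q e`, where the monomials do span. -/
theorem exists_monoCoords (hq₀ : q ≠ 0) : ∃ f : OqGL q n →ₗ[K] (Multiset (Fin n × Fin n) →₀ K),
    f ∘ₗ Finsupp.linearCombination K (mono q) = LinearMap.id :=
  LinearMap.exists_leftInverse_of_injective _
    (LinearMap.ker_eq_bot.2 (linearIndependent_mono (n := n) hq₀))

/-- Coordinates with respect to the normally ordered monomials. -/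
def monoCoords (hq₀ : q ≠ 0) : OqGL q n →ₗ[K] (Multiset (Fin n × Fin n) →₀ K) :=
  (exists_monoCoords hq₀).choose

theorem monoCoords_mono (hq₀ : q ≠ 0) (s : Multiset (Fin n × Fin n)) :
    monoCoords hq₀ (mono q s) = Finsupp.single s 1 := by
  have := LinearMap.congr_fun (exists_monoCoords (n := n) hq₀).choose_spec (Finsupp.single s 1)
  rw [LinearMap.comp_apply, Finsupp.linearCombination_single, one_smul] at this
  exact this

/-- Coordinates indexed by exponent vectors. -/
def expCoords (hq₀ : q ≠ 0) : OqGL q n →ₗ[K] ((Fin n × Fin n → ℤ) →₀ K) :=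
  Finsupp.lmapDomain K K scount ∘ₗ monoCoords hq₀

/-- The coefficient of the normally ordered monomial with exponents `m`. -/
def coef (hq₀ : q ≠ 0) (m : Fin n × Fin n → ℤ) : OqGL q n →ₗ[K] K := Finsupp.lapply m ∘ₗ expCoords
    hq₀

theorem coef_mono (hq₀ : q ≠ 0) (m : Fin n × Fin n → ℤ) (s : Multiset (Fin n × Fin n)) :
    coef hq₀ m (mono q s) = if scount s = m then 1 else 0 := by
  simp [coef, expCoords, monoCoords_mono, Finsupp.mapDomain_single, Finsupp.single_apply]

theorem coef_scount (hq₀ : q ≠ 0) (s : Multiset (Fin n × Fin n)) (x : OqGL q n) :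
    coef hq₀ (scount s) x = monoCoords hq₀ x s := by
  simp [coef, expCoords, Finsupp.mapDomain_apply scount_injective]

theorem finite_coef_support (hq₀ : q ≠ 0) (x : OqGL q n) : {m | coef hq₀ m x ≠ 0}.Finite := by
  refine (Finset.finite_toSet (expCoords hq₀ x).support).subset fun m hm => ?_
  exact Finsupp.mem_support_iff.2 hm

theorem coef_induction (hq₀ : q ≠ 0) {e : ℤ} {P : OqGL q n → Prop}
    (hz : P 0) (ha : ∀ x y, P x → P y → P (x + y)) (hs : ∀ (c : K) x, P x → P (c • x))
    (hm : ∀ s, mdeg (scount s) ≤ e → P (mono q s)) {x : OqGL q n} (hx : x ∈ filt q e) : P x := by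
  have h := filt_le_span hq₀ e hx
  clear hx
  induction h using Submodule.span_induction with
  | mem x h => obtain ⟨s, hs', rfl⟩ := h; exact hm s hs'
  | zero => exact hz
  | add x y _ _ h1 h2 => exact ha x y h1 h2
  | smul c x _ h => exact hs c x h

theorem coef_of_lt (hq₀ : q ≠ 0) {e : ℤ} {x : OqGL q n} (hx : x ∈ filt q e) {m : Fin n × Fin n → ℤ}
    (hm : e < mdeg m) : coef hq₀ m x = 0 := by
  refine coef_induction hq₀ (P := fun x => coef hq₀ m x = 0) (map_zero _)
    (fun x y h1 h2 => by rw [map_add, h1, h2, add_zero])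
    (fun c x h => by rw [map_smul, h, smul_zero]) (fun s hs => ?_) hx
  rw [coef_mono, if_neg]
  rintro rfl
  omega

/-- Integer exponents are needed because the symbol of a derivation is indexed by the exponent by
which it shifts, and such a shift may remove a generator. Actual elements have no component with a
negative exponent. -/
theorem coef_of_neg (hq₀ : q ≠ 0) {e : ℤ} {x : OqGL q n} (hx : x ∈ filt q e) {m : Fin n × Fin n → ℤ}
    {p : Fin n × Fin n} (hm : m p < 0) : coef hq₀ m x = 0 := by
  refine coef_induction hq₀ (P := fun x => coef hq₀ m x = 0) (map_zero _)
    (fun x y h1 h2 => by rw [map_add, h1, h2, add_zero])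
    (fun c x h => by rw [map_smul, h, smul_zero]) (fun s hs => ?_) hx
  rw [coef_mono, if_neg]
  rintro rfl
  exact absurd (wcount_nonneg s.toList p) (not_le.2 hm)

theorem sum_monoCoords (hq₀ : q ≠ 0) {e : ℤ} {x : OqGL q n} (hx : x ∈ filt q e) :
    Finsupp.linearCombination K (mono q) (monoCoords hq₀ x) = x := by
  refine coef_induction hq₀
    (P := fun x => Finsupp.linearCombination K (mono q) (monoCoords hq₀ x) = x) (by simp)
    (fun x y h1 h2 => by rw [map_add, map_add, h1, h2])
    (fun c x h => by rw [map_smul, map_smul, h]) (fun s hs => ?_) hx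
  simp [monoCoords_mono]

theorem mem_filt_of_coef (hq₀ : q ≠ 0) {e d : ℤ} {x : OqGL q n} (hx : x ∈ filt q e)
    (h : ∀ m, d < mdeg m → coef hq₀ m x = 0) : x ∈ filt q d := by
  rw [← sum_monoCoords hq₀ hx, Finsupp.linearCombination_apply, Finsupp.sum]
  refine Submodule.sum_mem _ fun s hs => Submodule.smul_mem _ _ ?_
  refine filt_mono ?_ (mono_mem_filt s)
  by_contra hc
  have := h (scount s) (not_le.1 hc)
  rw [coef_scount] at this
  exact Finsupp.mem_support_iff.1 hs this

theorem mem_filt_sub_one (hq₀ : q ≠ 0) {e : ℤ} {x : OqGL q n} (hx : x ∈ filt q e)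
    (h : ∀ m, mdeg m = e → coef hq₀ m x = 0) : x ∈ filt q (e - 1) := by
  refine mem_filt_of_coef hq₀ hx fun m hm => ?_
  rcases (by omega : mdeg m = e ∨ e < mdeg m) with h1 | h1
  · exact h m h1
  · exact coef_of_lt hq₀ hx h1

theorem coef_word (hq₀ : q ≠ 0) {w : List (Fin n × Fin n)} {m : Fin n × Fin n → ℤ}
    (h : mdeg (wcount w) ≤ mdeg m) :
    coef hq₀ m (word q n w) = if wcount w = m then q ^ qexp w else 0 := by
  have h1 := coef_of_lt hq₀ (word_sub_mono hq₀ w) (m := m) (by omega)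
  rw [map_sub, map_smul, coef_mono, scount_coe, sub_eq_zero] at h1
  rw [h1]
  split_ifs <;> simp

theorem filt_induction {e : ℤ} {P : OqGL q n → Prop}
    (hz : P 0) (ha : ∀ x y, P x → P y → P (x + y)) (hs : ∀ (c : K) x, P x → P (c • x))
    (hm : ∀ w, mdeg (wcount w) ≤ e → P (word q n w)) {x : OqGL q n} (hx : x ∈ filt q e) : P x := by
  induction hx using Submodule.span_induction with
  | mem x h => obtain ⟨s, hs', rfl⟩ := h; exact hm s hs'
  | zero => exact hz
  | add x y _ _ h1 h2 => exact ha x y h1 h2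
  | smul c x _ h => exact hs c x h

/-- On leading terms, multiplication by a generator shifts exponents and rescales by a power of `q`.
-/
theorem coef_mul_YGL (hq₀ : q ≠ 0) {m : Fin n × Fin n → ℤ} {x : OqGL q n} (hx : x ∈ filt q (mdeg m))
    (p : Fin n × Fin n) :
    coef hq₀ (m + Pi.single p 1) (x * YGL q n p.1 p.2) = q ^ cright m p * coef hq₀ m x := by
  refine filt_induction (P := fun x => coef hq₀ (m + Pi.single p 1) (x * YGL q n p.1 p.2)
    = q ^ cright m p * coef hq₀ m x) (by simp)
    (fun x y h1 h2 => by rw [add_mul, map_add, h1, h2, map_add, mul_add])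
    (fun c x h => by rw [smul_mul_assoc, map_smul, h, map_smul, smul_eq_mul, smul_eq_mul,
      mul_left_comm]) (fun w hw => ?_) hx
  rw [← word_singleton, ← word_append, coef_word hq₀ hw, coef_word hq₀ (by
    rw [wcount_append, wcount_cons, wcount_nil, zero_add, mdeg_add, mdeg_add]; omega),
    wcount_append, wcount_cons, wcount_nil, zero_add, qexp_append_singleton]
  simp only [add_left_inj]
  split_ifs with h
  · rw [h, zpow_add₀ hq₀, mul_comm]
  · simp

theorem coef_YGL_mul (hq₀ : q ≠ 0) {m : Fin n × Fin n → ℤ} {x : OqGL q n} (hx : x ∈ filt q (mdeg m))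
    (p : Fin n × Fin n) :
    coef hq₀ (m + Pi.single p 1) (YGL q n p.1 p.2 * x) = q ^ cleft p m * coef hq₀ m x := by
  refine filt_induction (P := fun x => coef hq₀ (m + Pi.single p 1) (YGL q n p.1 p.2 * x)
    = q ^ cleft p m * coef hq₀ m x) (by simp)
    (fun x y h1 h2 => by rw [mul_add, map_add, h1, h2, map_add, mul_add])
    (fun c x h => by rw [mul_smul_comm, map_smul, h, map_smul, smul_eq_mul, smul_eq_mul,
      mul_left_comm]) (fun w hw => ?_) hx
  rw [← word_cons, coef_word hq₀ hw, coef_word hq₀ (by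
    rw [wcount_cons, mdeg_add, mdeg_add]; omega),
    wcount_cons, qexp]
  simp only [add_left_inj]
  split_ifs with h
  · rw [h, zpow_add₀ hq₀]
  · simp

theorem exists_coef_word_mul (hq₀ : q ≠ 0) (v : List (Fin n × Fin n)) (m : Fin n × Fin n → ℤ) :
    ∃ u : K, u ≠ 0 ∧ ∀ x ∈ filt q (mdeg m),
      coef hq₀ (m + wcount v) (word q n v * x) = u * coef hq₀ m x := by
  induction v with
  | nil => exact ⟨1, one_ne_zero, fun x _ => by simp [word_nil, wcount_nil]⟩
  | cons p v ih =>
    obtain ⟨u, hu, h⟩ := ih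
    refine ⟨q ^ cleft p (m + wcount v) * u, mul_ne_zero (zpow_ne_zero _ hq₀) hu, fun x hx => ?_⟩
    rw [wcount_cons, ← add_assoc, word_cons, mul_assoc, coef_YGL_mul hq₀, h x hx, mul_assoc]
    rw [mdeg_add, add_comm]
    exact mul_mem_filt (word_mem_filt le_rfl) hx

end Coef

/-! ### The quantum determinant -/

section Determinant

variable {K : Type*} [Field K] {q : K} {n : ℕ}

/-- The exponents of the product of the diagonal generators. -/
def idExp (n : ℕ) : Fin n × Fin n → ℤ := fun p => if p.1 = p.2 then 1 else 0

theorem mdeg_wcount_ofFn {k : ℕ} (f : Fin k → Fin n × Fin n) :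
    mdeg (wcount (List.ofFn f)) = ∑ i, pdeg (f i) := by
  induction k with
  | zero => simp [wcount_nil, mdeg_zero]
  | succ k ih =>
    rw [List.ofFn_succ, wcount_cons, mdeg_add, ih, mdeg_single, Fin.sum_univ_succ, add_comm]

theorem wcount_ofFn {k : ℕ} (f : Fin k → Fin n × Fin n) :
    wcount (List.ofFn f) = ∑ i, Pi.single (f i) 1 := by
  induction k with
  | zero => simp [wcount_nil]
  | succ k ih =>
    rw [List.ofFn_succ, wcount_cons, ih, Fin.sum_univ_succ, add_comm]

theorem wcount_diag : wcount (List.ofFn fun i : Fin n => (i, i)) = idExp n := by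
  rw [wcount_ofFn]
  funext ⟨i, j⟩
  rw [Finset.sum_apply, Finset.sum_eq_single i]
  · simp [Pi.single_apply, idExp, eq_comm]
  · intro k _ hk
    rw [Pi.single_apply, if_neg]
    intro e
    exact hk (congrArg Prod.fst e).symm
  · simp

theorem mdeg_idExp : mdeg (idExp n) = ∑ i : Fin n, (i : ℤ) * i := by
  rw [← wcount_diag, mdeg_wcount_ofFn]; rfl

theorem mdeg_idExp_pos (hn : 1 < n) : 0 < mdeg (idExp n) := by
  rw [mdeg_idExp]
  exact Finset.sum_pos' (fun i _ => by positivity) ⟨⟨1, hn⟩, Finset.mem_univ _, by simp⟩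

/-- The rearrangement inequality, from `∑ (i - σ i)² > 0`. It makes the diagonal word the unique
term of `Δ` of top degree. -/
theorem perm_deg_lt {σ : Equiv.Perm (Fin n)} (hσ : σ ≠ 1) :
    ∑ i : Fin n, (i : ℤ) * (σ i : ℤ) < ∑ i : Fin n, (i : ℤ) * i := by
  have h1 : ∑ i : Fin n, (σ i : ℤ) * (σ i : ℤ) = ∑ i : Fin n, (i : ℤ) * i :=
    Equiv.sum_comp σ fun i : Fin n => (i : ℤ) * i
  have h2 : 0 < ∑ i : Fin n, ((i : ℤ) - σ i) ^ 2 := by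
    obtain ⟨i, hi⟩ : ∃ i, σ i ≠ i := by
      by_contra! hc
      exact hσ (Equiv.ext hc)
    refine Finset.sum_pos' (fun i _ => sq_nonneg _) ⟨i, Finset.mem_univ _, ?_⟩
    have : (i : ℤ) - σ i ≠ 0 := by
      intro e
      apply hi
      apply Fin.ext
      have : ((i : ℕ) : ℤ) = ((σ i : ℕ) : ℤ) := by linarith
      exact_mod_cast this.symm
    positivity
  have h3 : ∑ i : Fin n, ((i : ℤ) - σ i) ^ 2 = ∑ i : Fin n, (i : ℤ) * i
      - 2 * ∑ i : Fin n, (i : ℤ) * (σ i : ℤ) + ∑ i : Fin n, (σ i : ℤ) * (σ i : ℤ) := by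
    rw [Finset.mul_sum, ← Finset.sum_sub_distrib, ← Finset.sum_add_distrib]
    exact Finset.sum_congr rfl fun i _ => by ring
  linarith

theorem detGL_sub_word :
    detGL q n - word q n (List.ofFn fun i : Fin n => (i, i)) ∈ filt q (mdeg (idExp n) - 1) := by
  have h : detGL q n = ∑ σ : Equiv.Perm (Fin n),
      (-q) ^ invCount σ • word q n (List.ofFn fun i => (i, σ i)) := by
    simp [detGL, qdet, word, List.map_ofFn, Function.comp_def]
  rw [h, ← Finset.add_sum_erase _ _ (Finset.mem_univ (1 : Equiv.Perm (Fin n))), invCount_one,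
    pow_zero, one_smul]
  simp only [Equiv.Perm.one_apply, add_sub_cancel_left]
  refine Submodule.sum_mem _ fun σ hσ => Submodule.smul_mem _ _ (word_mem_filt ?_)
  rw [mdeg_wcount_ofFn, mdeg_idExp]
  have := perm_deg_lt (Finset.mem_erase.1 hσ).1
  simp only [pdeg]
  omega

theorem detGL_mem_filt : detGL q n ∈ filt q (mdeg (idExp n)) := by
  have h1 : word q n (List.ofFn fun i : Fin n => (i, i)) ∈ filt q (mdeg (idExp n)) :=
    word_mem_filt (by rw [wcount_diag])
  simpa using Submodule.add_mem _ (filt_mono (by omega) (detGL_sub_word (q := q) (n := n))) h1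

theorem mdeg_nsmul (k : ℕ) (m : Fin n × Fin n → ℤ) : mdeg (k • m) = k * mdeg m := by
  simp [mdeg, Finset.mul_sum, mul_assoc]

theorem detGL_pow_mem_filt (k : ℕ) : detGL q n ^ k ∈ filt q (mdeg (k • idExp n)) := by
  induction k with
  | zero => simpa [mdeg_zero] using one_mem_filt
  | succ k ih =>
    rw [pow_succ, succ_nsmul, mdeg_add]
    exact mul_mem_filt ih detGL_mem_filt

theorem exists_coef_detGL_mul (hq₀ : q ≠ 0) (m : Fin n × Fin n → ℤ) :
    ∃ u : K, u ≠ 0 ∧ ∀ x ∈ filt q (mdeg m),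
      coef hq₀ (m + idExp n) (detGL q n * x) = u * coef hq₀ m x := by
  obtain ⟨u, hu, h⟩ := exists_coef_word_mul hq₀ (List.ofFn fun i : Fin n => (i, i)) m
  rw [wcount_diag] at h
  refine ⟨u, hu, fun x hx => ?_⟩
  have h1 := coef_of_lt hq₀ (mul_mem_filt detGL_sub_word hx) (m := m + idExp n)
    (by rw [mdeg_add]; omega)
  rw [sub_mul, map_sub, sub_eq_zero] at h1
  rw [h1, h x hx]

theorem exists_coef_detGL_pow_mul (hq₀ : q ≠ 0) (k : ℕ) (m : Fin n × Fin n → ℤ) :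
    ∃ u : K, u ≠ 0 ∧ ∀ x ∈ filt q (mdeg m),
      coef hq₀ (m + k • idExp n) (detGL q n ^ k * x) = u * coef hq₀ m x := by
  induction k with
  | zero => exact ⟨1, one_ne_zero, fun x _ => by simp⟩
  | succ k ih =>
    obtain ⟨u, hu, h⟩ := ih
    obtain ⟨v, hv, h'⟩ := exists_coef_detGL_mul hq₀ (m + k • idExp n)
    refine ⟨v * u, mul_ne_zero hv hu, fun x hx => ?_⟩
    rw [succ_nsmul, ← add_assoc, pow_succ', mul_assoc, h', h x hx, mul_assoc]
    rw [mdeg_add, add_comm]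
    exact mul_mem_filt (detGL_pow_mem_filt k) hx

theorem commute_detExp_lowerMat (b : Bool) (k : ℕ) (i j : Fin n) :
    Commute (wshift (detExp n) fun _ => (1 : K)) (lowerMat q n b k i j) := by
  have : (List.ofFn fun i : Fin n => diagMat (K := K) n i i).prod
      = wshift (detExp n) fun _ => (1 : K) := by
    simp only [diagMat, if_true]
    exact prod_ofFn_wshift_one _
  rw [← this]
  refine Commute.list_prod_left _ _ fun x hx => ?_
  obtain ⟨i, rfl⟩ := (List.mem_ofFn' _ _).1 hx
  exact diagMat_commute_lowerMat ..

theorem commute_detExp_pathMat (i j : Fin n) :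
    Commute (wshift (detExp n) fun _ => (1 : K)) (pathMat q n i j) := by
  refine Commute.sum_right _ _ _ fun k _ => Commute.mul_right ?_ (commute_detExp_lowerMat ..)
  rw [lowerDiag_eq]
  exact Commute.mul_right (commute_detExp_lowerMat ..) (wshift_commute fun γ => rfl)

/-- In the path model `Δ` is the unweighted shift in the diagonal variables, on which no weight
depends. Both products are combinations of words, so faithfulness transfers the commutation. -/
theorem detGL_commute_YGL (hq₀ : q ≠ 0) (i j : Fin n) : Commute (detGL q n) (YGL q n i j) := by
  have h1 : pathRep n hq₀ (detGL q n) = wshift (detExp n) fun _ => 1 := by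
    refine (map_qdet (B := Module.End K (PathExp →₀ K)) q (pathRep n hq₀) (YGL q n)).trans ?_
    simp only [pathRep_YGL]
    exact qdet_pathMat hq₀
  rw [Commute, SemiconjBy, ← sub_eq_zero]
  have hm := YGL_mem_filt (q := q) (i, j)
  refine eq_zero_of_pathRep_eq_zero hq₀ (e := mdeg (idExp n) + pdeg (i, j))
    (Submodule.sub_mem _ (mul_mem_filt detGL_mem_filt hm)
      (by rw [add_comm]; exact mul_mem_filt hm detGL_mem_filt)) ?_
  rw [map_sub, map_mul, map_mul, h1, pathRep_YGL, (commute_detExp_pathMat i j).eq, sub_self]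

theorem GL_induction {P : OqGL q n → Prop} (hc : ∀ c, P (algebraMap K _ c))
    (hY : ∀ i j, P (YGL q n i j)) (hi : P (detInvGL q n)) (ha : ∀ x y, P x → P y → P (x + y))
    (hm : ∀ x y, P x → P y → P (x * y)) (x : OqGL q n) : P x := by
  obtain ⟨y, rfl⟩ : ∃ y, mkGL q n y = x := RingQuot.mkAlgHom_surjective K (GLRel q n) x
  induction y using FreeAlgebra.induction with
  | grade0 c => rw [AlgHom.commutes]; exact hc c
  | grade1 o =>
    rcases o with _ | ⟨i, j⟩
    · exact hi
    · exact hY i j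
  | add x y h1 h2 => rw [map_add]; exact ha _ _ h1 h2
  | mul x y h1 h2 => rw [map_mul]; exact hm _ _ h1 h2

/-- The quantum determinant is central. -/
theorem detGL_commute (hq₀ : q ≠ 0) (x : OqGL q n) : Commute (detGL q n) x := by
  refine GL_induction (P := fun x => Commute (detGL q n) x)
    (fun c => (Algebra.commutes c _).symm) (detGL_commute_YGL hq₀) ?_
    (fun x y h1 h2 => h1.add_right h2) (fun x y h1 h2 => h1.mul_right h2) x
  rw [Commute, SemiconjBy, detGL_mul_detInvGL, detInvGL_mul_detGL]

/-- Clearing denominators; for products this uses the centrality of `Δ`. -/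
theorem exists_detGL_pow_mul_mem (hq₀ : q ≠ 0) (x : OqGL q n) : ∃ (k : ℕ) (e :
    ℤ), detGL q n ^ k * x ∈ filt q e := by
  have step : ∀ (x : OqGL q n) (k : ℕ) (e : ℤ) (l : ℕ), detGL q n ^ k * x ∈ filt q e →
      detGL q n ^ (l + k) * x ∈ filt q (mdeg (l • idExp n) + e) := by
    intro x k e l h
    rw [pow_add, mul_assoc]
    exact mul_mem_filt (detGL_pow_mem_filt l) h
  refine GL_induction (P := fun x => ∃ (k : ℕ) (e : ℤ), detGL q n ^ k * x ∈ filt q e)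
    ?_ ?_ ?_ ?_ ?_ x
  · intro c
    refine ⟨0, 0, ?_⟩
    rw [pow_zero, one_mul, Algebra.algebraMap_eq_smul_one]
    exact Submodule.smul_mem _ _ one_mem_filt
  · intro i j
    exact ⟨0, _, by rw [pow_zero, one_mul]; exact YGL_mem_filt (i, j)⟩
  · exact ⟨1, 0, by rw [pow_one, detGL_mul_detInvGL]; exact one_mem_filt⟩
  · rintro x y ⟨k, e, h⟩ ⟨l, f, h'⟩
    refine ⟨l + k, max (mdeg (l • idExp n) + e) (mdeg (k • idExp n) + f), ?_⟩
    rw [mul_add]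
    refine Submodule.add_mem _ (filt_mono (le_max_left _ _) (step _ _ _ _ h))
      (filt_mono (le_max_right _ _) ?_)
    rw [add_comm l]
    exact step _ _ _ _ h'
  · rintro x y ⟨k, e, h⟩ ⟨l, f, h'⟩
    refine ⟨k + l, e + f, ?_⟩
    have : detGL q n ^ (k + l) * (x * y) = detGL q n ^ k * x * (detGL q n ^ l * y) := by
      rw [pow_add, mul_assoc, mul_assoc, ← mul_assoc (detGL q n ^ l) x,
        ((detGL_commute hq₀ x).pow_left l).eq, mul_assoc]
    rw [this]
    exact mul_mem_filt h h'

end Determinant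

/-! ### Central exponents -/

section Central

variable {n : ℕ}

/-- The exponents of monomials which are central up to lower degree. -/
def IsCentralExp (m : Fin n × Fin n → ℤ) : Prop := ∀ p, cright m p = cleft p m

theorem cexp_sub (i j α β : Fin n) : cexp (j, β) (i, α) - cexp (i, α) (j, β)
    = (if i = j then Int.sign ((α : ℤ) - β) else 0) + if α = β then Int.sign ((i :
        ℤ) - j) else 0 := by
  unfold cexp
  rcases lt_trichotomy i j with h | rfl | h <;> rcases lt_trichotomy α β with h' | rfl | h'
  · simp [h.ne, h.ne', h'.ne, h'.ne']
  · have : Int.sign ((i : ℤ) - j) = -1 := Int.sign_eq_neg_one_of_neg (by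
      have : (i : ℤ) < j := by exact_mod_cast h
      omega)
    simp [h.ne, h, h.not_gt, this]
  · simp [h.ne, h.ne', h'.ne, h'.ne']
  · have : Int.sign ((α : ℤ) - β) = -1 := Int.sign_eq_neg_one_of_neg (by
      have : (α : ℤ) < β := by exact_mod_cast h'
      omega)
    simp [h'.ne, h', h'.not_gt, this]
  · simp
  · have : Int.sign ((α : ℤ) - β) = 1 := Int.sign_eq_one_of_pos (by
      have : (β : ℤ) < α := by exact_mod_cast h'
      omega)
    simp [h'.ne', h', h'.not_gt, this]
  · simp [h.ne, h.ne', h'.ne, h'.ne']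
  · have : Int.sign ((i : ℤ) - j) = 1 := Int.sign_eq_one_of_pos (by
      have : (j : ℤ) < i := by exact_mod_cast h
      omega)
    simp [h.ne', h, h.not_gt, this]
  · simp [h.ne, h.ne', h'.ne, h'.ne']

theorem cright_sub_cleft (m : Fin n × Fin n → ℤ) (i α : Fin n) :
    cright m (i, α) - cleft (i, α) m
      = ∑ β, m (i, β) * Int.sign ((α : ℤ) - β) + ∑ j, m (j, α) * Int.sign ((i : ℤ) - j) := by
  unfold cright cleft
  rw [← Finset.sum_sub_distrib, Fintype.sum_prod_type]
  simp only [← mul_sub, cexp_sub, mul_add, Finset.sum_add_distrib, mul_ite, mul_zero]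
  congr 1
  · rw [Finset.sum_eq_single i]
    · simp
    · intro j _ hj; simp [hj.symm]
    · simp
  · simp

/-- Moving `α` one place changes only the two signs at the positions involved, each by one. -/
theorem sum_sign_succ (f : Fin n → ℤ) {α α' : Fin n} (h : (α' : ℕ) = α + 1) :
    ∑ β, f β * Int.sign ((α' : ℤ) - β) - ∑ β, f β * Int.sign ((α : ℤ) - β) = f α + f α' := by
  have hne : α ≠ α' := fun e => by rw [e] at h; omega
  rw [← Finset.sum_sub_distrib, ← Finset.sum_pair hne]
  symm
  rw [← Finset.sum_subset (Finset.subset_univ {α, α'})]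
  · refine Finset.sum_congr rfl fun β hβ => ?_
    simp only [Finset.mem_insert, Finset.mem_singleton] at hβ
    rcases hβ with rfl | rfl
    · rw [h]; simp
    · rw [h]; simp
  · intro β _ hβ
    simp only [Finset.mem_insert, Finset.mem_singleton, not_or, Fin.ext_iff] at hβ
    rw [sub_eq_zero]
    congr 1
    rw [h]
    push_cast
    rcases Nat.lt_or_ge β α with hlt | hge
    · rw [Int.sign_eq_one_of_pos (by omega), Int.sign_eq_one_of_pos (by omega)]
    · rw [Int.sign_eq_neg_one_of_neg (by omega), Int.sign_eq_neg_one_of_neg (by omega)]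

variable {m : Fin n × Fin n → ℤ}

/-- The mixed second difference of the centrality equations over the `2 × 2` block is `2 * (m (i',
α') - m (i, α))`. -/
theorem IsCentralExp.diag_succ (hm : IsCentralExp m) {i i' α α' : Fin n} (hi : (i' : ℕ) = i + 1)
    (hα : (α' : ℕ) = α + 1) : m (i', α') = m (i, α) := by
  have h : ∀ i α : Fin n, ∑ β, m (i, β) * Int.sign ((α : ℤ) - β)
      + ∑ j, m (j, α) * Int.sign ((i : ℤ) - j) = 0 := fun i α => by
    rw [← cright_sub_cleft, hm (i, α), sub_self]
  have h1 := h i α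
  have h2 := h i α'
  have h3 := h i' α
  have h4 := h i' α'
  have r1 := sum_sign_succ (fun β => m (i, β)) hα
  have r2 := sum_sign_succ (fun β => m (i', β)) hα
  have c1 := sum_sign_succ (fun j => m (j, α)) hi
  have c2 := sum_sign_succ (fun j => m (j, α')) hi
  beta_reduce at r1 r2 c1 c2
  linarith

theorem IsCentralExp.diag_add (hm : IsCentralExp m) (t : ℕ) {i i' α α' : Fin n}
    (hi : (i' : ℕ) = i + t) (hα : (α' : ℕ) = α + t) : m (i', α') = m (i, α) := by
  induction t generalizing i' α' with
  | zero =>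
    have h1 : i' = i := Fin.ext hi
    have h2 : α' = α := Fin.ext hα
    rw [h1, h2]
  | succ t ih =>
    rw [← ih (i' := ⟨i + t, by omega⟩) (α' := ⟨α + t, by omega⟩) rfl rfl]
    exact hm.diag_succ hi hα

/-- Subtract the centrality equations of neighbouring entries of the first row. Constancy along
diagonals makes the column sums cancel except for their ends. -/
theorem IsCentralExp.wrap (hm : IsCentralExp m) {z l α α' : Fin n} (hz : (z : ℕ) = 0)
    (hl : (l : ℕ) + 1 = n) (hα : (α' : ℕ) = α + 1) : m (z, α') + m (l, α) = 0 := by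
  obtain ⟨N, rfl⟩ : ∃ N, n = N + 1 := ⟨l, hl.symm⟩
  have hz' : z = 0 := Fin.ext hz
  have hl' : l = Fin.last N := Fin.ext (by simp; omega)
  subst hz' hl'
  have h : ∀ α : Fin (N + 1),
      ∑ β, m (0, β) * Int.sign ((α : ℤ) - β) - ∑ j : Fin N, m (j.succ, α) = 0 := fun α => by
    have := cright_sub_cleft m 0 α
    rw [hm (0, α), sub_self, Fin.sum_univ_succ (fun j => m (j, α) * Int.sign (((0 : Fin (N + 1)) :
        ℤ) - j))] at this
    have e : ∀ j : Fin N, m (j.succ, α) * Int.sign (((0 : Fin (N + 1)) : ℤ) - ((j.succ :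
        Fin (N + 1)) : ℤ))
        = - m (j.succ, α) := fun j => by
      rw [Int.sign_eq_neg_one_of_neg (by simp; omega)]; ring
    simp only [e, Finset.sum_neg_distrib] at this
    simp only [Fin.val_zero, Nat.cast_zero, sub_self, Int.sign_zero, mul_zero, zero_add] at this
    linarith
  have h1 := h α
  have h2 := h α'
  have r := sum_sign_succ (fun β => m (0, β)) hα
  have s1 : ∑ j : Fin N, m (j.succ, α') = ∑ j : Fin N, m (j.castSucc, α) :=
    Finset.sum_congr rfl fun j _ => hm.diag_succ (by simp) hα
  have s2 := Fin.sum_univ_succ fun j : Fin (N + 1) => m (j, α)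
  have s3 := Fin.sum_univ_castSucc fun j : Fin (N + 1) => m (j, α)
  beta_reduce at r s2 s3
  linarith

/-- A nonnegative central exponent vector is a multiple of that of the determinant. -/
theorem IsCentralExp.eq_smul_of_nonneg (hm : IsCentralExp m) (h0 : ∀ p, 0 ≤ m p) :
    ∃ k : ℕ, m = k • idExp n := by
  rcases n with _ | N
  · exact ⟨0, Subsingleton.elim _ _⟩
  refine ⟨(m (0, 0)).toNat, ?_⟩
  funext ⟨i, α⟩
  simp only [Pi.smul_apply, idExp, nsmul_eq_mul, Int.toNat_of_nonneg (h0 _)]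
  rcases lt_trichotomy i α with h | rfl | h
  · have hlt : (i : ℕ) < α := h
    rw [if_neg h.ne, mul_zero]
    -- Slide the entry along its diagonal to the first row; by `wrap` it is minus an entry of the
    -- last row. Both are nonnegative, so both are zero.
    have e1 := hm.diag_add (i := 0) (α := ⟨α - i, by omega⟩) (i' := i) (α' := α) i
      (by simp) (by simp; omega)
    have e2 := hm.wrap (z := 0) (l := Fin.last N) (α := ⟨α - i - 1, by omega⟩)
      (α' := ⟨α - i, by omega⟩) rfl (by simp) (by simp; omega)
    have := h0 (0, ⟨α - i, by omega⟩)
    have := h0 (Fin.last N, ⟨α - i - 1, by omega⟩)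
    omega
  · rw [if_pos rfl, mul_one]
    exact hm.diag_add (i := 0) (α := 0) (i' := i) (α' := i) i (by simp) (by simp)
  · have hlt : (α : ℕ) < i := h
    rw [if_neg h.ne', mul_zero]
    have e1 := hm.diag_add (i := i) (α := α) (i' := Fin.last N) (α' := ⟨α + (N - i), by omega⟩)
      (N - i) (by simp; omega) rfl
    have e2 := hm.wrap (z := 0) (l := Fin.last N) (α := ⟨α + (N - i), by omega⟩)
      (α' := ⟨α + (N - i) + 1, by omega⟩) rfl (by simp) (by simp)
    have := h0 (0, ⟨α + (N - i) + 1, by omega⟩)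
    have := h0 (i, α)
    omega

/-- A central exponent vector with one negative entry has it at a corner off the diagonal. -/
theorem IsCentralExp.corner_of_neg (hm : IsCentralExp m) (hn : 1 < n) {i α : Fin n}
    (hneg : m (i, α) < 0) (h0 : ∀ p, p ≠ (i, α) → 0 ≤ m p) :
    ((i : ℕ) = 0 ∧ (α : ℕ) + 1 = n) ∨ ((i : ℕ) + 1 = n ∧ (α : ℕ) = 0) := by
  -- A neighbour on the same diagonal would be equally negative, so the diagonal consists of this
  -- entry alone.
  have h1 : ¬ ((i : ℕ) + 1 < n ∧ (α : ℕ) + 1 < n) := by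
    rintro ⟨hi, hα⟩
    have e := hm.diag_succ (i := i) (α := α) (i' := ⟨i + 1, hi⟩) (α' := ⟨α + 1, hα⟩) rfl rfl
    have := h0 (⟨i + 1, hi⟩, ⟨α + 1, hα⟩) (by simp [Fin.ext_iff])
    omega
  have h2 : ¬ (0 < (i : ℕ) ∧ 0 < (α : ℕ)) := by
    rintro ⟨hi, hα⟩
    have e := hm.diag_succ (i' := i) (α' := α) (i := ⟨i - 1, by omega⟩) (α := ⟨α - 1, by omega⟩)
      (by simp; omega) (by simp; omega)
    have := h0 (⟨i - 1, by omega⟩, ⟨α - 1, by omega⟩) (by simp [Fin.ext_iff]; omega)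
    omega
  omega

/-- The commutation form is skew-symmetric: a monomial commutes with itself. -/
theorem sum_mul_cright_sub_cleft (m : Fin n × Fin n → ℤ) :
    ∑ p, m p * (cright m p - cleft p m) = 0 := by
  unfold cright cleft
  simp only [mul_sub, Finset.mul_sum, Finset.sum_sub_distrib]
  rw [sub_eq_zero]
  rw [Finset.sum_comm]
  exact Finset.sum_congr rfl fun p _ => Finset.sum_congr rfl fun p' _ => by ring

theorem exists_scount_eq (h0 : ∀ p, 0 ≤ m p) : ∃ s, scount s = m := by
  refine ⟨∑ p, (m p).toNat • {p}, ?_⟩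
  funext p
  have : ∀ s : Multiset (Fin n × Fin n), scount s p = s.count p := by
    intro s
    simp only [scount, wcount]
    conv_rhs => rw [← Multiset.coe_toList s, Multiset.coe_count]
    exact congrArg Nat.cast (List.countP_congr fun x _ => by simp)
  rw [this, Multiset.count_sum', Finset.sum_eq_single p]
  · simp [h0 p]
  · intro p' _ h; simp [h.symm]
  · simp

end Central

/-! ### Symbols of derivations -/

section Symbol

variable {K : Type*} [Field K] {q : K} {n : ℕ}

/-- The leading coefficient of the commutator of a monomial and a generator. -/
def chi (q : K) (m : Fin n × Fin n → ℤ) (p : Fin n × Fin n) : K := q ^ cright m p - q ^ cleft p m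

theorem zpow_injective_of_not_root (hq₀ : q ≠ 0) (hq : ∀ m : ℕ, 0 < m → q ^ m ≠ 1) {a b : ℤ}
    (h : q ^ a = q ^ b) : a = b := by
  have key : ∀ {a b : ℤ}, q ^ a = q ^ b → ¬ a < b := by
    intro a b h hlt
    have h1 : q ^ (b - a) = 1 := by rw [zpow_sub₀ hq₀, h, div_self (zpow_ne_zero _ hq₀)]
    obtain ⟨k, hk⟩ := Int.eq_ofNat_of_zero_le (by omega : 0 ≤ b - a)
    rw [hk, zpow_natCast] at h1
    exact hq k (by omega) h1
  exact le_antisymm (not_lt.1 (key h.symm)) (not_lt.1 (key h))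

theorem chi_eq_zero_iff (hq₀ : q ≠ 0) (hq : ∀ m : ℕ, 0 < m → q ^ m ≠ 1)
    {m : Fin n × Fin n → ℤ} {p : Fin n × Fin n} : chi q m p = 0 ↔ cright m p = cleft p m := by
  rw [chi, sub_eq_zero]
  exact ⟨zpow_injective_of_not_root hq₀ hq, fun h => by rw [h]⟩

theorem Der.map_sub (D : Der K (OqGL q n)) (x y : OqGL q n) : D (x - y) = D x - D y :=
  _root_.map_sub D.1 x y

theorem Der.map_smul (D : Der K (OqGL q n)) (c : K) (x : OqGL q n) : D (c • x) = c • D x :=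
  _root_.map_smul D.1 c x

theorem Der.sub_apply (D E : Der K (OqGL q n)) (x : OqGL q n) : (D - E) x = D x - E x := rfl

theorem Der.map_one (D : Der K (OqGL q n)) : D 1 = 0 := by simpa using D.leibniz 1 1

/-- The derivation raises degrees by at most `d`. -/
def HasDeg (D : Der K (OqGL q n)) (d : ℤ) : Prop :=
  ∀ p : Fin n × Fin n, D (YGL q n p.1 p.2) ∈ filt q (d + pdeg p)

theorem HasDeg.word_mem {D : Der K (OqGL q n)} {d : ℤ} (hD : HasDeg D d)
    (w : List (Fin n × Fin n)) : D (word q n w) ∈ filt q (d + mdeg (wcount w)) := by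
  induction w with
  | nil => rw [word_nil, Der.map_one]; exact Submodule.zero_mem _
  | cons p w ih =>
    rw [word_cons, Der.leibniz, wcount_cons, mdeg_add, mdeg_single]
    refine Submodule.add_mem _ (filt_mono ?_ (mul_mem_filt (hD p) (word_mem_filt (w := w) le_rfl)))
      (filt_mono ?_ (mul_mem_filt (YGL_mem_filt p) ih)) <;> omega

theorem HasDeg.map_mem {D : Der K (OqGL q n)} {d e : ℤ} (hD : HasDeg D d) {x : OqGL q n}
    (hx : x ∈ filt q e) : D x ∈ filt q (d + e) := by
  refine filt_induction (P := fun x => D x ∈ filt q (d + e)) ?_ ?_ ?_ ?_ hx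
  · exact (_root_.map_zero D.1).symm ▸ Submodule.zero_mem _
  · intro x y h1 h2
    exact (_root_.map_add D.1 x y).symm ▸ Submodule.add_mem _ h1 h2
  · intro c x h; rw [Der.map_smul]; exact Submodule.smul_mem _ _ h
  · intro w hw; exact filt_mono (by omega) (hD.word_mem w)

/-- Apply `D` to the leading `q`-commutation of two generators and compare coefficients at `m` plus
both; the lower-degree error does not reach that degree. This is the cocycle condition in the graded
algebra: where `chi q m` is not identically zero, the symbol at `m` is proportional to it. -/
theorem HasDeg.symbol_comm (hq₀ : q ≠ 0) {D : Der K (OqGL q n)} {m : Fin n × Fin n → ℤ}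
    (hD : HasDeg D (mdeg m)) (p p' : Fin n × Fin n) :
    chi q m p' * coef hq₀ (m + Pi.single p 1) (D (YGL q n p.1 p.2))
      = chi q m p * coef hq₀ (m + Pi.single p' 1) (D (YGL q n p'.1 p'.2)) := by
  have h := coef_of_lt hq₀ (hD.map_mem (YGL_swap hq₀ p p'))
    (m := m + Pi.single p 1 + Pi.single p' 1) (by simp only [mdeg_add, mdeg_single]; omega)
  have hp := hD p
  have hp' := hD p'
  rw [← mdeg_single, ← mdeg_add] at hp hp'
  rw [Der.map_sub, Der.map_smul, Der.leibniz, Der.leibniz, map_sub, map_add, map_smul, map_add,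
    coef_mul_YGL hq₀ hp, add_right_comm, coef_YGL_mul hq₀ hp', coef_mul_YGL hq₀ hp',
    add_right_comm, coef_YGL_mul hq₀ hp, cright_add, cright_add, cleft_add, cleft_add,
    cright_single, cright_single, cleft_single, cleft_single, smul_eq_mul] at h
  simp only [zpow_add₀ hq₀, zpow_sub₀ hq₀] at h
  unfold chi
  have e1 := zpow_ne_zero (cexp p p') hq₀
  have e2 := zpow_ne_zero (cexp p' p) hq₀
  field_simp at h
  linear_combination (mul_eq_zero.1 h).resolve_left e1

theorem coef_ad (hq₀ : q ≠ 0) {m : Fin n × Fin n → ℤ} {x : OqGL q n} (hx : x ∈ filt q (mdeg m))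
    (p : Fin n × Fin n) : coef hq₀ (m + Pi.single p 1) (ad K x (YGL q n p.1 p.2))
      = chi q m p * coef hq₀ m x := by
  rw [ad_apply, map_sub, coef_mul_YGL hq₀ hx, coef_YGL_mul hq₀ hx, chi, sub_mul]

theorem hasDeg_ad {x : OqGL q n} {d : ℤ} (hx : x ∈ filt q d) : HasDeg (ad K x) d := fun p => by
  rw [ad_apply]
  refine Submodule.sub_mem _ (mul_mem_filt hx (YGL_mem_filt p)) ?_
  rw [add_comm]
  exact mul_mem_filt (YGL_mem_filt p) hx

theorem HasDeg.sub {D E : Der K (OqGL q n)} {d : ℤ} (hD : HasDeg D d) (hE : HasDeg E d) :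
    HasDeg (D - E) d := fun p => Submodule.sub_mem _ (hD p) (hE p)

theorem add_single_neg {m : Fin n × Fin n → ℤ} {p p' : Fin n × Fin n} (h : m p < 0)
    (hne : p' ≠ p) : (m + Pi.single p' (1 : ℤ) : Fin n × Fin n → ℤ) p < 0 := by
  simp [hne.symm, h]

/-- A noncentral leading exponent of a derivation is nonnegative. -/
theorem HasDeg.nonneg_of_coef_ne_zero (hq₀ : q ≠ 0) (hq : ∀ m : ℕ, 0 < m → q ^ m ≠ 1)
    {D : Der K (OqGL q n)} {m : Fin n × Fin n → ℤ}
    (hD : HasDeg D (mdeg m)) (hm : ¬ IsCentralExp m) {p : Fin n × Fin n}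
    (hp : coef hq₀ (m + Pi.single p 1) (D (YGL q n p.1 p.2)) ≠ 0) (p₀ : Fin n × Fin n) :
    0 ≤ m p₀ := by
  by_contra hneg
  rw [not_le] at hneg
  -- Adding a generator other than `p₀` leaves the negative entry in place, so only the value of `D`
  -- at `p₀` can have a component of shift `m`.
  have hz : ∀ p', p' ≠ p₀ → coef hq₀ (m + Pi.single p' 1) (D (YGL q n p'.1 p'.2)) = 0 :=
    fun p' hp' => coef_of_neg hq₀ (hD p') (add_single_neg hneg hp')
  have hpp : p = p₀ := by
    by_contra hc
    exact hp (hz p hc)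
  subst hpp
  have hc : ∀ p', p' ≠ p → cright m p' = cleft p' m := by
    intro p' hp'
    have := hD.symbol_comm hq₀ p p'
    rw [hz p' hp', mul_zero] at this
    exact (chi_eq_zero_iff hq₀ hq).1 ((mul_eq_zero.1 this).resolve_right hp)
  -- The exponents agree away from `p`. As `m p ≠ 0`, skew-symmetry forces agreement at `p` too,
  -- contradicting noncentrality.
  have hs := sum_mul_cright_sub_cleft m
  rw [Finset.sum_eq_single p] at hs
  · refine hm fun p' => ?_
    by_cases e : p' = p
    · subst e
      rcases mul_eq_zero.1 hs with h | h
      · omega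
      · omega
    · exact hc p' e
  · intro p' _ e; rw [hc p' e, sub_self, mul_zero]
  · simp

/-- Subtracting an inner derivation removes the noncentral part of the symbol. -/
theorem HasDeg.exists_ad (hq₀ : q ≠ 0) (hq : ∀ m : ℕ, 0 < m → q ^ m ≠ 1)
    {D : Der K (OqGL q n)} {d : ℤ} (hD : HasDeg D d) :
    ∃ x ∈ filt q d, ∀ (m : Fin n × Fin n → ℤ) (p : Fin n × Fin n), mdeg m = d →
      coef hq₀ (m + Pi.single p 1) ((D - ad K x : Der K (OqGL q n)) (YGL q n p.1 p.2)) ≠ 0 →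
          IsCentralExp m := by
  classical
  set T : Set (Fin n × Fin n → ℤ) := {m | mdeg m = d ∧ ¬ IsCentralExp m ∧
    ∃ p, coef hq₀ (m + Pi.single p 1) (D (YGL q n p.1 p.2)) ≠ 0} with hT
  have hfin : T.Finite := by
    have : (⋃ p : Fin n × Fin n, (fun m => m + Pi.single p 1) ⁻¹'
        {m | coef hq₀ m (D (YGL q n p.1 p.2)) ≠ 0}).Finite :=
      Set.finite_iUnion fun p => (finite_coef_support hq₀ _).preimage
        (fun _ _ _ _ h => add_right_cancel h)
    refine this.subset fun m hm => ?_
    obtain ⟨-, -, p, hp⟩ := hm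
    exact Set.mem_iUnion.2 ⟨p, hp⟩
  have hex : ∀ m ∈ T, ∃ (s : Multiset (Fin n × Fin n)) (c : K), scount s = m ∧
      ∀ p, coef hq₀ (m + Pi.single p 1) (D (YGL q n p.1 p.2)) = chi q m p * c := by
    rintro m ⟨rfl, hc, p, hp⟩
    obtain ⟨s, hs⟩ := exists_scount_eq (hD.nonneg_of_coef_ne_zero hq₀ hq hc hp)
    have : ∃ p', cright m p' ≠ cleft p' m := by
      by_contra! h; exact hc h
    obtain ⟨p', hp'⟩ := this
    have hchi : chi q m p' ≠ 0 := fun e => hp' ((chi_eq_zero_iff hq₀ hq).1 e)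
    -- The ratio to `chi` does not depend on the generator, by `symbol_comm`; it is the coefficient
    -- of the monomial `m` in the required `x`.
    refine ⟨s, coef hq₀ (m + Pi.single p' 1) (D (YGL q n p'.1 p'.2)) / chi q m p', hs, fun p => ?_⟩
    rw [mul_div_assoc', eq_div_iff hchi, mul_comm, hD.symbol_comm hq₀ p p']
  choose! s c hs hc using hex
  set x : OqGL q n := ∑ m ∈ hfin.toFinset, c m • mono q (s m) with hx
  have hxmem : x ∈ filt q d := by
    refine Submodule.sum_mem _ fun m hm => Submodule.smul_mem _ _ ?_
    have hm' : m ∈ T := hfin.mem_toFinset.1 hm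
    have := mono_mem_filt (q := q) (s m)
    rwa [hs m hm', hm'.1] at this
  have hcoef : ∀ m, coef hq₀ m x = if m ∈ T then c m else 0 := by
    intro m
    rw [hx, map_sum]
    have : ∀ m' ∈ hfin.toFinset, coef hq₀ m (c m' • mono q (s m')) = if m' = m then c m' else 0 :=
        by
      intro m' hm'
      rw [map_smul, coef_mono, hs m' (hfin.mem_toFinset.1 hm')]
      simp
    rw [Finset.sum_congr rfl this, Finset.sum_ite_eq']
    simp only [hfin.mem_toFinset]
  refine ⟨x, hxmem, fun m p hmd hne => ?_⟩
  by_contra hcen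
  apply hne
  subst hmd
  rw [Der.sub_apply, map_sub, coef_ad hq₀ hxmem, hcoef]
  by_cases hmT : m ∈ T
  · rw [if_pos hmT, hc m hmT, sub_self]
  · rw [if_neg hmT, mul_zero, sub_zero]
    by_contra h
    exact hmT ⟨rfl, hcen, p, h⟩

end Symbol

/-! ### Representations attached to a diagonal `2 × 2` block -/

section BlockDet

variable {K : Type*} [Field K] {q : K} {n : ℕ} {A : Type*} [Ring A] [Algebra K A]

theorem invCount_swap {k k' : Fin n} (hk : (k' : ℕ) = k + 1) : invCount (Equiv.swap k k') = 1 := by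
  have h := invMap_comp_swap (f := (1 : Equiv.Perm (Fin n))) hk (by
    simp only [Equiv.Perm.one_apply, Fin.lt_def]; omega)
  have h1 : invMap (1 : Equiv.Perm (Fin n)) = 0 := invCount_one
  rw [h1, zero_add] at h
  exact h

theorem perm_eq_one_or_swap {k k' : Fin n} (hne : k ≠ k') {σ : Equiv.Perm (Fin n)}
    (h : ∀ i, σ i = i ∨ (i = k ∧ σ i = k') ∨ (i = k' ∧ σ i = k)) :
    σ = 1 ∨ σ = Equiv.swap k k' := by
  rcases h k with hk | hk | hk
  · left
    refine Equiv.ext fun i => ?_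
    rcases h i with hi | hi | hi
    · exact hi
    · exact absurd (by rw [← hi.2, hi.1, hk]) hne
    · exact absurd (σ.injective (hk.trans hi.2.symm)) (by rw [hi.1]; exact hne)
  · right
    refine Equiv.ext fun i => ?_
    rcases h i with hi | hi | hi
    · have h1 : i ≠ k := fun e => by rw [e, hk.2] at hi; exact hne hi.symm
      have h2 : i ≠ k' := fun e => h1 (σ.injective (by rw [hi, hk.2, e]))
      rw [hi, Equiv.swap_apply_of_ne_of_ne h1 h2]
    · rw [hi.2, hi.1, Equiv.swap_apply_left]
    · rw [hi.2, hi.1, Equiv.swap_apply_right]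
  · exact absurd hk.1 hne

/-- Only the identity and the transposition contribute, and together they give the `2 × 2` quantum
minor. The family `T` records any factorisation of that minor over the two adjacent positions. -/
theorem qdet_block {k k' : Fin n} (hk : (k' : ℕ) = k + 1) {Z : Fin n → Fin n → A}
    (hZ : ∀ i α, i ≠ α → ¬ (i = k ∧ α = k') → ¬ (i = k' ∧ α = k) → Z i α = 0) {T : Fin n → A}
    (hT : ∀ i, i ≠ k → i ≠ k' → T i = Z i i)
    (hd : T k * T k' = Z k k * Z k' k' - q • (Z k k' * Z k' k)) :
    qdet q Z = (List.ofFn T).prod := by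
  have hne : k ≠ k' := fun e => by rw [e] at hk; omega
  have hswap : (1 : Equiv.Perm (Fin n)) ≠ Equiv.swap k k' := fun e => hne (by
    have := DFunLike.congr_fun e k
    rwa [Equiv.Perm.one_apply, Equiv.swap_apply_left] at this)
  rw [qdet, Fintype.sum_eq_add 1 (Equiv.swap k k') hswap]
  · obtain ⟨l₁, l₂, hl, h₁, h₂⟩ := finRange_split hk
    have e : ∀ (f : Fin n → A), (∀ i, i ≠ k → i ≠ k' → f i = T i) →
        (List.ofFn f).prod = (l₁.map T).prod * (f k * f k') * (l₂.map T).prod := by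
      intro f hf
      rw [List.ofFn_eq_map, hl, List.map_append, List.map_cons, List.map_cons, List.prod_append,
        List.prod_cons, List.prod_cons, List.map_congr_left (l := l₁) fun i hi => hf i (h₁ i hi).1
            (h₁ i hi).2,
        List.map_congr_left (l := l₂) fun i hi => hf i (h₂ i hi).1 (h₂ i hi).2]
      simp only [mul_assoc]
    rw [e T fun _ _ _ => rfl, e _ fun i h h' => by rw [Equiv.Perm.one_apply]; exact (hT i h
        h').symm,
      e _ fun i h h' => by rw [Equiv.swap_apply_of_ne_of_ne h h']; exact (hT i h h').symm,
      invCount_one, invCount_swap hk, hd, Equiv.swap_apply_left, Equiv.swap_apply_right]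
    simp only [Equiv.Perm.one_apply, pow_zero, one_smul, pow_one, mul_sub, sub_mul, neg_smul,
      mul_smul_comm, smul_mul_assoc]
    abel
  · rintro σ ⟨h1, h2⟩
    obtain ⟨i, hi⟩ : ∃ i, ¬ (σ i = i ∨ (i = k ∧ σ i = k') ∨ (i = k' ∧ σ i = k)) := by
      by_contra! hc
      rcases perm_eq_one_or_swap hne hc with e | e
      · exact h1 e
      · exact h2 e
    push Not at hi
    rw [List.prod_eq_zero, smul_zero]
    rw [List.mem_ofFn']
    exact ⟨i, hZ i (σ i) (Ne.symm hi.1) (fun h => hi.2.1 h.1 h.2) fun h => hi.2.2 h.1 h.2⟩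

end BlockDet

/-! ### Quantum torus operators for a diagonal `2 × 2` block -/

section Block

variable {K : Type*} [Field K] {n : ℕ}

/-- Exponents of `a, b, Δ, u` and of the remaining diagonal variables. -/
abbrev BlockExp (n : ℕ) : Type := ℤ × ℤ × ℤ × ℤ × (Fin n → ℤ)

/-- Left multiplication by `a`. -/
def blockA (K : Type*) [Field K] (n : ℕ) : Module.End K (BlockExp n →₀ K) :=
  wshift (1, 0, 0, 0, 0) fun _ => 1

/-- Left multiplication by `b`. -/
def blockB (q : K) (n : ℕ) : Module.End K (BlockExp n →₀ K) :=
  wshift (0, 1, 0, 0, 0) fun γ => q ^ (-γ.1)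

/-- Left multiplication by `c = u Δ b⁻¹`. -/
def blockC (q : K) (n : ℕ) : Module.End K (BlockExp n →₀ K) :=
  wshift (0, -1, 1, 1, 0) fun γ => q ^ (-γ.1)

/-- Left multiplication by `d = a⁻¹ (1 + q u) Δ`. -/
def blockD (q : K) (n : ℕ) : Module.End K (BlockExp n →₀ K) :=
  wshift ((-1, 0, 1, 0, 0) : BlockExp n) (fun _ => (1 : K))
    + wshift ((-1, 0, 1, 1, 0) : BlockExp n) fun γ => q ^ (1 - 2 * γ.1)

/-- Multiplication by a remaining diagonal variable. -/
def blockT (K : Type*) [Field K] {n : ℕ} (l : Fin n) : Module.End K (BlockExp n →₀ K) :=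
  wshift (0, 0, 0, 0, Pi.single l 1) fun _ => 1

/-- The array of operators with a `2 × 2` block in rows and columns `k, k'`. -/
def blockMat (q : K) (k k' i α : Fin n) : Module.End K (BlockExp n →₀ K) :=
  if i = k ∧ α = k then blockA K n
  else if i = k ∧ α = k' then blockB q n
  else if i = k' ∧ α = k then blockC q n
  else if i = k' ∧ α = k' then blockD q n
  else if i = α then blockT K i
  else 0

theorem add_inv_smul_eq {A : Type*} [Ring A] [Algebra K A] (q : K) (x y : A) :
    x + q⁻¹ • y = x + q • y - (q - q⁻¹) • y := by
  rw [sub_smul]; abel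

theorem blockMat_cases (q : K) (k k' i α : Fin n) :
    (i = k ∧ α = k) ∨ (i = k ∧ α = k') ∨ (i = k' ∧ α = k) ∨ (i = k' ∧ α = k') ∨
      (i = α ∧ i ≠ k ∧ i ≠ k' ∧ blockMat q k k' i α = blockT K i) ∨
      (i ≠ α ∧ ¬ (i = k ∧ α = k') ∧ ¬ (i = k' ∧ α = k) ∧ blockMat q k k' i α = 0) := by
  unfold blockMat
  split_ifs <;> grind

variable {q : K}

theorem blockB_mul_blockA (hq₀ : q ≠ 0) :
    blockB q n * blockA K n = q⁻¹ • (blockA K n * blockB q n) := by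
  rw [blockB, blockA, wshift_mul, wshift_mul, smul_wshift]
  refine wshift_congr (add_comm _ _) fun γ => ?_
  simp only [Prod.fst_add, neg_add, zpow_add₀ hq₀, zpow_neg_one]
  ring

theorem blockC_mul_blockA (hq₀ : q ≠ 0) :
    blockC q n * blockA K n = q⁻¹ • (blockA K n * blockC q n) := by
  rw [blockC, blockA, wshift_mul, wshift_mul, smul_wshift]
  refine wshift_congr (add_comm _ _) fun γ => ?_
  simp only [Prod.fst_add, neg_add, zpow_add₀ hq₀, zpow_neg_one]
  ring

theorem blockD_mul_blockB (hq₀ : q ≠ 0) :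
    blockD q n * blockB q n = q⁻¹ • (blockB q n * blockD q n) := by
  rw [blockD, blockB, add_mul, mul_add, smul_add]
  simp only [wshift_mul, smul_wshift]
  congr 1
  all_goals
    refine wshift_congr (add_comm _ _) fun γ => ?_
    simp only [Prod.fst_add, neg_add, neg_neg, zpow_add₀ hq₀, zpow_one, add_zero]
    field_simp

theorem blockD_mul_blockC (hq₀ : q ≠ 0) :
    blockD q n * blockC q n = q⁻¹ • (blockC q n * blockD q n) := by
  rw [blockD, blockC, add_mul, mul_add, smul_add]
  simp only [wshift_mul, smul_wshift]
  congr 1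
  all_goals
    refine wshift_congr (add_comm _ _) fun γ => ?_
    simp only [Prod.fst_add, neg_add, neg_neg, zpow_add₀ hq₀, zpow_one, add_zero]
    field_simp

theorem blockC_mul_blockB : blockC q n * blockB q n = blockB q n * blockC q n :=
  wshift_commute fun γ => by simp

theorem blockA_mul_blockD (hq₀ : q ≠ 0) : blockA K n * blockD q n
    = wshift (0, 0, 1, 0, 0) (fun _ => 1) + q • (blockB q n * blockC q n) := by
  rw [blockD, blockA, blockB, blockC, mul_add]
  simp only [wshift_mul, smul_wshift]
  congr 1
  · exact wshift_congr (by simp) fun γ => by simp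
  · refine wshift_congr (by simp) fun γ => ?_
    simp only [Prod.fst_add, add_zero, one_mul]
    rw [← zpow_add₀ hq₀, ← zpow_one_add₀ hq₀]
    congr 1; ring

/-- Moving `d` across `a` turns `1 + q u` into `1 + q⁻¹ u`, which vanishes at `u = -q`. This is the
source of the specialisation used below. -/
theorem blockD_mul_blockA (hq₀ : q ≠ 0) : blockD q n * blockA K n
    = wshift (0, 0, 1, 0, 0) (fun _ => 1) + q⁻¹ • (blockB q n * blockC q n) := by
  rw [blockD, blockA, blockB, blockC, add_mul]
  simp only [wshift_mul, smul_wshift]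
  congr 1
  · exact wshift_congr (by simp) fun γ => by simp
  · refine wshift_congr (by simp) fun γ => ?_
    simp only [Prod.fst_add, add_zero, mul_one]
    rw [← zpow_add₀ hq₀, ← zpow_neg_one, ← zpow_add₀ hq₀]
    congr 1; ring

/-- Operators whose weights depend only on the exponent of `a` commute with shifts of the other
exponents. -/
theorem commute_blockMat_of_fst_eq_zero {k k' : Fin n} {δ : BlockExp n} (hδ : δ.1 = 0) (i α :
    Fin n) :
    Commute (wshift δ fun _ => (1 : K)) (blockMat q k k' i α) := by
  have h : ∀ (ε : BlockExp n) (w : ℤ → K), Commute (wshift δ fun _ => (1 : K))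
      (wshift ε fun γ => w γ.1) := fun ε w => wshift_commute fun γ => by simp [hδ]
  unfold blockMat blockA blockB blockC blockD blockT
  split_ifs
  · exact h _ fun _ => 1
  · exact h _ fun i => q ^ (-i)
  · exact h _ fun i => q ^ (-i)
  · exact Commute.add_right (h (-1, 0, 1, 0, 0) fun _ => 1)
      (h (-1, 0, 1, 1, 0) fun i => q ^ (1 - 2 * i))
  · exact h _ fun _ => 1
  · exact Commute.zero_right _

theorem blockMat_mul_eq_zero {k k' : Fin n} (hk : (k' : ℕ) = k + 1) {i j α β : Fin n}
    (hij : i < j) (hαβ : α < β) (h : ¬ (i = k ∧ j = k' ∧ α = k ∧ β = k')) :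
    blockMat q k k' i β * blockMat q k k' j α = 0 := by
  rw [Fin.lt_def] at hij hαβ
  simp only [Fin.ext_iff] at h
  rcases blockMat_cases q k k' i β with h1 | h1 | h1 | h1 | h1 | h1 <;>
  rcases blockMat_cases q k k' j α with h2 | h2 | h2 | h2 | h2 | h2 <;>
  first
  | rw [h1.2.2.2, zero_mul]
  | rw [h2.2.2.2, mul_zero]
  | (exfalso; simp only [Fin.ext_iff, ne_eq] at h1 h2; omega)

theorem isQMat_blockMat (hq₀ : q ≠ 0) {k k' : Fin n} (hk : (k' : ℕ) = k + 1) :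
    IsQMat q (blockMat q k k') := by
  have hne : k ≠ k' := fun e => by rw [e] at hk; omega
  have hA : blockMat q k k' k k = blockA K n := by simp [blockMat]
  have hB : blockMat q k k' k k' = blockB q n := by simp [blockMat, hne.symm]
  have hC : blockMat q k k' k' k = blockC q n := by simp [blockMat, hne.symm]
  have hD : blockMat q k k' k' k' = blockD q n := by simp [blockMat, hne.symm]
  have hcomm : ∀ {l i α : Fin n}, blockT K l * blockMat q k k' i α
      = blockMat q k k' i α * blockT K l := fun {l i α} =>
    commute_blockMat_of_fst_eq_zero rfl i α
  intro l r h
  cases h with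
  | @row i α β h =>
    rw [Fin.lt_def] at h
    rcases blockMat_cases q k k' i β with h1 | h1 | h1 | h1 | h1 | h1 <;>
    rcases blockMat_cases q k k' i α with h2 | h2 | h2 | h2 | h2 | h2 <;>
    first
    | rw [h1.2.2.2, zero_mul, mul_zero, smul_zero]
    | rw [h2.2.2.2, zero_mul, mul_zero, smul_zero]
    | (exfalso; simp only [Fin.ext_iff, ne_eq] at h1 h2; omega)
    | rw [h1.1, h1.2, h2.2, hA, hB, blockB_mul_blockA hq₀]
    | rw [h1.1, h1.2, h2.2, hC, hD, blockD_mul_blockC hq₀]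
  | @col i j α h =>
    rw [Fin.lt_def] at h
    rcases blockMat_cases q k k' j α with h1 | h1 | h1 | h1 | h1 | h1 <;>
    rcases blockMat_cases q k k' i α with h2 | h2 | h2 | h2 | h2 | h2 <;>
    first
    | rw [h1.2.2.2, zero_mul, mul_zero, smul_zero]
    | rw [h2.2.2.2, zero_mul, mul_zero, smul_zero]
    | (exfalso; simp only [Fin.ext_iff, ne_eq] at h1 h2; omega)
    | rw [h1.1, h1.2, h2.1, hA, hC, blockC_mul_blockA hq₀]
    | rw [h1.1, h1.2, h2.1, hB, hD, blockD_mul_blockB hq₀]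
  | @anti i j α β h h' =>
    rw [Fin.lt_def] at h h'
    rcases blockMat_cases q k k' j β with h1 | h1 | h1 | h1 | h1 | h1 <;>
    rcases blockMat_cases q k k' i α with h2 | h2 | h2 | h2 | h2 | h2 <;>
    first
    | rw [h1.2.2.2, zero_mul, mul_zero]
    | rw [h2.2.2.2, zero_mul, mul_zero]
    | (exfalso; simp only [Fin.ext_iff, ne_eq] at h1 h2; omega)
    | rw [h1.1, h1.2, h2.1, h2.2, hB, hC, blockC_mul_blockB]
  | @diag i j α β h h' =>
    by_cases hb : i = k ∧ j = k' ∧ α = k ∧ β = k'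
    · obtain ⟨rfl, rfl, rfl, rfl⟩ := hb
      rw [hA, hB, hC, hD, blockA_mul_blockD hq₀, blockD_mul_blockA hq₀]
      exact add_inv_smul_eq (A := Module.End K (BlockExp n →₀ K)) q _ _
    · refine eq_sub_smul_of_eq_zero (A := Module.End K (BlockExp n →₀ K))
        (blockMat_mul_eq_zero hk h h' hb) ?_
      rw [Fin.lt_def] at h h'
      simp only [Fin.ext_iff] at hb
      rcases blockMat_cases q k k' j β with h1 | h1 | h1 | h1 | h1 | h1 <;>
      rcases blockMat_cases q k k' i α with h2 | h2 | h2 | h2 | h2 | h2 <;>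
      first
      | rw [h1.2.2.2, zero_mul, mul_zero]
      | rw [h2.2.2.2, zero_mul, mul_zero]
      | rw [h1.2.2.2, hcomm]
      | rw [h2.2.2.2, hcomm]
      | (exfalso; simp only [Fin.ext_iff, ne_eq] at h1 h2; omega)

/-- The shift by which the quantum determinant acts. -/
def blockDet (k k' : Fin n) : BlockExp n := (0, 0, 1, 0, fun l => if l = k ∨ l = k' then 0 else 1)

theorem qdet_blockMat (hq₀ : q ≠ 0) {k k' : Fin n} (hk : (k' : ℕ) = k + 1) :
    qdet q (blockMat q k k') = wshift (blockDet k k') fun _ => 1 := by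
  have hne : k ≠ k' := fun e => by rw [e] at hk; omega
  -- The `2 × 2` determinant is placed at position `k` and the trivial factor at `k'`.
  set δ : Fin n → BlockExp n := fun i =>
    if i = k then (0, 0, 1, 0, 0) else if i = k' then 0 else (0, 0, 0, 0, Pi.single i 1) with hδ
  have hsum : ∑ i, δ i = blockDet k k' := by
    refine Prod.ext ?_ (Prod.ext ?_ (Prod.ext ?_ (Prod.ext ?_ ?_)))
    · rw [Prod.fst_sum]
      exact Finset.sum_eq_zero fun i _ => by simp only [hδ]; split_ifs <;> rfl
    · rw [Prod.snd_sum, Prod.fst_sum]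
      exact Finset.sum_eq_zero fun i _ => by simp only [hδ]; split_ifs <;> rfl
    · rw [Prod.snd_sum, Prod.snd_sum, Prod.fst_sum, Finset.sum_eq_single k]
      · simp [hδ, blockDet]
      · intro i _ hi; simp only [hδ, if_neg hi]; split_ifs <;> rfl
      · simp
    · rw [Prod.snd_sum, Prod.snd_sum, Prod.snd_sum, Prod.fst_sum]
      exact Finset.sum_eq_zero fun i _ => by simp only [hδ]; split_ifs <;> rfl
    · rw [Prod.snd_sum, Prod.snd_sum, Prod.snd_sum, Prod.snd_sum]
      funext l
      rw [Finset.sum_apply, Finset.sum_eq_single l]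
      · by_cases h1 : l = k
        · simp [hδ, blockDet, h1]
        · by_cases h2 : l = k'
          · simp [hδ, blockDet, h2, hne.symm]
          · simp [hδ, blockDet, h1, h2]
      · intro i _ hi
        simp only [hδ]
        split_ifs
        · rfl
        · rfl
        · simp [hi.symm]
      · simp
  rw [← hsum, ← prod_ofFn_wshift_one]
  refine qdet_block hk ?_ ?_ ?_
  · intro i α h1 h2 h3
    rcases blockMat_cases q k k' i α with h | h | h | h | h | h
    · exact absurd (h.1.trans h.2.symm) h1
    · exact absurd h h2
    · exact absurd h h3
    · exact absurd (h.1.trans h.2.symm) h1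
    · exact absurd h.1 h1
    · exact h.2.2.2
  · intro i h1 h2
    simp [hδ, blockMat, h1, h2, blockT]
  · simp only [blockMat, hδ, if_true, hne.symm, hne, and_true, and_self, and_false, if_false]
    rw [blockA_mul_blockD hq₀, wshift_mul]
    refine Eq.trans ?_ (add_sub_cancel_right (G := Module.End K (BlockExp n →₀ K)) _ _).symm
    exact wshift_congr (by simp) fun γ => by simp

end Block

/-! ### Vectors in the block model and the specialisation `u = -q` -/

section BlockVectors

variable {K : Type*} [Field K] {q : K} {n : ℕ}

theorem wshift_apply_of_eq {Γ : Type*} [AddCommGroup Γ] {δ γ γ' : Γ} (h : γ' + δ = γ) (w : Γ → K)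
    (v : Γ →₀ K) : wshift δ w v γ = w γ' * v γ' := by
  rw [wshift_apply, ← h, add_sub_cancel_right]

/-- Right multiplication by `a`. -/
def blockRightA (q : K) (n : ℕ) : Module.End K (BlockExp n →₀ K) :=
  wshift (1, 0, 0, 0, 0) fun γ => q ^ (-γ.2.1 - 2 * γ.2.2.2.1)

/-- Specialisation at `u = -q`. -/
def blockEval (q : K) (n : ℕ) : Module.End K (BlockExp n →₀ K) :=
  Finsupp.lsum K fun γ => (-q) ^ γ.2.2.2.1 • Finsupp.lsingle (γ.1, γ.2.1, γ.2.2.1, 0, γ.2.2.2.2)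

theorem blockEval_single (γ : BlockExp n) (c : K) : blockEval q n (Finsupp.single γ c)
    = Finsupp.single (γ.1, γ.2.1, γ.2.2.1, 0, γ.2.2.2.2) ((-q) ^ γ.2.2.2.1 * c) := by
  simp [blockEval]

theorem blockEval_apply {v : BlockExp n →₀ K} {i j l s : ℤ} {τ : Fin n → ℤ}
    (h : ∀ e, e ≠ s → v (i, j, l, e, τ) = 0) :
    blockEval q n v (i, j, l, 0, τ) = (-q) ^ s * v (i, j, l, s, τ) := by
  classical
  conv_lhs => rw [← Finsupp.sum_single v, Finsupp.sum, map_sum, Finsupp.finsetSum_apply]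
  rw [Finset.sum_eq_single (i, j, l, s, τ)]
  · rw [blockEval_single, Finsupp.single_eq_same]
  · rintro ⟨i', j', l', e, τ'⟩ - hne
    rw [blockEval_single, Finsupp.single_apply, ite_eq_right_iff]
    intro he
    simp only [Prod.mk.injEq, true_and] at he
    obtain ⟨rfl, rfl, rfl, rfl⟩ := he
    rw [h e (by rintro rfl; exact hne rfl), mul_zero]
  · intro hs
    rw [Finsupp.notMem_support_iff.1 hs, Finsupp.single_zero, map_zero, Finsupp.zero_apply]

theorem blockEval_wshift (hq₀ : q ≠ 0) (i j l s : ℤ) (τ : Fin n → ℤ) (w : ℤ → K) (v :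
    BlockExp n →₀ K) :
    blockEval q n (wshift (i, j, l, s, τ) (fun γ => w γ.1) v)
      = (-q) ^ s • wshift (i, j, l, 0, τ) (fun γ => w γ.1) (blockEval q n v) := by
  suffices h : blockEval q n ∘ₗ wshift (i, j, l, s, τ) (fun γ => w γ.1)
      = (-q) ^ s • (wshift (i, j, l, 0, τ) (fun γ => w γ.1) ∘ₗ blockEval q n) from
    LinearMap.congr_fun h v
  refine Finsupp.lhom_ext fun γ c => ?_
  rw [LinearMap.smul_apply, LinearMap.comp_apply, LinearMap.comp_apply, wshift_single,
    blockEval_single, blockEval_single, wshift_single, Finsupp.smul_single]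
  congr 1
  simp only [Prod.fst_add, Prod.snd_add, zpow_add₀ (neg_ne_zero.2 hq₀), smul_eq_mul]
  ring

/-- The vectors whose specialisation involves only positive powers of `a`. -/
def blockIdeal (q : K) (n : ℕ) : Submodule K (BlockExp n →₀ K) where
  carrier := {v | ∀ γ : BlockExp n, γ.1 ≤ 0 → blockEval q n v γ = 0}
  add_mem' {v w} hv hw γ h := by rw [map_add, Finsupp.add_apply, hv γ h, hw γ h, add_zero]
  zero_mem' γ _ := by rw [map_zero, Finsupp.zero_apply]
  smul_mem' c v hv γ h := by rw [map_smul, Finsupp.smul_apply, hv γ h, smul_zero]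

theorem wshift_mem_blockIdeal (hq₀ : q ≠ 0) {i : ℤ} (hi : 0 ≤ i) (j l s : ℤ) (τ : Fin n → ℤ)
    (w : ℤ → K) {v : BlockExp n →₀ K} (hv : v ∈ blockIdeal q n) :
    wshift (i, j, l, s, τ) (fun γ => w γ.1) v ∈ blockIdeal q n := fun γ h => by
  rw [blockEval_wshift hq₀, Finsupp.smul_apply, wshift_apply, hv _ (by
    rw [Prod.fst_sub]; dsimp only; omega), mul_zero, smul_zero]

/-- Only `d` lowers the power of `a`. Its weight in passing from `a¹` to `a⁰` is `1 + q⁻¹ u`, which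
specialises to zero. -/
theorem blockMat_mem_blockIdeal (hq₀ : q ≠ 0) {k k' : Fin n} (i α : Fin n) {v : BlockExp n →₀ K}
    (hv : v ∈ blockIdeal q n) : blockMat q k k' i α v ∈ blockIdeal q n := by
  unfold blockMat blockA blockB blockC blockD blockT
  split_ifs
  · exact wshift_mem_blockIdeal hq₀ zero_le_one 0 0 0 0 (fun _ => 1) hv
  · exact wshift_mem_blockIdeal hq₀ le_rfl 1 0 0 0 (fun i => q ^ (-i)) hv
  · exact wshift_mem_blockIdeal hq₀ le_rfl (-1) 1 1 0 (fun i => q ^ (-i)) hv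
  · intro γ h
    rw [LinearMap.add_apply, map_add, Finsupp.add_apply,
      blockEval_wshift hq₀ (-1) 0 1 0 0 (fun _ => 1),
      blockEval_wshift hq₀ (-1) 0 1 1 0 (fun i => q ^ (1 - 2 * i)), Finsupp.smul_apply,
      Finsupp.smul_apply, wshift_apply, wshift_apply, Prod.fst_sub]
    dsimp only
    rcases (by omega : γ.1 = 0 ∨ γ.1 - -1 ≤ 0) with h0 | h0
    · rw [h0]
      norm_num
      field_simp
      ring
    · rw [hv _ (by rw [Prod.fst_sub]; exact h0)]
      simp
  · exact wshift_mem_blockIdeal hq₀ le_rfl 0 0 0 _ (fun _ => 1) hv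
  · exact Submodule.zero_mem _

/-- Left and right multiplications commute; the weight of `blockRightA` is the cost of moving `a`
leftwards past powers of `b` and `u`. -/
theorem commute_blockRightA (hq₀ : q ≠ 0) {k k' : Fin n} (i α : Fin n) :
    Commute (blockRightA q n) (blockMat q k k' i α) := by
  unfold blockRightA blockMat blockA blockB blockC blockD blockT
  split_ifs
  · exact wshift_commute fun γ => by simp
  · refine wshift_commute fun γ => ?_
    simp only [Prod.fst_add, Prod.snd_add]
    rw [← zpow_add₀ hq₀, ← zpow_add₀ hq₀]
    congr 1; ring
  · refine wshift_commute fun γ => ?_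
    simp only [Prod.fst_add, Prod.snd_add]
    rw [← zpow_add₀ hq₀, ← zpow_add₀ hq₀]
    congr 1; ring
  · refine Commute.add_right ?_ ?_
    · exact wshift_commute fun γ => by simp
    · refine wshift_commute fun γ => ?_
      simp only [Prod.fst_add, Prod.snd_add]
      rw [← zpow_add₀ hq₀, ← zpow_add₀ hq₀]
      congr 1; ring
  · exact wshift_commute fun γ => by simp
  · exact Commute.zero_right _

/-- The hypotheses are Leibniz rules for `ba = q⁻¹ab`, `ca = q⁻¹ac`, centrality of the `2 × 2`
determinant with respect to `a`, and `da = Δ + q⁻¹bc`, written for the images of the derivation's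
values in the torus. The last one alone involves the unknown `vΔ`. Specialising `u` to `-q`
expresses `vΔ` through `vb` and `vc`; reading the same equation at `u^s` without specialisation then
gives the identity. -/
theorem block_relation (hq₀ : q ≠ 0) (hq : ∀ m : ℕ, 0 < m → q ^ m ≠ 1)
    {va vb vc vd vΔ : BlockExp n →₀ K}
    (hab : blockRightA q n vb + blockB q n va
      = q⁻¹ • (wshift (0, 1, 0, 0, 0) (fun _ => 1) va + blockA K n vb))
    (hac : blockRightA q n vc + blockC q n va
      = q⁻¹ • (wshift (0, -1, 1, 1, 0) (fun _ => 1) va + blockA K n vc))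
    (hΔ : blockRightA q n vΔ = blockA K n vΔ)
    (hda : blockRightA q n vd + blockD q n va
      = vΔ + q⁻¹ • (wshift (0, -1, 1, 1, 0) (fun _ => 1) vb + blockB q n vc))
    (hJ : blockRightA q n vd ∈ blockIdeal q n) (l s : ℤ) (τ : Fin n → ℤ) :
    vd (-1, -2 * s, l, s, τ) + va (1, -2 * s, l - 1, s, τ) + q⁻¹ * va (1, -2 * s, l - 1, s - 1, τ)
      = vb (0, 1 - 2 * s, l - 1, s, τ) + vc (0, -1 - 2 * s, l, s + 1, τ) := by
  have hpow : ∀ {a : ℤ} {x : K}, a ≠ 0 → q ^ a * x = x → x = 0 := by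
    intro a x ha hx
    by_contra hx0
    exact ha (zpow_injective_of_not_root hq₀ hq (by
      rw [zpow_zero]; exact mul_right_cancel₀ hx0 (by rw [hx, one_mul])))
  -- At `a¹` the contributions of `va` to the two sides cancel, leaving `vb` multiplied by a factor
  -- that vanishes only for `e = s`, since `q` is not a root of unity. The next two steps follow the
  -- same pattern.
  have hb : ∀ l e, e ≠ s → vb (0, 1 - 2 * s, l, e, τ) = 0 := by
    intro l e he
    have h := DFunLike.congr_fun hab (1, 1 - 2 * s, l, e, τ)
    simp only [blockRightA, blockA, blockB, Finsupp.add_apply, Finsupp.smul_apply, smul_eq_mul] at h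
    rw [wshift_apply_of_eq (γ' := (0, 1 - 2 * s, l, e, τ)) (by simp),
      wshift_apply_of_eq (γ' := (1, - 2 * s, l, e, τ)) (by simp; ring),
      wshift_apply_of_eq (γ' := (1, - 2 * s, l, e, τ)) (by simp; ring),
      wshift_apply_of_eq (γ' := (0, 1 - 2 * s, l, e, τ)) (by simp)] at h
    dsimp only at h
    rw [zpow_neg_one] at h
    refine hpow (a := 2 * s - 2 * e) (by omega) ?_
    have e1 : q ^ (2 * s - 2 * e) = q * q ^ (-(1 - 2 * s) - 2 * e) := by
      rw [← zpow_one_add₀ hq₀]; congr 1; ring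
    rw [e1]
    field_simp at h
    linear_combination h
  have hc : ∀ l e, e ≠ s + 1 → vc (0, -1 - 2 * s, l, e, τ) = 0 := by
    intro l e he
    have h := DFunLike.congr_fun hac (1, -1 - 2 * s, l, e, τ)
    simp only [blockRightA, blockA, blockC, Finsupp.add_apply, Finsupp.smul_apply, smul_eq_mul] at h
    rw [wshift_apply_of_eq (γ' := (0, -1 - 2 * s, l, e, τ)) (by simp),
      wshift_apply_of_eq (γ' := (1, - 2 * s, l - 1, e - 1, τ)) (by simp; ring),
      wshift_apply_of_eq (γ' := (1, - 2 * s, l - 1, e - 1, τ)) (by simp; ring),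
      wshift_apply_of_eq (γ' := (0, -1 - 2 * s, l, e, τ)) (by simp)] at h
    dsimp only at h
    rw [zpow_neg_one] at h
    refine hpow (a := 2 * s + 2 - 2 * e) (by omega) ?_
    have e1 : q ^ (2 * s + 2 - 2 * e) = q * q ^ (-(-1 - 2 * s) - 2 * e) := by
      rw [← zpow_one_add₀ hq₀]; congr 1; ring
    rw [e1]
    field_simp at h
    linear_combination h
  have hD : ∀ l e, e ≠ s → vΔ (0, -2 * s, l, e, τ) = 0 := by
    intro l e he
    have h := DFunLike.congr_fun hΔ (1, -2 * s, l, e, τ)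
    simp only [blockRightA, blockA] at h
    rw [wshift_apply_of_eq (γ' := (0, -2 * s, l, e, τ)) (by simp),
      wshift_apply_of_eq (γ' := (0, -2 * s, l, e, τ)) (by simp), one_mul] at h
    refine hpow (a := -(-2 * s) - 2 * e) (by omega) h

  -- After specialisation, the terms from `vd` and `va` have no component at `a⁰`. Each remaining
  -- vector has a single relevant power of `u`, so the equation reads `vΔ = vb + vc` at the
  -- indicated places.
  have hev := congrArg (fun v => blockEval q n v (0, -2 * s, l, 0, τ)) hda
  simp only [map_add, map_smul, Finsupp.add_apply, Finsupp.smul_apply, smul_eq_mul] at hev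
  rw [hJ _ le_rfl, zero_add, blockEval_apply (hD l),
    blockEval_apply (s := s + 1) (v := wshift (0, -1, 1, 1, 0) (fun _ => 1) vb),
        blockEval_apply (s := s + 1) (v := blockB q n vc)] at hev
  rotate_left
  · intro e he
    rw [blockB, wshift_apply_of_eq (γ' := (0, -1 - 2 * s, l, e, τ)) (by simp; ring), hc _ _ he,
        mul_zero]
  · intro e he
    rw [wshift_apply_of_eq (γ' := (0, 1 - 2 * s, l - 1, e - 1, τ)) (by simp; ring),
      hb _ _ (by omega), mul_zero]
  have hva : blockEval q n (blockD q n va) (0, -2 * s, l, 0, τ) = 0 := by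
    rw [blockD, LinearMap.add_apply, map_add, Finsupp.add_apply,
      blockEval_wshift hq₀ (-1) 0 1 0 0 (fun _ => 1),
      blockEval_wshift hq₀ (-1) 0 1 1 0 (fun i => q ^ (1 - 2 * i)), Finsupp.smul_apply,
      Finsupp.smul_apply, wshift_apply_of_eq (γ' := (1, -2 * s, l - 1, 0, τ)) (by simp),
      wshift_apply_of_eq (γ' := (1, -2 * s, l - 1, 0, τ)) (by simp)]
    norm_num
    field_simp
    ring
  rw [hva, blockB, wshift_apply_of_eq (γ' := (0, 1 - 2 * s, l - 1, s, τ)) (by simp; ring),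
    wshift_apply_of_eq (γ' := (0, -1 - 2 * s, l, s + 1, τ)) (by simp; ring),
    zpow_add_one₀ (neg_ne_zero.2 hq₀)] at hev
  -- At `u^s` itself the terms in `vb` and `vc` vanish by `hb` and `hc`, so the right-hand side is
  -- just `vΔ`.
  have hs := DFunLike.congr_fun hda (0, -2 * s, l, s, τ)
  simp only [blockRightA, blockD, blockB, LinearMap.add_apply, Finsupp.add_apply,
    Finsupp.smul_apply, smul_eq_mul] at hs
  rw [wshift_apply_of_eq (γ' := (-1, -2 * s, l, s, τ)) (by simp),
    wshift_apply_of_eq (γ' := (1, -2 * s, l - 1, s, τ)) (by simp),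
    wshift_apply_of_eq (γ' := (1, -2 * s, l - 1, s - 1, τ)) (by simp),
    wshift_apply_of_eq (γ' := (0, 1 - 2 * s, l - 1, s - 1, τ)) (by simp; ring),
    wshift_apply_of_eq (γ' := (0, -1 - 2 * s, l, s, τ)) (by simp; ring),
    hb _ _ (by omega), hc _ _ (by omega)] at hs
  dsimp only at hs hev
  have e1 : -(-2 * s) - 2 * s = 0 := by ring
  rw [e1] at hs
  norm_num at hs hev
  have hne : (-q) ^ s ≠ 0 := zpow_ne_zero _ (neg_ne_zero.2 hq₀)
  have hev' : (-q) ^ s * (vΔ (0, -(2 * s), l, s, τ) - (vb (0, 1 - 2 * s, l - 1, s, τ)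
      + vc (0, -1 - 2 * s, l, s + 1, τ))) = 0 := by
    rw [eq_comm] at hev
    rw [← hev]
    field_simp
    ring
  have := (mul_eq_zero.1 hev').resolve_left hne
  norm_num
  linear_combination hs + this

end BlockVectors

/-! ### Derivations seen through the block representation -/

section BlockRep

variable {K : Type*} [Field K] {q : K} {n : ℕ} {k k' : Fin n}

/-- The representation attached to a diagonal `2 × 2` block. -/
def blockRep (hq₀ : q ≠ 0) (hk : (k' : ℕ) = k + 1) :
    OqGL q n →ₐ[K] Module.End K (BlockExp n →₀ K) :=
  liftGL q (blockMat q k k') (wshift (-blockDet k k') fun _ => 1)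
    (fun l r h => isQMat_blockMat hq₀ hk l r h)
    (by rw [qdet_blockMat hq₀ hk, wshift_mul, ← wshift_one]; exact wshift_congr (by simp) (by simp))
    (by rw [qdet_blockMat hq₀ hk, wshift_mul, ← wshift_one]; exact wshift_congr (by simp) (by simp))

theorem blockRep_YGL (hq₀ : q ≠ 0) (hk : (k' : ℕ) = k + 1) (i α : Fin n) :
    blockRep hq₀ hk (YGL q n i α) = blockMat q k k' i α := liftGL_YGL ..

theorem blockRep_detGL_pow (hq₀ : q ≠ 0) (hk : (k' : ℕ) = k + 1) (N : ℕ) :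
    blockRep hq₀ hk (detGL q n ^ N) = wshift (N • blockDet k k') fun _ => 1 := by
  have h1 : blockRep hq₀ hk (detGL q n) = wshift (blockDet k k') fun _ => 1 := by
    refine (map_qdet (B := Module.End K (BlockExp n →₀ K)) q (blockRep hq₀ hk) (YGL q n)).trans ?_
    simp only [blockRep_YGL]
    exact qdet_blockMat hq₀ hk
  induction N with
  | zero => rw [pow_zero, map_one, zero_smul, wshift_one]
  | succ N ih =>
    rw [pow_succ, map_mul, ih, h1, wshift_mul]
    exact wshift_congr (by rw [succ_nsmul, add_comm]) (by simp)

theorem blockRep_commute (hq₀ : q ≠ 0) (hk : (k' : ℕ) = k + 1)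
    {R : Module.End K (BlockExp n →₀ K)} (hR : ∀ i α, Commute R (blockMat q k k' i α))
    {x : OqGL q n} {e : ℤ} (hx : x ∈ filt q e) : Commute R (blockRep hq₀ hk x) := by
  refine filt_induction (P := fun x => Commute R (blockRep hq₀ hk x)) ?_ ?_ ?_ ?_ hx
  · rw [map_zero]; exact Commute.zero_right R
  · intro x y h1 h2; rw [map_add]; exact h1.add_right h2
  · intro c x h; rw [map_smul]; exact h.smul_right c
  · intro w hw
    clear hw
    induction w with
    | nil => rw [word_nil, map_one]; exact Commute.one_right R
    | cons p w ih =>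
      rw [word_cons, map_mul, blockRep_YGL]
      exact (hR _ _).mul_right ih

theorem blockRep_apply_apply (hq₀ : q ≠ 0) (hk : (k' : ℕ) = k + 1)
    {R : Module.End K (BlockExp n →₀ K)} (hR : ∀ i α, Commute R (blockMat q k k' i α))
    {x : OqGL q n} {e : ℤ} (hx : x ∈ filt q e) (v : BlockExp n →₀ K) :
    blockRep hq₀ hk x (R v) = R (blockRep hq₀ hk x v) :=
  (LinearMap.congr_fun (blockRep_commute hq₀ hk hR hx).eq v).symm

theorem blockRep_mem_blockIdeal (hq₀ : q ≠ 0) (hk : (k' : ℕ) = k + 1) {x : OqGL q n} {e : ℤ}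
    (hx : x ∈ filt q e) {v : BlockExp n →₀ K} (hv : v ∈ blockIdeal q n) :
    blockRep hq₀ hk x v ∈ blockIdeal q n := by
  refine filt_induction (P := fun x => blockRep hq₀ hk x v ∈ blockIdeal q n) ?_ ?_ ?_ ?_ hx
  · rw [map_zero]; exact Submodule.zero_mem _
  · intro x y h1 h2; rw [map_add]; exact Submodule.add_mem _ h1 h2
  · intro c x h; rw [map_smul]; exact Submodule.smul_mem _ c h
  · intro w hw
    clear hw
    induction w with
    | nil => rw [word_nil, map_one]; exact hv
    | cons p w ih =>
      rw [word_cons, map_mul, blockRep_YGL]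
      exact blockMat_mem_blockIdeal hq₀ _ _ ih

/-- The values of a derivation on the generators of a diagonal block, applied to the vacuum. -/
theorem der_block_relation (hq₀ : q ≠ 0) (hq : ∀ m : ℕ, 0 < m → q ^ m ≠ 1)
    (hk : (k' : ℕ) = k + 1) {D : Der K (OqGL q n)} {d : ℤ} (hD : HasDeg D d)
    {v : Fin n → Fin n → BlockExp n →₀ K}
    (hv : ∀ i α, v i α = blockRep hq₀ hk (D (YGL q n i α)) (Finsupp.single 0 1)) (l s : ℤ)
    (τ : Fin n → ℤ) :
    v k' k' (-1, -2 * s, l, s, τ) + v k k (1, -2 * s, l - 1, s, τ)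
        + q⁻¹ * v k k (1, -2 * s, l - 1, s - 1, τ)
      = v k k' (0, 1 - 2 * s, l - 1, s, τ) + v k' k (0, -1 - 2 * s, l, s + 1, τ) := by
  have hne : k ≠ k' := fun e => by rw [e] at hk; omega
  have hlt : k < k' := by rw [Fin.lt_def]; omega
  have hA : blockMat q k k' k k = blockA K n := by simp [blockMat]
  have hB : blockMat q k k' k k' = blockB q n := by simp [blockMat, hne.symm]
  have hC : blockMat q k k' k' k = blockC q n := by simp [blockMat, hne.symm]
  have hDD : blockMat q k k' k' k' = blockD q n := by simp [blockMat, hne.symm]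
  have hYA := blockRep_YGL hq₀ hk k k
  have hYB := blockRep_YGL hq₀ hk k k'
  have hYC := blockRep_YGL hq₀ hk k' k
  have hYD := blockRep_YGL hq₀ hk k' k'
  rw [hA] at hYA
  rw [hB] at hYB
  rw [hC] at hYC
  rw [hDD] at hYD
  -- Applied to the vacuum, `a`, `b`, `c` give the same vectors as right multiplication by them. As
  -- right multiplications commute with the representation, the image of `x * a` on the vacuum is
  -- determined by that of `x`.
  have rA : ∀ {x : OqGL q n} {e : ℤ}, x ∈ filt q e → blockRep hq₀ hk x (blockA K n (Finsupp.single
      0 1))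
      = blockRightA q n (blockRep hq₀ hk x (Finsupp.single 0 1)) := fun hx => by
    rw [← blockRep_apply_apply hq₀ hk (commute_blockRightA hq₀) hx, blockA, blockRightA,
      wshift_single, wshift_single]
    simp
  have rB : ∀ {x : OqGL q n} {e : ℤ}, x ∈ filt q e → blockRep hq₀ hk x (blockB q n (Finsupp.single
      0 1))
      = wshift (0, 1, 0, 0, 0) (fun _ => 1) (blockRep hq₀ hk x (Finsupp.single 0 1)) := fun hx => by
    rw [← blockRep_apply_apply hq₀ hk (commute_blockMat_of_fst_eq_zero rfl) hx, blockB,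
      wshift_single, wshift_single]
    simp
  have rC : ∀ {x : OqGL q n} {e : ℤ}, x ∈ filt q e → blockRep hq₀ hk x (blockC q n (Finsupp.single
      0 1))
      = wshift (0, -1, 1, 1, 0) (fun _ => 1) (blockRep hq₀ hk x (Finsupp.single 0 1)) := fun hx =>
          by
    rw [← blockRep_apply_apply hq₀ hk (commute_blockMat_of_fst_eq_zero rfl) hx, blockC,
      wshift_single, wshift_single]
    simp
  set Δ := YGL q n k' k' * YGL q n k k - q⁻¹ • (YGL q n k k' * YGL q n k' k) with hΔdef
  have hba := YGL_rel q (QMatRel.row (i := k) hlt)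
  have hca := YGL_rel q (QMatRel.col (α := k) hlt)
  have hda := YGL_rel q (QMatRel.diag hlt hlt)
  -- The minor is both `da - q⁻¹bc` and `ad - qbc`; one form is used on each side.
  have hΔa : Δ * YGL q n k k = YGL q n k k * Δ := by
    have e1 : Δ = YGL q n k k * YGL q n k' k' - q • (YGL q n k k' * YGL q n k' k) := by
      rw [hΔdef, hda, sub_smul]; abel
    conv_lhs => rw [e1]
    rw [hΔdef, sub_mul, mul_sub, mul_assoc, smul_mul_assoc, mul_assoc, hca, mul_smul_comm,
      ← mul_assoc, smul_smul, mul_inv_cancel₀ hq₀, one_smul, ← mul_assoc (YGL q n k k'), hba,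
      smul_mul_assoc, mul_smul_comm, mul_assoc (YGL q n k k) (YGL q n k k')]
  have hΔrep : blockRep hq₀ hk Δ = wshift (0, 0, 1, 0, 0) fun _ => 1 := by
    have : blockRep hq₀ hk Δ = blockD q n * blockA K n - q⁻¹ • (blockB q n * blockC q n) := by
      rw [hΔdef, map_sub, map_mul, map_smul, map_mul, hYA, hYB, hYC, hYD]
    rw [this, blockD_mul_blockA hq₀]
    exact add_sub_cancel_right (G := Module.End K (BlockExp n →₀ K)) _ _
  have hm := fun i α => hD (i, α)
  have hΔmem : Δ ∈ filt q (pdeg (k', k') + pdeg (k, k) + (pdeg (k, k') + pdeg (k', k))) := by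
    have p1 := pdeg_nonneg (k, k)
    have p2 := pdeg_nonneg (k, k')
    have p3 := pdeg_nonneg (k', k)
    have p4 := pdeg_nonneg (k', k')
    exact Submodule.sub_mem _
      (filt_mono (by omega) (mul_mem_filt (YGL_mem_filt (k', k')) (YGL_mem_filt (k, k))))
      (Submodule.smul_mem _ _
        (filt_mono (by omega) (mul_mem_filt (YGL_mem_filt (k, k')) (YGL_mem_filt (k', k)))))
  have key : ∀ x y : OqGL q n, blockRep hq₀ hk (D (x * y)) (Finsupp.single 0 1)
      = blockRep hq₀ hk (D x) (blockRep hq₀ hk y (Finsupp.single 0 1))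
        + blockRep hq₀ hk x (blockRep hq₀ hk (D y) (Finsupp.single 0 1)) := by
    intro x y
    rw [Der.leibniz, map_add, map_mul, map_mul]
    rfl
  refine block_relation hq₀ hq (vΔ := blockRep hq₀ hk (D Δ) (Finsupp.single 0 1)) ?_ ?_ ?_ ?_ ?_ l
      s τ
  · have h := key (YGL q n k k') (YGL q n k k)
    rw [hba, Der.map_smul, map_smul, LinearMap.smul_apply, key, hYA, hYB, rA (hm _ _),
      rB (hm _ _), ← hv, ← hv] at h
    exact h.symm
  · have h := key (YGL q n k' k) (YGL q n k k)
    rw [hca, Der.map_smul, map_smul, LinearMap.smul_apply, key, hYA, hYC, rA (hm _ _),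
      rC (hm _ _), ← hv, ← hv] at h
    exact h.symm
  · have h := key Δ (YGL q n k k)
    rw [hΔa, key, hΔrep, hYA, rA (hD.map_mem hΔmem), ← hv] at h
    have h2 := blockRep_apply_apply hq₀ hk (R := wshift (0, 0, 1, 0, 0) fun _ => 1)
      (commute_blockMat_of_fst_eq_zero rfl) (hm k k) (Finsupp.single 0 1)
    rw [h2, ← hv, add_comm] at h
    exact (add_right_cancel h).symm
  · have h := key (YGL q n k' k') (YGL q n k k)
    have e : YGL q n k' k' * YGL q n k k = Δ + q⁻¹ • (YGL q n k k' * YGL q n k' k) := by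
      rw [hΔdef, sub_add_cancel]
    rw [e, show D (Δ + q⁻¹ • (YGL q n k k' * YGL q n k' k))
        = D Δ + q⁻¹ • D (YGL q n k k' * YGL q n k' k) from by
          rw [← Der.map_smul]; exact _root_.map_add D.1 _ _, map_add, map_smul,
      LinearMap.add_apply, LinearMap.smul_apply, key, hYA, hYB, hYC, hYD, rA (hm _ _),
      rC (hm _ _), ← hv, ← hv, ← hv, ← hv] at h
    exact h.symm
  -- The vector of `a` lies in `blockIdeal`, and the ideal is stable under the representation, so it
  -- contains the vector of `D(d) * a`.
  · rw [hv, ← rA (hm k' k')]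
    refine blockRep_mem_blockIdeal hq₀ hk (hm k' k') fun γ hγ => ?_
    rw [blockA, wshift_single, blockEval_single, Finsupp.single_apply, if_neg]
    intro he
    rw [← he] at hγ
    simp at hγ

/-- The possible exponents `m` of a monomial whose image of the vacuum involves `γ`. -/
def BlockSupp (k k' : Fin n) (m : Fin n × Fin n → ℤ) (γ : BlockExp n) : Prop :=
  (∀ i α, i ≠ α → ¬ (i = k ∧ α = k') → ¬ (i = k' ∧ α = k) → m (i, α) = 0) ∧
    γ.1 = m (k, k) - m (k', k') ∧ γ.2.1 = m (k, k') - m (k', k) ∧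
    γ.2.2.1 = m (k', k) + m (k', k') ∧ m (k', k) ≤ γ.2.2.2.1 ∧
    ∀ l, l ≠ k → l ≠ k' → γ.2.2.2.2 l = m (l, l)

theorem ne_zero_of_wshift_ne_zero {Γ : Type*} [AddCommGroup Γ] {δ γ : Γ} {w : Γ → K} {v : Γ →₀ K}
    (h : wshift δ w v γ ≠ 0) : v (γ - δ) ≠ 0 := by
  rw [wshift_apply] at h
  exact right_ne_zero_of_mul h

theorem BlockSupp.blockMat (hne : k ≠ k') {m : Fin n × Fin n → ℤ} {v : BlockExp n →₀ K}
    (hv : ∀ γ, v γ ≠ 0 → BlockSupp k k' m γ) (i α : Fin n) {γ : BlockExp n}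
    (hγ : blockMat q k k' i α v γ ≠ 0) : BlockSupp k k' (m + Pi.single (i, α) 1) γ := by
  have hs : ∀ j β, (m + Pi.single (i, α) 1 : Fin n × Fin n → ℤ) (j, β)
      = m (j, β) + if j = i ∧ β = α then 1 else 0 := fun j β => by
    rw [Pi.add_apply, Pi.single_apply]; simp
  unfold QuantumGL.blockMat blockA blockB blockC blockD blockT at hγ
  unfold BlockSupp at hv ⊢
  simp only [hs]
  split_ifs at hγ with h1 h2 h3 h4 h5
  · have := hv _ (ne_zero_of_wshift_ne_zero hγ)
    simp only [Prod.fst_sub, Prod.snd_sub, Pi.sub_apply, Pi.zero_apply] at this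
    grind
  · have := hv _ (ne_zero_of_wshift_ne_zero hγ)
    simp only [Prod.fst_sub, Prod.snd_sub, Pi.sub_apply, Pi.zero_apply] at this
    grind
  · have := hv _ (ne_zero_of_wshift_ne_zero hγ)
    simp only [Prod.fst_sub, Prod.snd_sub, Pi.sub_apply, Pi.zero_apply] at this
    grind
  · rw [LinearMap.add_apply, Finsupp.add_apply] at hγ
    have : wshift ((-1, 0, 1, 0, 0) : BlockExp n) (fun _ => (1 : K)) v γ ≠ 0 ∨
        wshift ((-1, 0, 1, 1, 0) : BlockExp n) (fun γ => q ^ (1 - 2 * γ.1)) v γ ≠ 0 := by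
      by_contra! hc
      rw [hc.1, hc.2, add_zero] at hγ
      exact hγ rfl
    rcases this with h | h
    · have := hv _ (ne_zero_of_wshift_ne_zero h)
      simp only [Prod.fst_sub, Prod.snd_sub, Pi.sub_apply, Pi.zero_apply] at this
      grind
    · have := hv _ (ne_zero_of_wshift_ne_zero h)
      simp only [Prod.fst_sub, Prod.snd_sub, Pi.sub_apply, Pi.zero_apply] at this
      grind
  · have := hv _ (ne_zero_of_wshift_ne_zero hγ)
    simp only [Prod.fst_sub, Prod.snd_sub, Pi.sub_apply, Pi.single_apply] at this
    grind
  · exact absurd rfl hγ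

theorem blockSupp_word (hq₀ : q ≠ 0) (hk : (k' : ℕ) = k + 1) (w : List (Fin n × Fin n))
    {γ : BlockExp n} (hγ : blockRep hq₀ hk (word q n w) (Finsupp.single 0 1) γ ≠ 0) :
    BlockSupp k k' (wcount w) γ := by
  have hne : k ≠ k' := fun e => by rw [e] at hk; omega
  induction w generalizing γ with
  | nil =>
    rw [word_nil, map_one, Module.End.one_apply, Finsupp.single_apply] at hγ
    have : 0 = γ := by by_contra h; rw [if_neg h] at hγ; exact hγ rfl
    subst this
    rw [wcount_nil]
    simp [BlockSupp]
  | cons p w ih =>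
    rw [word_cons, map_mul, blockRep_YGL] at hγ
    rw [wcount_cons]
    exact BlockSupp.blockMat hne (fun γ h => ih h) _ _ hγ

/-- Each monomial spreads only over the exponents allowed by `BlockSupp`, so a coefficient of the
image sees only finitely constrained coefficients of `x`. In the applications below a single
exponent vector is left. -/
theorem blockRep_apply_eq_zero (hq₀ : q ≠ 0) (hk : (k' : ℕ) = k + 1) {x : OqGL q n} {e : ℤ}
    (hx : x ∈ filt q e) {γ : BlockExp n}
    (h : ∀ m, (∀ p, 0 ≤ m p) → BlockSupp k k' m γ → coef hq₀ m x = 0) :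
    blockRep hq₀ hk x (Finsupp.single 0 1) γ = 0 := by
  rw [← sum_monoCoords hq₀ hx, Finsupp.linearCombination_apply, Finsupp.sum, map_sum,
    LinearMap.sum_apply, Finsupp.finsetSum_apply]
  refine Finset.sum_eq_zero fun s _ => ?_
  rw [map_smul, LinearMap.smul_apply, Finsupp.smul_apply, ← coef_scount hq₀]
  by_cases hs : blockRep hq₀ hk (word q n s.toList) (Finsupp.single 0 1) γ = 0
  · rw [mono, map_smul, LinearMap.smul_apply, Finsupp.smul_apply, hs, smul_zero, smul_zero]
  · rw [h (scount s) (wcount_nonneg _) (blockSupp_word hq₀ hk _ hs), zero_smul]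

theorem blockRep_add_apply (hq₀ : q ≠ 0) (hk : (k' : ℕ) = k + 1) {x : OqGL q n} {e : ℤ}
    (hx : x ∈ filt q e) {γ : BlockExp n} (θ : K) (N : ℕ) (i α : Fin n)
    (h : ∀ m, (∀ p, 0 ≤ m p) → BlockSupp k k' m (γ + N • blockDet k k') → coef hq₀ m x = 0) :
    blockRep hq₀ hk (θ • (detGL q n ^ N * YGL q n i α) + x) (Finsupp.single 0 1)
      (γ + N • blockDet k k') = θ * blockMat q k k' i α (Finsupp.single 0 1) γ := by
  rw [_root_.map_add (blockRep hq₀ hk), LinearMap.add_apply, Finsupp.add_apply,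
    blockRep_apply_eq_zero hq₀ hk hx h, add_zero, map_smul, LinearMap.smul_apply,
    Finsupp.smul_apply, map_mul, blockRep_detGL_pow, blockRep_YGL, Module.End.mul_apply,
    wshift_apply_of_eq rfl, one_mul, smul_eq_mul]

theorem blockSupp_add_iff {m : Fin n × Fin n → ℤ} {i j l s : ℤ} {N : ℕ} :
    BlockSupp k k' m ((i, j, l, s, 0) + N • blockDet k k') ↔
      (∀ i α, i ≠ α → ¬ (i = k ∧ α = k') → ¬ (i = k' ∧ α = k) → m (i, α) = 0) ∧
        i = m (k, k) - m (k', k') ∧ j = m (k, k') - m (k', k) ∧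
        l + N = m (k', k) + m (k', k') ∧ m (k', k) ≤ s ∧
        ∀ l, l ≠ k → l ≠ k' → N = m (l, l) := by
  unfold BlockSupp
  refine and_congr_right fun _ => ?_
  simp only [blockDet, Prod.smul_mk, Prod.mk_add_mk, smul_zero, add_zero, nsmul_eq_mul, mul_one]
  refine and_congr_right fun _ => and_congr_right fun _ => and_congr_right fun _ =>
    and_congr_right fun _ => forall_congr' fun l => ?_
  refine forall_congr' fun h1 => forall_congr' fun h2 => ?_
  simp [h1, h2]

theorem eq_smul_idExp_add_single {N : ℕ} {m : Fin n × Fin n → ℤ} {p : Fin n × Fin n}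
    (h : ∀ i α, m (i, α)
      = (if i = α then (N : ℤ) else 0) + if i = p.1 ∧ α = p.2 then 1 else 0) :
    m = N • idExp n + Pi.single p 1 := by
  funext ⟨i, α⟩
  rw [h i α, Pi.add_apply, Pi.single_apply, Pi.smul_apply, idExp]
  simp [Prod.ext_iff]

theorem blockExp_eq_add (i j l s : ℤ) (N : ℕ) :
    ((i, j, l + N, s, (N • blockDet k k').2.2.2.2) : BlockExp n)
      = (i, j, l, s, 0) + N • blockDet k k' := by
  simp [blockDet]

variable {N : ℕ} {D : Der K (OqGL q n)} {d : ℤ}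

/-- Leading coefficients of a derivation are additive on a diagonal block. -/
theorem HasDeg.add_diag_block (hq₀ : q ≠ 0) (hq : ∀ m : ℕ, 0 < m → q ^ m ≠ 1)
    (hk : (k' : ℕ) = k + 1) (hD : HasDeg D d) {θ : Fin n × Fin n → K} {E : Fin n × Fin n → OqGL q n}
    {e : ℤ} (hE : ∀ p, E p ∈ filt q e)
    (hDE : ∀ p, D (YGL q n p.1 p.2) = θ p • (detGL q n ^ N * YGL q n p.1 p.2) + E p)
    (hc : ∀ p, p.1 = k ∨ p.1 = k' → p.2 = k ∨ p.2 = k' →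
      coef hq₀ (N • idExp n + Pi.single p 1) (E p) = 0) :
    θ (k, k) + θ (k', k') = θ (k, k') + θ (k', k) := by
  have hne : k ≠ k' := fun e => by rw [e] at hk; omega
  -- With `s = 0` and this power of the `2 × 2` determinant, the relation picks out the leading
  -- places of `Δ^N d`, `Δ^N a`, `Δ^N b` and `Δ^N c`.
  have h := der_block_relation hq₀ hq hk hD (fun i α => rfl) (N + 1) 0
    (N • blockDet k k').2.2.2.2
  simp only [fun i α => hDE (i, α)] at h
  have hd := blockRep_add_apply hq₀ hk (hE (k', k')) (γ := (-1, 0, 1, 0, 0)) (θ (k', k')) N k' k'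
    fun m h0 hm => by
      rw [blockSupp_add_iff] at hm
      rw [eq_smul_idExp_add_single (N := N) (m := m) (p := (k', k')) ?_, hc _ (.inr rfl) (.inr rfl)]
      have := h0 (k', k)
      have := h0 (k, k')
      grind
  have ha := blockRep_add_apply hq₀ hk (hE (k, k)) (γ := (1, 0, 0, 0, 0)) (θ (k, k)) N k k
    fun m h0 hm => by
      rw [blockSupp_add_iff] at hm
      rw [eq_smul_idExp_add_single (N := N) (m := m) (p := (k, k)) ?_, hc _ (.inl rfl) (.inl rfl)]
      have := h0 (k', k)
      have := h0 (k, k')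
      grind
  have ha' := blockRep_add_apply hq₀ hk (hE (k, k)) (γ := (1, 0, 0, -1, 0)) (θ (k, k)) N k k
    fun m h0 hm => by
      rw [blockSupp_add_iff] at hm
      have := h0 (k', k)
      omega
  have hb := blockRep_add_apply hq₀ hk (hE (k, k')) (γ := (0, 1, 0, 0, 0)) (θ (k, k')) N k k'
    fun m h0 hm => by
      rw [blockSupp_add_iff] at hm
      rw [eq_smul_idExp_add_single (N := N) (m := m) (p := (k, k')) ?_, hc _ (.inl rfl) (.inr rfl)]
      have := h0 (k', k)
      have := h0 (k, k')
      grind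
  have hc := blockRep_add_apply hq₀ hk (hE (k', k)) (γ := (0, -1, 1, 1, 0)) (θ (k', k)) N k' k
    fun m h0 hm => by
      rw [blockSupp_add_iff] at hm
      rw [eq_smul_idExp_add_single (N := N) (m := m) (p := (k', k)) ?_, hc _ (.inr rfl) (.inl rfl)]
      have := h0 (k', k)
      have := h0 (k, k')
      grind
  rw [← blockExp_eq_add] at hd ha ha' hb hc
  have e1 : 1 + (N : ℤ) - 1 = N := by ring
  rw [add_comm (N : ℤ) 1] at h
  simp only [e1, mul_zero, sub_zero, zero_sub, zero_add] at h hd ha ha' hb hc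
  rw [hd, ha, ha', hb, hc] at h
  simp [QuantumGL.blockMat, hne.symm, blockA, blockB, blockC, blockD, Finsupp.single_apply] at h
  rw [add_comm, h]

/-- A derivation cannot exchange the off-diagonal generators of a diagonal block. -/
theorem HasDeg.upper_block_eq_zero (hq₀ : q ≠ 0) (hq : ∀ m : ℕ, 0 < m → q ^ m ≠ 1)
    (hk : (k' : ℕ) = k + 1) (hD : HasDeg D d) {θ : K} {E : OqGL q n} {e : ℤ} (hE : E ∈ filt q e)
    (hDE : D (YGL q n k k') = θ • (detGL q n ^ N * YGL q n k' k) + E)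
    (hc : coef hq₀ (N • idExp n + Pi.single (k', k) 1) E = 0) : θ = 0 := by
  have hne : k ≠ k' := fun e => by rw [e] at hk; omega
  -- With `s = 1` the `vb` term sits where `Δ^N c` occurs. In every other term the exponents of `b`
  -- and `u` have negative sum, which `BlockSupp` forbids.
  have h := der_block_relation hq₀ hq hk hD (fun i α => rfl) (N + 2) 1
    (N • blockDet k k').2.2.2.2
  have hz : ∀ (i α : Fin n) (i' j l s : ℤ), j + s < 0 →
      blockRep hq₀ hk (D (YGL q n i α)) (Finsupp.single 0 1)
        (i', j, l, s, (N • blockDet k k').2.2.2.2) = 0 := by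
    intro i α i' j l s hs
    refine blockRep_apply_eq_zero hq₀ hk (hD (i, α)) fun m h0 hm => ?_
    obtain ⟨-, -, h1, -, h2, -⟩ := hm
    dsimp only at h1 h2
    have := h0 (k, k')
    omega
  rw [hz k' k' _ _ _ _ (by omega), hz k k _ _ _ _ (by omega), hz k k _ _ _ _ (by omega),
    hz k' k _ _ _ _ (by omega), hDE, show (N : ℤ) + 2 - 1 = 1 + N by ring,
    show (1 : ℤ) - 2 * 1 = -1 by ring, blockExp_eq_add, blockRep_add_apply hq₀ hk hE] at h
  · simp [QuantumGL.blockMat, hne.symm, blockC] at h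
    exact h.symm
  · intro m h0 hm
    rw [blockSupp_add_iff] at hm
    rw [eq_smul_idExp_add_single (N := N) (m := m) (p := (k', k)) ?_, hc]
    have := h0 (k', k)
    have := h0 (k, k')
    grind

theorem HasDeg.lower_block_eq_zero (hq₀ : q ≠ 0) (hq : ∀ m : ℕ, 0 < m → q ^ m ≠ 1)
    (hk : (k' : ℕ) = k + 1) (hD : HasDeg D d) {θ : K} {E : OqGL q n} {e : ℤ} (hE : E ∈ filt q e)
    (hDE : D (YGL q n k' k) = θ • (detGL q n ^ N * YGL q n k k') + E)
    (hc : coef hq₀ (N • idExp n + Pi.single (k, k') 1) E = 0) : θ = 0 := by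
  have hne : k ≠ k' := fun e => by rw [e] at hk; omega
  -- With `s = -1` the `vc` term sits where `Δ^N b` occurs, and every other term has a negative
  -- power of `u`.
  have h := der_block_relation hq₀ hq hk hD (fun i α => rfl) N (-1)
    (N • blockDet k k').2.2.2.2
  have hz : ∀ (i α : Fin n) (i' j l s : ℤ), s < 0 →
      blockRep hq₀ hk (D (YGL q n i α)) (Finsupp.single 0 1)
        (i', j, l, s, (N • blockDet k k').2.2.2.2) = 0 := by
    intro i α i' j l s hs
    refine blockRep_apply_eq_zero hq₀ hk (hD (i, α)) fun m h0 hm => ?_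
    obtain ⟨-, -, -, -, h2, -⟩ := hm
    dsimp only at h2
    have := h0 (k', k)
    omega
  rw [hz k' k' _ _ _ _ (by omega), hz k k _ _ _ _ (by omega), hz k k _ _ _ _ (by omega),
    hz k k' _ _ _ _ (by omega), hDE, show (N : ℤ) = 0 + N by ring,
    show (-1 : ℤ) - 2 * -1 = 1 by ring, show (-1 : ℤ) + 1 = 0 by ring, blockExp_eq_add,
    blockRep_add_apply hq₀ hk hE] at h
  · simp [QuantumGL.blockMat, hne.symm, blockB] at h
    exact h.symm
  · intro m h0 hm
    rw [blockSupp_add_iff] at hm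
    rw [eq_smul_idExp_add_single (N := N) (m := m) (p := (k, k')) ?_, hc]
    have := h0 (k', k)
    have := h0 (k, k')
    grind

end BlockRep

/-! ### The central part of the symbol -/

section CentralSymbol

variable {K : Type*} [Field K] {q : K} {n : ℕ}

theorem coef_one (hq₀ : q ≠ 0) {m : Fin n × Fin n → ℤ} (hm : 0 ≤ mdeg m) :
    coef hq₀ m (1 : OqGL q n) = if m = 0 then 1 else 0 := by
  rw [← word_nil, coef_word hq₀ (by rw [wcount_nil, mdeg_zero]; exact hm), wcount_nil]
  simp [qexp, eq_comm]

theorem exists_coef_detGL_pow (hq₀ : q ≠ 0) (N : ℕ) : ∃ u : K, u ≠ 0 ∧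
    coef hq₀ (N • idExp n) (detGL q n ^ N) = u := by
  obtain ⟨u, hu, h⟩ := exists_coef_detGL_pow_mul (n := n) hq₀ N 0
  refine ⟨u, hu, ?_⟩
  have := h 1 (by rw [mdeg_zero]; exact one_mem_filt)
  rwa [zero_add, mul_one, coef_one hq₀ (by rw [mdeg_zero]), if_pos rfl, mul_one] at this

theorem coef_detGL_pow_of_ne (hq₀ : q ≠ 0) {N : ℕ} {m : Fin n × Fin n → ℤ}
    (hm : mdeg m = mdeg (N • idExp n)) (hne : m ≠ N • idExp n) :
    coef hq₀ m (detGL q n ^ N) = 0 := by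
  obtain ⟨u, hu, h⟩ := exists_coef_detGL_pow_mul (n := n) hq₀ N (m - N • idExp n)
  have h0 : mdeg (m - N • idExp n) = 0 := by rw [mdeg_sub, hm, sub_self]
  have := h 1 (by rw [h0]; exact one_mem_filt)
  rwa [sub_add_cancel, mul_one, coef_one hq₀ h0.ge, if_neg (sub_ne_zero.2 hne), mul_zero] at this

theorem nsmul_idExp_injective (hn : 1 < n) {M N : ℕ}
    (h : mdeg (M • idExp n) = mdeg (N • idExp n)) : M = N := by
  rw [mdeg_nsmul, mdeg_nsmul] at h
  exact_mod_cast mul_right_cancel₀ (mdeg_idExp_pos hn).ne' h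

/-- Applying `D` to the `diag` relation and reading it one degree below the top brings in the
correction term. The unknown subleading parts of `E (i, α)` and `E (i', α')` also enter there, but
only multiplied by the opposite diagonal generator. When `m` is nonpositive at both diagonal
positions, their coefficients would sit at exponents with a negative entry, so they drop out. -/
theorem HasDeg.block_coef (hq₀ : q ≠ 0) (hκ : q - q⁻¹ ≠ 0) {D : Der K (OqGL q n)} {d : ℤ}
    {N : ℕ} {θ : Fin n × Fin n → K} {E : Fin n × Fin n → OqGL q n}
    (hDE : ∀ p, D (YGL q n p.1 p.2) = θ p • (detGL q n ^ N * YGL q n p.1 p.2) + E p)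
    {i i' α α' : Fin n} (hi : (i' : ℕ) = i + 1) (hα : (α' : ℕ) = α + 1)
    (h1 : E (i, α) ∈ filt q (d - 1 + pdeg (i, α)))
    (h2 : E (i', α') ∈ filt q (d - 1 + pdeg (i', α')))
    (h3 : E (i, α') ∈ filt q (d + pdeg (i, α')))
    (h4 : E (i', α) ∈ filt q (d + pdeg (i', α)))
    {m : Fin n × Fin n → ℤ} (hm : mdeg m = d) (hm1 : m (i, α) ≤ 0) (hm2 : m (i', α') ≤ 0) :
    (θ (i, α') + θ (i', α) - θ (i, α) - θ (i', α'))
        * coef hq₀ (m + Pi.single (i, α') 1 + Pi.single (i', α) 1)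
          (detGL q n ^ N * YGL q n i α' * YGL q n i' α)
      + q ^ cright (m + Pi.single (i, α') 1) (i', α) * coef hq₀ (m + Pi.single (i, α') 1) (E (i,
          α'))
      + q ^ cleft (i, α') (m + Pi.single (i', α) 1)
        * coef hq₀ (m + Pi.single (i', α) 1) (E (i', α)) = 0 := by
  have hii : i < i' := by rw [Fin.lt_def]; omega
  have hαα : α < α' := by rw [Fin.lt_def]; omega
  have hX := fun y : OqGL q n => ((detGL_commute hq₀ y).pow_left N).eq
  set X := detGL q n ^ N
  have hrel := YGL_rel q (QMatRel.diag hii hαα)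
  have d1 := hDE (i, α)
  have d2 := hDE (i', α')
  have d3 := hDE (i, α')
  have d4 := hDE (i', α)
  dsimp only at d1 d2 d3 d4
  have hD := congrArg D.1 hrel
  have key : (q - q⁻¹) • ((θ (i, α') + θ (i', α) - θ (i, α) - θ (i', α')) •
        (X * YGL q n i α' * YGL q n i' α) + E (i, α') * YGL q n i' α + YGL q n i α' * E (i', α))
      + (E (i', α') * YGL q n i α - YGL q n i α * E (i', α'))
      + (YGL q n i' α' * E (i, α) - E (i, α) * YGL q n i' α') = 0 := by
    have h' : D (YGL q n i' α' * YGL q n i α) - D (YGL q n i α * YGL q n i' α')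
        + (q - q⁻¹) • D (YGL q n i α' * YGL q n i' α) = 0 := by
      have e := hD
      rw [show D.1 (YGL q n i α * YGL q n i' α' - (q - q⁻¹) • (YGL q n i α' * YGL q n i' α))
        = D (YGL q n i α * YGL q n i' α') - (q - q⁻¹) • D (YGL q n i α' * YGL q n i' α) from by
          rw [← Der.map_smul, ← Der.map_sub]] at e
      rw [e]; abel
    have hXr := congrArg (X * ·) hrel
    simp only [mul_sub, mul_smul_comm] at hXr
    rw [Der.leibniz, Der.leibniz, Der.leibniz, d1, d2, d3, d4] at h'
    simp only [add_mul, mul_add, smul_mul_assoc, mul_smul_comm] at h'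
    have c : ∀ y z : OqGL q n, y * (X * z) = X * (y * z) := fun y z => by
      rw [← mul_assoc, ← hX, mul_assoc]
    simp only [c, mul_assoc] at h'
    simp only [hXr] at h'
    rw [mul_assoc, ← h']
    module
  have hd := congrArg (coef hq₀ (m + Pi.single (i, α') 1 + Pi.single (i', α) 1)) key
  -- For an adjacent block the correction term is lower by exactly one degree.
  have hpd : pdeg (i, α) + pdeg (i', α') = pdeg (i, α') + pdeg (i', α) + 1 := by
    simp only [pdeg, hi, hα]; push_cast; ring
  have hμ : mdeg (m + Pi.single (i, α') 1 + Pi.single (i', α) 1)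
      = d - 1 + pdeg (i, α) + pdeg (i', α') := by
    rw [mdeg_add, mdeg_add, mdeg_single, mdeg_single, hm]; omega
  have hμ1 : (m + Pi.single (i, α') 1 + Pi.single (i', α) 1 :
      Fin n × Fin n → ℤ) (i, α) = m (i, α) := by
    simp [Pi.single_apply, hii.ne, hαα.ne]
  have hμ2 : (m + Pi.single (i, α') 1 + Pi.single (i', α) 1 : Fin n × Fin n → ℤ) (i', α')
      = m (i', α') := by
    simp [Pi.single_apply, hii.ne', hαα.ne']
  have lr : ∀ (p p' : Fin n × Fin n) (μ : Fin n × Fin n → ℤ) (x : OqGL q n),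
      x ∈ filt q (d - 1 + pdeg p) → mdeg μ = d - 1 + pdeg p + pdeg p' → μ p' ≤ 0 →
      coef hq₀ μ (x * YGL q n p'.1 p'.2) = 0 ∧ coef hq₀ μ (YGL q n p'.1 p'.2 * x) = 0 := by
    intro p p' μ x hx hμ hneg
    have e : mdeg (μ - Pi.single p' 1) = d - 1 + pdeg p := by rw [mdeg_sub, mdeg_single, hμ]; ring
    have hz : coef hq₀ (μ - Pi.single p' 1) x = 0 := coef_of_neg hq₀ hx (p := p') (by
      simp only [Pi.sub_apply, Pi.single_eq_same]; omega)
    rw [← e] at hx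
    have a1 := coef_mul_YGL hq₀ hx p'
    have a2 := coef_YGL_mul hq₀ hx p'
    rw [sub_add_cancel, hz, mul_zero] at a1 a2
    exact ⟨a1, a2⟩
  obtain ⟨z1, z2⟩ := lr (i', α') (i, α) _ _ h2 (by rw [hμ]; ring) (hμ1.trans_le hm1)
  obtain ⟨z3, z4⟩ := lr (i, α) (i', α') _ _ h1 hμ (hμ2.trans_le hm2)
  dsimp only at z1 z2 z3 z4
  have t3 := coef_mul_YGL hq₀ (m := m + Pi.single (i, α') 1) (x := E (i, α'))
    (by rw [mdeg_add, mdeg_single, hm]; exact h3) (i', α)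
  have t4 := coef_YGL_mul hq₀ (m := m + Pi.single (i', α) 1) (x := E (i', α))
    (by rw [mdeg_add, mdeg_single, hm]; exact h4) (i, α')
  rw [add_right_comm] at t4
  dsimp only at t3 t4
  simp only [map_add, map_sub, map_smul, z1, z2, z3, z4, t3, t4, map_zero, sub_zero, add_zero,
    smul_eq_mul] at hd
  exact (mul_eq_zero.1 hd).resolve_left hκ

end CentralSymbol

/-! ### Splitting off a multiple of a power of the determinant -/

section CentralSymbol

variable {K : Type*} [Field K] {q : K} {n : ℕ}

/-- Vanishing of the mixed second differences means that `θ` is a function of the row plus a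
function of the column. -/
theorem additive_of_adjacent {θ : Fin n × Fin n → K}
    (h : ∀ i i' α α' : Fin n, (i' : ℕ) = i + 1 → (α' : ℕ) = α + 1 →
      θ (i, α) + θ (i', α') = θ (i, α') + θ (i', α)) (z i α : Fin n) (hz : (z : ℕ) = 0) :
    θ (i, α) = θ (i, z) - θ (z, z) + θ (z, α) := by
  have h1 : ∀ (t : ℕ) (α i i' : Fin n), (α : ℕ) = t → (i' : ℕ) = i + 1 →
      θ (i', α) - θ (i, α) = θ (i', z) - θ (i, z) := by
    intro t
    induction t with
    | zero =>
      intro α i i' hα hi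
      have : α = z := Fin.ext (by omega)
      rw [this]
    | succ t ih =>
      intro α i i' hα hi
      rw [← ih ⟨t, by omega⟩ i i' rfl hi]
      linear_combination h i i' ⟨t, by omega⟩ α hi (by simp; omega)
  have h2 : ∀ (t : ℕ) (i : Fin n), (i : ℕ) = t → θ (i, α) = θ (i, z) - θ (z, z) + θ (z, α) := by
    intro t
    induction t with
    | zero =>
      intro i hi
      have : i = z := Fin.ext (by omega)
      rw [this]; ring
    | succ t ih =>
      intro i hi
      linear_combination ih ⟨t, by omega⟩ rfl + h1 α α ⟨t, by omega⟩ i rfl (by simp; omega)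
  exact h2 i i rfl

theorem coef_detGL_pow_mul_YGL (hq₀ : q ≠ 0) {N : ℕ} {m : Fin n × Fin n → ℤ}
    (hm : mdeg m = mdeg (N • idExp n)) (p : Fin n × Fin n) :
    coef hq₀ (m + Pi.single p 1) (detGL q n ^ N * YGL q n p.1 p.2)
      = q ^ cright m p * coef hq₀ m (detGL q n ^ N) :=
  coef_mul_YGL hq₀ (by rw [hm]; exact detGL_pow_mem_filt N) p

theorem coef_detGL_pow_mul_YGL_ne_zero (hq₀ : q ≠ 0) (N : ℕ) (p : Fin n × Fin n) :
    coef hq₀ (N • idExp n + Pi.single p 1) (detGL q n ^ N * YGL q n p.1 p.2) ≠ 0 := by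
  rw [coef_detGL_pow_mul_YGL hq₀ rfl]
  obtain ⟨u, hu, h⟩ := exists_coef_detGL_pow (n := n) hq₀ N
  rw [h]
  exact mul_ne_zero (zpow_ne_zero _ hq₀) hu

theorem coef_detGL_pow_mul_mul (hq₀ : q ≠ 0) {N : ℕ} {m : Fin n × Fin n → ℤ}
    (hm : mdeg m = mdeg (N • idExp n)) (p p' : Fin n × Fin n) :
    coef hq₀ (m + Pi.single p 1 + Pi.single p' 1)
        (detGL q n ^ N * YGL q n p.1 p.2 * YGL q n p'.1 p'.2)
      = q ^ cright (m + Pi.single p 1) p' * (q ^ cright m p * coef hq₀ m (detGL q n ^ N)) := by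
  rw [coef_mul_YGL hq₀, coef_detGL_pow_mul_YGL hq₀ hm]
  rw [mdeg_add, hm, mdeg_single]
  exact mul_mem_filt (detGL_pow_mem_filt N) (YGL_mem_filt p)

theorem nonneg_of_coef_add_single_ne_zero (hq₀ : q ≠ 0) {x : OqGL q n} {e : ℤ} (hx : x ∈ filt q e)
    {m : Fin n × Fin n → ℤ} {p : Fin n × Fin n} (h : coef hq₀ (m + Pi.single p 1) x ≠ 0) :
    (∀ p', p' ≠ p → 0 ≤ m p') ∧ 0 ≤ m p + 1 := by
  constructor
  · intro p' hp'
    by_contra! hc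
    exact h (coef_of_neg hq₀ hx (add_single_neg hc hp'.symm))
  · by_contra! hc
    refine h (coef_of_neg hq₀ hx (p := p) ?_)
    simpa using hc

/-- The leading part of a derivation is a multiple of a power of the determinant, up to terms
whose exponents are central and not nonnegative. -/
structure CentralSymbol (hq₀ : q ≠ 0) (D : Der K (OqGL q n)) (d : ℤ) (N : ℕ)
    (θ : Fin n × Fin n → K) (E : Fin n × Fin n → OqGL q n) : Prop where
  eq : ∀ p, D (YGL q n p.1 p.2) = θ p • (detGL q n ^ N * YGL q n p.1 p.2) + E p
  mem : ∀ p, E p ∈ filt q (d + pdeg p)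
  central : ∀ m p, mdeg m = d → coef hq₀ (m + Pi.single p 1) (E p) ≠ 0 → IsCentralExp m ∧ m p < 0
  deg : θ = 0 ∨ mdeg (N • idExp n) = d

/-- A nonnegative central exponent of degree `d` is `N • idExp n` with `N` determined by `d`, and
`θ` is chosen to remove it. Any other central exponent has a negative entry, which must be at `p`,
since adding `p` makes the vector nonnegative. -/
theorem HasDeg.exists_centralSymbol (hq₀ : q ≠ 0) (hn : 1 < n) {D : Der K (OqGL q n)} {d : ℤ}
    (hD : HasDeg D d) (hC : ∀ (m : Fin n × Fin n → ℤ) (p : Fin n × Fin n), mdeg m = d →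
      coef hq₀ (m + Pi.single p 1) (D (YGL q n p.1 p.2)) ≠ 0 → IsCentralExp m) :
    ∃ N θ E, CentralSymbol hq₀ D d N θ E := by
  by_cases hN : ∃ N : ℕ, mdeg (N • idExp n) = d
  · obtain ⟨N, hN⟩ := hN
    set θ : Fin n × Fin n → K := fun p =>
      coef hq₀ (N • idExp n + Pi.single p 1) (D (YGL q n p.1 p.2))
        / coef hq₀ (N • idExp n + Pi.single p 1) (detGL q n ^ N * YGL q n p.1 p.2) with hθ
    have hmem : ∀ p, D (YGL q n p.1 p.2) - θ p • (detGL q n ^ N * YGL q n p.1 p.2)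
        ∈ filt q (d + pdeg p) := fun p =>
      Submodule.sub_mem _ (hD p) (Submodule.smul_mem _ _ (hN ▸
        mul_mem_filt (detGL_pow_mem_filt N) (YGL_mem_filt p)))
    refine ⟨N, θ, fun p => D (YGL q n p.1 p.2) - θ p • (detGL q n ^ N * YGL q n p.1 p.2),
      fun p => (add_sub_cancel _ _).symm, hmem, fun m p hm hne => ?_, .inr hN⟩
    have hmN : m ≠ N • idExp n := by
      rintro rfl
      apply hne
      rw [map_sub, map_smul, smul_eq_mul, hθ]
      rw [div_mul_cancel₀ _ (coef_detGL_pow_mul_YGL_ne_zero hq₀ N p), sub_self]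
    have hnn := (nonneg_of_coef_add_single_ne_zero hq₀ (hmem p) hne).1
    rw [map_sub, map_smul, coef_detGL_pow_mul_YGL hq₀ (hm.trans hN.symm),
      coef_detGL_pow_of_ne hq₀ (hm.trans hN.symm) hmN, mul_zero, smul_zero, sub_zero] at hne
    have hc := hC m p hm hne
    refine ⟨hc, ?_⟩
    by_contra! h0
    obtain ⟨k, rfl⟩ := hc.eq_smul_of_nonneg fun p' => by
      by_cases e : p' = p
      · rw [e]; exact h0
      · exact hnn p' e
    exact hmN (by rw [nsmul_idExp_injective hn (hm.trans hN.symm)])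
  · refine ⟨0, 0, fun p => D (YGL q n p.1 p.2), fun p => by simp, hD, fun m p hm hne => ?_,
        .inl rfl⟩
    have hc := hC m p hm hne
    have hnn := (nonneg_of_coef_add_single_ne_zero hq₀ (hD p) hne).1
    refine ⟨hc, ?_⟩
    by_contra! h0
    obtain ⟨k, rfl⟩ := hc.eq_smul_of_nonneg fun p' => by
      by_cases e : p' = p
      · rw [e]; exact h0
      · exact hnn p' e
    exact hN ⟨k, hm⟩

namespace CentralSymbol

variable {hq₀ : q ≠ 0} {D : Der K (OqGL q n)} {d : ℤ} {N : ℕ} {θ : Fin n × Fin n → K}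
  {E : Fin n × Fin n → OqGL q n}

/-- Reduces the degree bound for `E p` to central exponents whose only negative entry is a `-1` at
`p`; by `corner_of_neg` these exist only at the off-diagonal corners. -/
theorem mem_of_forall (h : CentralSymbol hq₀ D d N θ E) {p : Fin n × Fin n}
    (hp : ∀ m, mdeg m = d → IsCentralExp m → m p < 0 → (∀ p', p' ≠ p → 0 ≤ m p') → m p = -1 →
      coef hq₀ (m + Pi.single p 1) (E p) = 0) : E p ∈ filt q (d - 1 + pdeg p) := by
  have := mem_filt_sub_one hq₀ (h.mem p) fun μ hμ => by
    by_contra hne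
    have e : μ = μ - Pi.single p 1 + Pi.single p 1 := (sub_add_cancel _ _).symm
    have hd : mdeg (μ - Pi.single p 1) = d := by rw [mdeg_sub, mdeg_single, hμ]; ring
    rw [e] at hne
    obtain ⟨hc, hneg⟩ := h.central _ p hd hne
    obtain ⟨hnn, h1⟩ := nonneg_of_coef_add_single_ne_zero hq₀ (h.mem p) hne
    exact hne (hp _ hd hc hneg hnn (by omega))
  rwa [show d + pdeg p - 1 = d - 1 + pdeg p by ring] at this

theorem mem_of_not_corner (h : CentralSymbol hq₀ D d N θ E) (hn : 1 < n) {i α : Fin n}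
    (h1 : ¬ ((i : ℕ) = 0 ∧ (α : ℕ) + 1 = n)) (h2 : ¬ ((i : ℕ) + 1 = n ∧ (α : ℕ) = 0)) :
    E (i, α) ∈ filt q (d - 1 + pdeg (i, α)) :=
  h.mem_of_forall fun m _ hc hneg hnn _ =>
    absurd (hc.corner_of_neg hn hneg hnn) (not_or.2 ⟨h1, h2⟩)

theorem coef_eq (h : CentralSymbol hq₀ D d N θ E) {m : Fin n × Fin n → ℤ} {p : Fin n × Fin n}
    (hm : mdeg m = d) (hneg : m p < 0) :
    coef hq₀ (m + Pi.single p 1) (D (YGL q n p.1 p.2)) = coef hq₀ (m + Pi.single p 1) (E p) := by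
  rw [h.eq, map_add, map_smul]
  rcases h.deg with h0 | hN
  · simp [h0]
  · rw [coef_detGL_pow_mul_YGL hq₀ (hm.trans hN.symm), coef_detGL_pow_of_ne hq₀ (hm.trans hN.symm)]
    · simp
    · rintro rfl
      refine absurd hneg (not_lt.2 ?_)
      simp only [Pi.smul_apply, idExp]
      split_ifs <;> simp

theorem theta_mul_coef_eq_zero (h : CentralSymbol hq₀ D d N θ E) {m : Fin n × Fin n → ℤ}
    {p r s : Fin n × Fin n} {c : K} (hm : mdeg m = d) (hneg : m p < 0) (hc : θ = 0 → c = 0) :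
    c * coef hq₀ (m + Pi.single r 1 + Pi.single s 1)
      (detGL q n ^ N * YGL q n r.1 r.2 * YGL q n s.1 s.2) = 0 := by
  rcases h.deg with h0 | hN
  · rw [hc h0, zero_mul]
  · rw [coef_detGL_pow_mul_mul hq₀ (hm.trans hN.symm), coef_detGL_pow_of_ne hq₀ (hm.trans hN.symm)]
    · simp
    · rintro rfl
      refine absurd hneg (not_lt.2 ?_)
      simp only [Pi.smul_apply, idExp]
      split_ifs <;> simp

end CentralSymbol

end CentralSymbol

/-! ### Vanishing of the corner terms and additivity of the weights -/

section CentralSymbol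

variable {K : Type*} [Field K] {q : K} {n : ℕ}

theorem sub_inv_ne_zero_of_not_root (hq₀ : q ≠ 0) (hq : ∀ m : ℕ, 0 < m → q ^ m ≠ 1) :
    q - q⁻¹ ≠ 0 := by
  intro h
  refine hq 2 two_pos ?_
  rw [sub_eq_zero] at h
  rw [pow_two]
  nth_rewrite 1 [h]
  exact inv_mul_cancel₀ hq₀

theorem exists_smul_sub_coef_eq_zero (hq₀ : q ≠ 0) (N : ℕ) (p : Fin n × Fin n) {x : OqGL q n}
    {e : ℤ} (hx : x ∈ filt q e) : ∃ (c : K) (y : OqGL q n) (e' : ℤ), y ∈ filt q e' ∧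
      x = c • (detGL q n ^ N * YGL q n p.1 p.2) + y ∧
      coef hq₀ (N • idExp n + Pi.single p 1) y = 0 := by
  have hm : detGL q n ^ N * YGL q n p.1 p.2 ∈ filt q (mdeg (N • idExp n) + pdeg p) :=
    mul_mem_filt (detGL_pow_mem_filt N) (YGL_mem_filt p)
  refine ⟨coef hq₀ (N • idExp n + Pi.single p 1) x
    / coef hq₀ (N • idExp n + Pi.single p 1) (detGL q n ^ N * YGL q n p.1 p.2), _,
    max e (mdeg (N • idExp n) + pdeg p),
    Submodule.sub_mem _ (filt_mono (le_max_left _ _) hx)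
      (Submodule.smul_mem _ _ (filt_mono (le_max_right _ _) hm)), (add_sub_cancel _ _).symm, ?_⟩
  rw [map_sub, map_smul, smul_eq_mul,
    div_mul_cancel₀ _ (coef_detGL_pow_mul_YGL_ne_zero hq₀ N p), sub_self]

namespace CentralSymbol

variable {hq₀ : q ≠ 0} {D : Der K (OqGL q n)} {d : ℤ} {N : ℕ} {θ : Fin n × Fin n → K}
  {E : Fin n × Fin n → OqGL q n}

/-- For `n = 2` such an exponent turns one off-diagonal generator into a power of `Δ` times the
other, as in `b ↦ Δ^N c`. The block representation excludes this. -/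
theorem mem_of_corner_two (h : CentralSymbol hq₀ D d N θ E) (hD : HasDeg D d)
    (hq : ∀ m : ℕ, 0 < m → q ^ m ≠ 1) (hn : n = 2) {z l : Fin n} (hz : (z : ℕ) = 0)
    (hl : (l : ℕ) = 1) : E (z, l) ∈ filt q (d - 1 + pdeg (z, l)) ∧
      E (l, z) ∈ filt q (d - 1 + pdeg (l, z)) := by
  have hzl : z ≠ l := fun e => by rw [e] at hz; omega
  have hall : ∀ i : Fin n, i = z ∨ i = l := fun i => by
    simp only [Fin.ext_iff]; omega
  constructor
  · refine h.mem_of_forall fun m hm hc hneg hnn h1 => ?_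
    have w := hc.wrap (z := z) (l := l) (α := z) (α' := l) hz (by omega) (by omega)
    have dg := hc.diag_succ (i := z) (α := z) (i' := l) (α' := l) (by omega) (by omega)
    have h0 := hnn (z, z) (by simp [hzl])
    have e : m + Pi.single (z, l) 1 = (m (z, z)).toNat • idExp n + Pi.single (l, z) 1 := by
      refine eq_smul_idExp_add_single fun i α => ?_
      rw [Int.toNat_of_nonneg h0, Pi.add_apply, Pi.single_apply]
      simp only [Prod.mk.injEq]
      rcases hall i with rfl | rfl <;> rcases hall α with rfl | rfl <;>
        simp [hzl, hzl.symm] <;> omega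
    rw [← h.coef_eq hm hneg]
    obtain ⟨c, y, e', hy, hx, hcy⟩ :=
      exists_smul_sub_coef_eq_zero hq₀ (m (z, z)).toNat (l, z) (hD (z, l))
    have hc0 := hD.upper_block_eq_zero hq₀ hq (k := z) (k' := l) (by omega) hy hx hcy
    rw [hx, hc0, zero_smul, zero_add, e, hcy]
  · refine h.mem_of_forall fun m hm hc hneg hnn h1 => ?_
    have w := hc.wrap (z := z) (l := l) (α := z) (α' := l) hz (by omega) (by omega)
    have dg := hc.diag_succ (i := z) (α := z) (i' := l) (α' := l) (by omega) (by omega)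
    have h0 := hnn (z, z) (by simp [hzl])
    have e : m + Pi.single (l, z) 1 = (m (z, z)).toNat • idExp n + Pi.single (z, l) 1 := by
      refine eq_smul_idExp_add_single fun i α => ?_
      rw [Int.toNat_of_nonneg h0, Pi.add_apply, Pi.single_apply]
      simp only [Prod.mk.injEq]
      rcases hall i with rfl | rfl <;> rcases hall α with rfl | rfl <;>
        simp [hzl, hzl.symm] <;> omega
    rw [← h.coef_eq hm hneg]
    obtain ⟨c, y, e', hy, hx, hcy⟩ :=
      exists_smul_sub_coef_eq_zero hq₀ (m (z, z)).toNat (z, l) (hD (l, z))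
    have hc0 := hD.lower_block_eq_zero hq₀ hq (k := z) (k' := l) (by omega) hy hx hcy
    rw [hx, hc0, zero_smul, zero_add, e, hcy]

/-- For `n > 2` apply `block_coef` to the adjacent block containing the corner. By `wrap` and
nonnegativity `m` vanishes at the two diagonal positions of that block, neither of which is an
off-diagonal corner, so only the corner coefficient remains. -/
theorem mem_of_corner (h : CentralSymbol hq₀ D d N θ E)
    (hq : ∀ m : ℕ, 0 < m → q ^ m ≠ 1) (hn : 2 < n) {z l : Fin n} (hz : (z : ℕ) = 0)
    (hl : (l : ℕ) + 1 = n) : E (z, l) ∈ filt q (d - 1 + pdeg (z, l)) ∧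
      E (l, z) ∈ filt q (d - 1 + pdeg (l, z)) := by
  have hκ := sub_inv_ne_zero_of_not_root hq₀ hq
  constructor
  · refine h.mem_of_forall fun m hm hc hneg hnn _ => ?_
    set i' : Fin n := ⟨1, by omega⟩ with hi'
    set α : Fin n := ⟨n - 2, by omega⟩ with hα
    have w := hc.wrap (z := z) (l := l) (α := ⟨n - 3, by omega⟩) (α' := α) hz hl
      (by simp [hα]; omega)
    have dg := hc.diag_succ (i := z) (α := α) (i' := i') (α' := l) (by simp [hi']; omega)
      (by simp [hα]; omega)
    have n1 := hnn (z, α) (by simp [hα, Fin.ext_iff]; omega)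
    have n2 := hnn (l, ⟨n - 3, by omega⟩) (by simp [Fin.ext_iff]; omega)
    have key := HasDeg.block_coef hq₀ hκ h.eq (i := z) (i' := i') (α := α) (α' := l)
      (by simp [hi']; omega) (by simp [hα]; omega)
      (h.mem_of_not_corner (by omega) (by simp [hα]; omega) (by simp [hα]; omega))
      (h.mem_of_not_corner (by omega) (by simp [hi']) (by simp [hi']; omega))
      (h.mem _) (h.mem _) hm (by omega) (by omega)
    have ht := h.theta_mul_coef_eq_zero (r := (z, l)) (s := (i', α)) hm hneg
      (c := θ (z, l) + θ (i', α) - θ (z, α) - θ (i', l)) (fun h0 => by simp [h0])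
    rw [ht, zero_add, coef_of_neg hq₀ (h.mem (i', α)) (p := (z, l)) (add_single_neg hneg
      (by simp [hα, Fin.ext_iff]; omega)), mul_zero, add_zero] at key
    exact (mul_eq_zero.1 key).resolve_left (zpow_ne_zero _ hq₀)
  · refine h.mem_of_forall fun m hm hc hneg hnn _ => ?_
    set i : Fin n := ⟨n - 2, by omega⟩ with hi
    set α' : Fin n := ⟨1, by omega⟩ with hα'
    have w := hc.wrap (z := z) (l := l) (α := α') (α' := ⟨2, by omega⟩) hz hl rfl
    have dg := hc.diag_succ (i := i) (α := z) (i' := l) (α' := α') (by simp [hi]; omega)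
      (by simp [hα']; omega)
    have n1 := hnn (l, α') (by simp [hα', Fin.ext_iff]; omega)
    have n2 := hnn (z, ⟨2, by omega⟩) (by simp [Fin.ext_iff]; omega)
    have key := HasDeg.block_coef hq₀ hκ h.eq (i := i) (i' := l) (α := z) (α' := α')
      (by simp [hi]; omega) (by simp [hα']; omega)
      (h.mem_of_not_corner (by omega) (by simp [hi]; omega) (by simp [hi]; omega))
      (h.mem_of_not_corner (by omega) (by simp [hα']; omega) (by simp [hα']))
      (h.mem _) (h.mem _) hm (by omega) (by omega)
    have ht := h.theta_mul_coef_eq_zero (r := (i, α')) (s := (l, z)) hm hneg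
      (c := θ (i, α') + θ (l, z) - θ (i, z) - θ (l, α')) (fun h0 => by simp [h0])
    rw [ht, zero_add, coef_of_neg hq₀ (h.mem (i, α')) (p := (l, z)) (add_single_neg hneg
      (by simp [hi, Fin.ext_iff]; omega)), mul_zero, zero_add] at key
    exact (mul_eq_zero.1 key).resolve_left (zpow_ne_zero _ hq₀)

theorem mem_sub_one (h : CentralSymbol hq₀ D d N θ E) (hD : HasDeg D d)
    (hq : ∀ m : ℕ, 0 < m → q ^ m ≠ 1) (hn : 1 < n) (p : Fin n × Fin n) :
    E p ∈ filt q (d - 1 + pdeg p) := by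
  obtain ⟨i, α⟩ := p
  by_cases h1 : (i : ℕ) = 0 ∧ (α : ℕ) + 1 = n
  · by_cases h2 : n = 2
    · exact (h.mem_of_corner_two hD hq h2 h1.1 (by omega)).1
    · exact (h.mem_of_corner hq (by omega) h1.1 h1.2).1
  by_cases h2 : (i : ℕ) + 1 = n ∧ (α : ℕ) = 0
  · by_cases h3 : n = 2
    · exact (h.mem_of_corner_two hD hq h3 h2.2 (by omega)).2
    · exact (h.mem_of_corner hq (by omega) h2.2 h2.1).2
  exact h.mem_of_not_corner hn h1 h2

/-- The exponent `N • idExp n` vanishes on the diagonal positions of a block off the main diagonal,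
so `block_coef` applies there. On the main diagonal it equals `N` at those positions, and the block
representation takes over. -/
theorem theta_block (h : CentralSymbol hq₀ D d N θ E) (hD : HasDeg D d)
    (hq : ∀ m : ℕ, 0 < m → q ^ m ≠ 1) (hn : 1 < n) {i i' α α' : Fin n} (hi : (i' : ℕ) = i + 1)
    (hα : (α' : ℕ) = α + 1) : θ (i, α) + θ (i', α') = θ (i, α') + θ (i', α) := by
  rcases h.deg with h0 | hN
  · simp [h0]
  have hz : ∀ p, coef hq₀ (N • idExp n + Pi.single p 1) (E p) = 0 := fun p => by
    by_contra hne
    refine absurd (h.central _ p hN hne).2 (not_lt.2 ?_)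
    simp only [Pi.smul_apply, idExp]
    split_ifs <;> simp
  by_cases hiα : i = α
  · subst hiα
    obtain rfl : i' = α' := Fin.ext (by omega)
    refine hD.add_diag_block hq₀ hq hi (e := d + ∑ p : Fin n × Fin n, pdeg p) (fun p => ?_) h.eq
      fun p _ _ => hz p
    refine filt_mono ?_ (h.mem p)
    have := Finset.single_le_sum (fun p _ => pdeg_nonneg p) (Finset.mem_univ p)
    omega
  · have hiα' : i' ≠ α' := fun e => hiα (Fin.ext (by rw [Fin.ext_iff] at e; omega))
    have key := HasDeg.block_coef hq₀ (sub_inv_ne_zero_of_not_root hq₀ hq) h.eq hi hα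
      (h.mem_sub_one hD hq hn _) (h.mem_sub_one hD hq hn _) (h.mem _) (h.mem _) hN
      (by simp [idExp, hiα]) (by simp [idExp, hiα'])
    rw [hz, hz, mul_zero, mul_zero, add_zero, add_zero,
      coef_detGL_pow_mul_mul hq₀ rfl (i, α') (i', α)] at key
    obtain ⟨u, hu, hu'⟩ := exists_coef_detGL_pow (n := n) hq₀ N
    rw [hu'] at key
    have := (mul_eq_zero.1 key).resolve_right (mul_ne_zero (zpow_ne_zero _ hq₀)
      (mul_ne_zero (zpow_ne_zero _ hq₀) hu))
    linear_combination -this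

end CentralSymbol

/-- A derivation of degree at most `d` is, up to lower degree, the sum of an inner derivation and a
multiple of a weight derivation by a power of the determinant. -/
theorem HasDeg.exists_sub (hq₀ : q ≠ 0) (hq : ∀ m : ℕ, 0 < m → q ^ m ≠ 1) (hn : 1 < n)
    {D : Der K (OqGL q n)} {d : ℤ} (hD : HasDeg D d) :
    ∃ (x : OqGL q n) (N : ℕ) (a b : Fin n → K), ∀ p : Fin n × Fin n,
      (D - ad K x : Der K (OqGL q n)) (YGL q n p.1 p.2)
        - (a p.1 + b p.2) • (detGL q n ^ N * YGL q n p.1 p.2) ∈ filt q (d - 1 + pdeg p) := by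
  obtain ⟨x, hx, hC⟩ := hD.exists_ad hq₀ hq
  have hD' := hD.sub (hasDeg_ad hx)
  obtain ⟨N, θ, E, h⟩ := hD'.exists_centralSymbol hq₀ hn hC
  -- The row and column weights normalised along the first row and the first column of `θ`.
  refine ⟨x, N, fun i => θ (i, ⟨0, by omega⟩) - θ (⟨0, by omega⟩, ⟨0, by omega⟩),
    fun α => θ (⟨0, by omega⟩, α), fun p => ?_⟩
  rw [← additive_of_adjacent (fun i i' α α' hi hα => h.theta_block hD' hq hn hi hα) _ _ _ rfl,
      h.eq p,
    add_sub_cancel_left]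
  exact h.mem_sub_one hD' hq hn p

end CentralSymbol

/-! ### The centre -/

section Centre

variable {K : Type*} [Field K] {q : K} {n : ℕ}

/-- Central leading exponents of an actual element are nonnegative, hence multiples of `idExp n`. As
`idExp n` has positive degree, each degree contains at most one power of `Δ`. -/
theorem exists_sub_detGL_pow_mem (hq₀ : q ≠ 0) (hn : 1 < n) {x : OqGL q n} {e : ℤ}
    (hx : x ∈ filt q e) (hc : ∀ m, mdeg m = e → coef hq₀ m x ≠ 0 → IsCentralExp m) :
    ∃ (c : K) (k : ℕ), x - c • detGL q n ^ k ∈ filt q (e - 1) := by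
  have hnn : ∀ m, mdeg m = e → coef hq₀ m x ≠ 0 → ∃ k : ℕ, m = k • idExp n := fun m hm h =>
    (hc m hm h).eq_smul_of_nonneg fun p => by
      by_contra! hneg
      exact h (coef_of_neg hq₀ hx hneg)
  by_cases hk : ∃ k : ℕ, mdeg (k • idExp n) = e
  · obtain ⟨k, hk⟩ := hk
    obtain ⟨u, hu, hu'⟩ := exists_coef_detGL_pow (n := n) hq₀ k
    refine ⟨coef hq₀ (k • idExp n) x / u, k, mem_filt_sub_one hq₀ (Submodule.sub_mem _ hx
      (Submodule.smul_mem _ _ (hk ▸ detGL_pow_mem_filt k))) fun m hm => ?_⟩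
    rw [map_sub, map_smul, smul_eq_mul]
    by_cases hmk : m = k • idExp n
    · rw [hmk, hu', div_mul_cancel₀ _ hu, sub_self]
    · rw [coef_detGL_pow_of_ne hq₀ (hm.trans hk.symm) hmk, mul_zero, sub_zero]
      by_contra hne
      obtain ⟨l, rfl⟩ := hnn m hm hne
      exact hmk (by rw [nsmul_idExp_injective hn (hm.trans hk.symm)])
  · refine ⟨0, 0, ?_⟩
    rw [zero_smul, sub_zero]
    refine mem_filt_sub_one hq₀ hx fun m hm => ?_
    by_contra hne
    obtain ⟨l, rfl⟩ := hnn m hm hne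
    exact hk ⟨l, hm⟩

theorem isCentralExp_of_ad (hq₀ : q ≠ 0) (hq : ∀ m : ℕ, 0 < m → q ^ m ≠ 1) {x : OqGL q n}
    {m : Fin n × Fin n → ℤ} (hx : x ∈ filt q (mdeg m)) (hm : coef hq₀ m x ≠ 0)
    (h : ∀ p : Fin n × Fin n,
      coef hq₀ (m + Pi.single p 1) (ad K x (YGL q n p.1 p.2)) = 0) : IsCentralExp m := fun p => by
  have hp := h p
  rw [coef_ad hq₀ hx] at hp
  exact (chi_eq_zero_iff hq₀ hq).1 ((mul_eq_zero.1 hp).resolve_right hm)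

theorem ad_eq_zero_of_mem_center {x : OqGL q n} (hx : x ∈ Subalgebra.center K (OqGL q n))
    (y : OqGL q n) : ad K x y = 0 := by
  rw [ad_apply, Subalgebra.mem_center_iff.1 hx y, sub_self]

variable (q n) in
theorem detGL_mem_center (hq₀ : q ≠ 0) : detGL q n ∈ Subalgebra.center K (OqGL q n) :=
  Subalgebra.mem_center_iff.2 fun x => (detGL_commute hq₀ x).eq.symm

variable (q n) in
theorem detInvGL_mem_center (hq₀ : q ≠ 0) : detInvGL q n ∈ Subalgebra.center K (OqGL q n) := by
  refine Subalgebra.mem_center_iff.2 fun x => ?_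
  have h := (detGL_commute hq₀ x).eq
  calc x * detInvGL q n = detInvGL q n * (detGL q n * x) * detInvGL q n := by
        rw [← mul_assoc, detInvGL_mul_detGL, one_mul]
    _ = detInvGL q n * x := by
        rw [h, mul_assoc, mul_assoc, detGL_mul_detInvGL, mul_one]

theorem mem_adjoin_of_mem_filt (hq₀ : q ≠ 0) (hq : ∀ m : ℕ, 0 < m → q ^ m ≠ 1) (hn : 1 < n)
    (t : ℕ) {x : OqGL q n} {e : ℤ} (ht : e < t) (hx : x ∈ filt q e)
    (hc : x ∈ Subalgebra.center K (OqGL q n)) : x ∈ Algebra.adjoin K {detGL q n} := by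
  induction t generalizing x e with
  | zero =>
    rw [filt_neg (by exact_mod_cast ht), Submodule.mem_bot] at hx
    rw [hx]
    exact Subalgebra.zero_mem _
  | succ t ih =>
    obtain ⟨c, k, h⟩ := exists_sub_detGL_pow_mem hq₀ hn hx fun m hm hne =>
      isCentralExp_of_ad hq₀ hq (hm ▸ hx) hne fun p => by
        rw [ad_eq_zero_of_mem_center hc, map_zero]
    have hΔ : c • detGL q n ^ k ∈ Subalgebra.center K (OqGL q n) :=
      Subalgebra.smul_mem _ (Subalgebra.pow_mem _ (detGL_mem_center q n hq₀) k) c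
    have h1 := ih (by push_cast at ht; omega) h (Subalgebra.sub_mem _ hc hΔ)
    have h2 : c • detGL q n ^ k ∈ Algebra.adjoin K {detGL q n} :=
      Subalgebra.smul_mem _ (Subalgebra.pow_mem _ (Algebra.self_mem_adjoin_singleton K _) k) c
    simpa using Subalgebra.add_mem _ h1 h2

theorem detInvGL_pow_mul_detGL_pow_mul (hq₀ : q ≠ 0) (k : ℕ) (x : OqGL q n) :
    detInvGL q n ^ k * (detGL q n ^ k * x) = x := by
  rw [← mul_assoc, ← (show Commute (detInvGL q n) (detGL q n) from
    (detGL_commute hq₀ (detInvGL q n)).symm).mul_pow, detInvGL_mul_detGL, one_pow, one_mul]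

/-- The centre of `O_q(GL_n)` is generated by the quantum determinant and its inverse. -/
theorem center_eq (hq₀ : q ≠ 0) (hq : ∀ m : ℕ, 0 < m → q ^ m ≠ 1) (hn : 1 < n) :
    Subalgebra.center K (OqGL q n) = Algebra.adjoin K {detGL q n, detInvGL q n} := by
  refine le_antisymm (fun x hx => ?_) (Algebra.adjoin_le ?_)
  · obtain ⟨k, e, h⟩ := exists_detGL_pow_mul_mem hq₀ x
    have h1 := mem_adjoin_of_mem_filt hq₀ hq hn (e.toNat + 1)
      (by push_cast; have := Int.self_le_toNat e; omega) h
      (Subalgebra.mul_mem _ (Subalgebra.pow_mem _ (detGL_mem_center q n hq₀) k) hx)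
    rw [← detInvGL_pow_mul_detGL_pow_mul hq₀ k x]
    exact Subalgebra.mul_mem _
      (Subalgebra.pow_mem _ (Algebra.subset_adjoin
        (Set.mem_insert_of_mem _ (Set.mem_singleton (detInvGL q n)))) k)
      (Algebra.adjoin_mono (Set.singleton_subset_iff.2 (Set.mem_insert _ _)) h1)
  · rintro x (rfl | rfl)
    · exact detGL_mem_center q n hq₀
    · exact detInvGL_mem_center q n hq₀

/-- Powers of `Δ` have strictly increasing degrees, so the top term of a polynomial in `Δ` cannot
cancel. -/
theorem transcendental_detGL (hq₀ : q ≠ 0) (hn : 1 < n) : Transcendental K (detGL q n) := by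
  rw [transcendental_iff]
  intro P hP
  by_contra hne
  have h := congrArg (coef hq₀ (P.natDegree • idExp n)) hP
  rw [Polynomial.aeval_eq_sum_range, map_sum, map_zero, Finset.sum_range_succ,
    Finset.sum_eq_zero, zero_add, map_smul, smul_eq_mul] at h
  · obtain ⟨u, hu, hu'⟩ := exists_coef_detGL_pow (n := n) hq₀ P.natDegree
    rw [hu', mul_eq_zero, Polynomial.coeff_natDegree, Polynomial.leadingCoeff_eq_zero] at h
    exact h.elim hne hu
  · intro i hi
    rw [map_smul, coef_of_lt hq₀ (detGL_pow_mem_filt i), smul_zero]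
    rw [mdeg_nsmul, mdeg_nsmul]
    exact mul_lt_mul_of_pos_right (by exact_mod_cast Finset.mem_range.1 hi) (mdeg_idExp_pos hn)

end Centre

/-! ### Generation by the derivations `D_j` -/

section Generation

variable {K : Type*} [Field K] {q : K} {n : ℕ}

/-- The index of the derivation of a column. -/
def colIdx (α : Fin n) : Fin (2 * n - 1) := ⟨n - 1 - α, by omega⟩

/-- The index of the derivation of a row. -/
def rowIdx (i : Fin n) : Fin (2 * n - 1) := ⟨i + (n - 1), by omega⟩

variable (n) in
/-- The index of the middle derivation. -/
def midIdx (hn : 1 < n) : Fin (2 * n - 1) := ⟨n - 1, by omega⟩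

theorem Der.sum_apply {ι : Type*} (s : Finset ι) (f : ι → Der K (OqGL q n)) (x : OqGL q n) :
    (∑ j ∈ s, f j : Der K (OqGL q n)) x = ∑ j ∈ s, f j x := by
  classical
  induction s using Finset.induction_on with
  | empty => rfl
  | insert j s hj ih => rw [Finset.sum_insert hj, Finset.sum_insert hj, Der.add_apply, ih]

/-- The indices of column 0, row 0 and the middle coincide. In this uniform formula the subtracted
term yields `D_n` and prevents counting the shared index twice. -/
theorem derD_YGL (hn : 1 < n) (j : Fin (2 * n - 1)) (i α : Fin n) :
    derD q j (YGL q n i α) = ((if j = colIdx α then 1 else 0) + (if j = rowIdx i then 1 else 0)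
      - if j = midIdx n hn then 1 else 0 : K) • YGL q n i α := by
  have hj : (j : ℕ) < 2 * n - 1 := j.isLt
  unfold derD
  dsimp only
  by_cases h1 : (j : ℕ) + 1 < n
  · rw [if_pos h1, colDer_YGL, if_neg (c := j = rowIdx i) (by simp [rowIdx, Fin.ext_iff]; omega),
      if_neg (c := j = midIdx n hn) (by simp [midIdx, Fin.ext_iff]; omega), add_zero, sub_zero,
      ite_smul, one_smul, zero_smul]
    congr 1
    simp only [colIdx, Fin.ext_iff, eq_iff_iff]
    omega
  rw [if_neg h1]
  by_cases h2 : (j : ℕ) + 1 = n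
  · have e1 : (j = colIdx α) ↔ (⟨0, by omega⟩ : Fin n) = α := by
      simp only [colIdx, Fin.ext_iff]; omega
    have e2 : (j = rowIdx i) ↔ (⟨0, by omega⟩ : Fin n) = i := by
      simp only [rowIdx, Fin.ext_iff]; omega
    have e3 : j = midIdx n hn := by simp only [midIdx, Fin.ext_iff]; omega
    rw [if_pos h2, Der.sub_apply, Der.add_apply, rowDer_YGL, colDer_YGL, Der.sum_apply]
    simp only [rowDer_YGL, Finset.sum_ite_eq', Finset.mem_univ, if_true, e1, e2, if_pos e3,
      sub_smul, add_smul, ite_smul, one_smul, zero_smul]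
    rw [add_comm (ite _ _ _)]
  · rw [if_neg h2, rowDer_YGL, if_neg (c := j = colIdx α) (by simp [colIdx, Fin.ext_iff]; omega),
      if_neg (c := j = midIdx n hn) (by simp [midIdx, Fin.ext_iff]; omega), zero_add, sub_zero,
      ite_smul, one_smul, zero_smul]
    congr 1
    simp only [rowIdx, Fin.ext_iff, eq_iff_iff]
    omega

theorem sum_smul_derD_YGL (hn : 1 < n) (μ : Fin (2 * n - 1) → Subalgebra.center K (OqGL q n))
    (i α : Fin n) : (∑ j, μ j • derD q j : Der K (OqGL q n)) (YGL q n i α)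
      = (μ (colIdx α) + μ (rowIdx i) - μ (midIdx n hn) : Subalgebra.center K (OqGL q n))
        * YGL q n i α := by
  rw [Der.sum_apply]
  simp only [Der.smul_apply, derD_YGL hn, sub_smul, add_smul, mul_sub, mul_add, ite_smul, one_smul,
    zero_smul, mul_ite, mul_zero, Finset.sum_sub_distrib, Finset.sum_add_distrib,
    Finset.sum_ite_eq', Finset.mem_univ, if_true]
  push_cast
  rw [sub_mul, add_mul]

end Generation

/-! ### The `D_j` span the derivations modulo inner ones -/

section Generation

variable {K : Type*} [Field K] {q : K} {n : ℕ}

theorem weightDer_mem_span (hn : 1 < n) (a b : Fin n → K) :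
    weightDer q a b ∈ Submodule.span (Subalgebra.center K (OqGL q n)) (Set.range (derD (n := n)
        q)) := by
  set z : Fin n := ⟨0, by omega⟩
  -- The requirement is that the column value at `α` plus the row value at `i` minus the middle
  -- value be `a i + b α`. Take `a z + b α` and `a i + b z`; they agree at the shared index, where
  -- both are `a z + b z`.
  set c : Fin (2 * n - 1) → K := fun j =>
    if h : (j : ℕ) < n then a z + b ⟨n - 1 - j, by omega⟩
    else a ⟨j - (n - 1), by omega⟩ + b z with hc
  refine (Submodule.mem_span_range_iff_exists_fun _).2
    ⟨fun j => algebraMap K (Subalgebra.center K (OqGL q n)) (c j), der_ext q fun i α => ?_⟩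
  rw [sum_smul_derD_YGL hn, ← map_add, ← map_sub, Subalgebra.coe_algebraMap, ← Algebra.smul_def,
    weightDer_YGL]
  congr 1
  have h1 : c (colIdx α) = a z + b α := by
    have : (colIdx α : ℕ) < n := by simp only [colIdx]; omega
    simp only [hc, dif_pos this]
    congr 2
    simp only [colIdx, Fin.ext_iff]; omega
  have h2 : c (rowIdx i) = a i + b z := by
    by_cases hi : i = z
    · have e : rowIdx i = colIdx z := by simp [rowIdx, colIdx, hi, z]
      have : (colIdx z : ℕ) < n := by simp only [colIdx]; omega
      rw [e, hi]
      simp only [hc, dif_pos this]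
      congr 2
      simp [colIdx, z]
    · have : ¬ (rowIdx i : ℕ) < n := by
        have : (i : ℕ) ≠ 0 := fun e => hi (Fin.ext e)
        simp only [rowIdx]; omega
      simp only [hc, dif_neg this]
      congr 2
      simp [rowIdx]
  have h3 : c (midIdx n hn) = a z + b z := by
    have : (midIdx n hn : ℕ) < n := by simp only [midIdx]; omega
    simp only [hc, dif_pos this]
    congr 2
    simp [midIdx, z]
  rw [h1, h2, h3]
  ring

theorem HasDeg.mem_sup (hq₀ : q ≠ 0) (hq : ∀ m : ℕ, 0 < m → q ^ m ≠ 1) (hn : 1 < n)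
    (t : ℕ) {D : Der K (OqGL q n)} {d : ℤ} (ht : d + ∑ p : Fin n × Fin n, pdeg p < t)
    (hD : HasDeg D d) : D ∈ InnDer K (OqGL q n) ⊔
      Submodule.span (Subalgebra.center K (OqGL q n)) (Set.range (derD (n := n) q)) := by
  induction t generalizing D d with
  | zero =>
    -- The total of all `pdeg` bounds each one, so every value of `D` on a generator lies in
    -- negative degree.
    have : D = 0 := der_ext q fun i α => by
      have h := hD (i, α)
      have := Finset.single_le_sum (fun p _ => pdeg_nonneg p) (Finset.mem_univ (i, α))
      rw [filt_neg (by push_cast at ht; omega), Submodule.mem_bot] at h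
      exact h
    rw [this]
    exact Submodule.zero_mem _
  | succ t ih =>
    obtain ⟨x, N, a, b, h⟩ := hD.exists_sub hq₀ hq hn
    set z : Subalgebra.center K (OqGL q n) := ⟨detGL q n ^ N,
      Subalgebra.pow_mem _ (detGL_mem_center q n hq₀) N⟩ with hz
    have h1 : HasDeg (D - ad K x - z • weightDer q a b) (d - 1) := fun p => by
      rw [Der.sub_apply, Der.smul_apply, weightDer_YGL, mul_smul_comm]
      exact h p
    have h2 := ih (by push_cast at ht; omega) h1
    have h3 : ad K x ∈ InnDer K (OqGL q n) := ⟨x, rfl⟩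
    have h4 := Submodule.smul_mem _ z (weightDer_mem_span (q := q) hn a b)
    have := Submodule.add_mem _ (Submodule.add_mem _ h2 (Submodule.mem_sup_right h4))
      (Submodule.mem_sup_left h3)
    rwa [sub_add_cancel, sub_add_cancel] at this

theorem exists_detGL_pow_mul_mem_forall (hq₀ : q ≠ 0) {ι : Type*} (s : Finset ι)
    (f : ι → OqGL q n) : ∃ (k : ℕ) (e : ℤ), 0 ≤ e ∧ ∀ i ∈ s, detGL q n ^ k * f i ∈ filt q e := by
  classical
  induction s using Finset.induction_on with
  | empty => exact ⟨0, 0, le_rfl, by simp⟩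
  | insert i s _ ih =>
    obtain ⟨k, e, he, h⟩ := ih
    obtain ⟨l, f', h'⟩ := exists_detGL_pow_mul_mem hq₀ (f i)
    refine ⟨l + k, max 0 (max (mdeg (l • idExp n) + e) (mdeg (k • idExp n) + f')), le_max_left _ _,
      fun j hj => ?_⟩
    rcases Finset.mem_insert.1 hj with rfl | hj
    · rw [add_comm l k, pow_add, mul_assoc]
      exact filt_mono ((le_max_right _ _).trans (le_max_right _ _))
        (mul_mem_filt (detGL_pow_mem_filt k) h')
    · rw [pow_add, mul_assoc]
      exact filt_mono ((le_max_left _ _).trans (le_max_right _ _))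
        (mul_mem_filt (detGL_pow_mem_filt l) (h j hj))

/-- The derivations `D_j` generate the derivations modulo the inner ones. -/
theorem InnDer_sup_span (hq₀ : q ≠ 0) (hq : ∀ m : ℕ, 0 < m → q ^ m ≠ 1) (hn : 1 < n) :
    InnDer K (OqGL q n) ⊔ Submodule.span (Subalgebra.center K (OqGL q n))
      (Set.range (derD (n := n) q)) = ⊤ := by
  refine eq_top_iff.2 fun D _ => ?_
  -- A power of `Δ` clears the denominators of the finitely many values on generators. The resulting
  -- derivation has bounded degree, and the power is divided out at the end, being a central unit.
  obtain ⟨k, e, he, h⟩ := exists_detGL_pow_mul_mem_forall hq₀ Finset.univ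
    fun p : Fin n × Fin n => D (YGL q n p.1 p.2)
  set z : Subalgebra.center K (OqGL q n) := ⟨detGL q n ^ k,
    Subalgebra.pow_mem _ (detGL_mem_center q n hq₀) k⟩
  set z' : Subalgebra.center K (OqGL q n) := ⟨detInvGL q n ^ k,
    Subalgebra.pow_mem _ (detInvGL_mem_center q n hq₀) k⟩
  have h1 : HasDeg (z • D) e := fun p => by
    rw [Der.smul_apply]
    exact filt_mono (by have := pdeg_nonneg p; omega) (h p (Finset.mem_univ p))
  have h2 : D = z' • (z • D) := Der.ext fun x => by
    rw [Der.smul_apply, Der.smul_apply]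
    exact (detInvGL_pow_mul_detGL_pow_mul hq₀ k _).symm
  rw [h2]
  refine Submodule.smul_mem _ _ (h1.mem_sup hq₀ hq hn
    (e + ∑ p : Fin n × Fin n, pdeg p).toNat.succ ?_)
  push_cast
  have := Int.self_le_toNat (e + ∑ p : Fin n × Fin n, pdeg p)
  omega

end Generation

/-! ### Independence of the derivations `D_j` modulo inner derivations -/

section Independence

variable {K : Type*} [Field K] {q : K} {n : ℕ}

/-- Multiplication by a generator does not kill leading terms, so a degree bound on the product
passes to the factor. -/
theorem mem_filt_of_mul_YGL_mem (hq₀ : q ≠ 0) (p : Fin n × Fin n) (t : ℕ) {x : OqGL q n} {e f : ℤ}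
    (ht : f ≤ e + t) (hx : x ∈ filt q f) (h : x * YGL q n p.1 p.2 ∈ filt q (e + pdeg p)) :
    x ∈ filt q e := by
  induction t generalizing f with
  | zero => exact filt_mono (by push_cast at ht; omega) hx
  | succ t ih =>
    by_cases hf : f ≤ e
    · exact filt_mono hf hx
    refine ih (f := f - 1) (by push_cast at ht; omega) (mem_filt_sub_one hq₀ hx fun m hm => ?_)
    subst hm
    have h1 := coef_mul_YGL hq₀ hx p
    rw [coef_of_lt hq₀ h (by rw [mdeg_add, mdeg_single]; omega)] at h1
    exact (mul_eq_zero.1 h1.symm).resolve_left (zpow_ne_zero _ hq₀)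

/-- Central `ν p` has only central leading exponents, while `[x, Y_p]` has zero coefficient at
those. Hence `[x, Y_p]` has no component in the top degree, the leading exponents of `x` are
central, and a multiple of a power of `Δ` can be subtracted from `x` without changing `ad x`. Once
`x` lies in negative degree, so does `ν p`. -/
theorem eq_zero_of_ad_eq_mul (hq₀ : q ≠ 0) (hq : ∀ m : ℕ, 0 < m → q ^ m ≠ 1) (hn : 1 < n)
    {ν : Fin n × Fin n → OqGL q n} (hν : ∀ p, ν p ∈ Subalgebra.center K (OqGL q n)) {f : ℤ}
    (hf : ∀ p, ν p ∈ filt q f) (t : ℕ) {x : OqGL q n} {e : ℤ} (ht : e < t) (hx : x ∈ filt q e)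
    (h : ∀ p, ad K x (YGL q n p.1 p.2) = ν p * YGL q n p.1 p.2) (p : Fin n × Fin n) : ν p = 0 := by
  have hνe : ∀ {x : OqGL q n} {e : ℤ}, x ∈ filt q e →
      (∀ p, ad K x (YGL q n p.1 p.2) = ν p * YGL q n p.1 p.2) → ∀ p, ν p ∈ filt q e := by
    intro x e hx h p
    refine mem_filt_of_mul_YGL_mem hq₀ p (f - e).toNat ?_ (hf p) ?_
    · have := Int.self_le_toNat (f - e); omega
    · rw [← h p]; exact hasDeg_ad hx p
  induction t generalizing x e with
  | zero =>
    have := hνe hx h p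
    rwa [filt_neg (by exact_mod_cast ht), Submodule.mem_bot] at this
  | succ t ih =>
    have hz : ∀ (m : Fin n × Fin n → ℤ) (p : Fin n × Fin n), mdeg m = e →
        coef hq₀ (m + Pi.single p 1) (ad K x (YGL q n p.1 p.2)) = 0 := by
      rintro m p rfl
      have hp := hνe hx h p
      by_cases h0 : coef hq₀ m (ν p) = 0
      · rw [h p, coef_mul_YGL hq₀ hp, h0, mul_zero]
      · have hc := isCentralExp_of_ad hq₀ hq hp h0 fun p' => by
          rw [ad_eq_zero_of_mem_center (hν p), map_zero]
        rw [coef_ad hq₀ hx, (chi_eq_zero_iff hq₀ hq).2 (hc p), zero_mul]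
    obtain ⟨c, k, h'⟩ := exists_sub_detGL_pow_mem hq₀ hn hx fun m hm hne =>
      isCentralExp_of_ad hq₀ hq (hm ▸ hx) hne fun p => hz m p hm
    refine ih (by push_cast at ht; omega) h' fun p => ?_
    rw [← h p, ad_apply, ad_apply, sub_mul, mul_sub, smul_mul_assoc, mul_smul_comm,
      ((detGL_commute hq₀ (YGL q n p.1 p.2)).pow_left k).eq]
    abel

theorem eq_zero_of_sum_smul_derD_eq_ad (hq₀ : q ≠ 0) (hq : ∀ m : ℕ, 0 < m → q ^ m ≠ 1)
    (hn : 1 < n) {μ : Fin (2 * n - 1) → Subalgebra.center K (OqGL q n)} {x : OqGL q n}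
    (h : ∑ j, μ j • derD q j = ad K x) : μ = 0 := by
  set ν : Fin n × Fin n → Subalgebra.center K (OqGL q n) := fun p =>
    μ (colIdx p.2) + μ (rowIdx p.1) - μ (midIdx n hn) with hνdef
  have hx : ∀ p : Fin n × Fin n, ad K x (YGL q n p.1 p.2) = ν p * YGL q n p.1 p.2 := fun p => by
    rw [← h, sum_smul_derD_YGL hn]
  obtain ⟨k, e, he, hk⟩ := exists_detGL_pow_mul_mem_forall hq₀ Finset.univ
    fun o : Option (Fin n × Fin n) => o.elim x fun p => (ν p : OqGL q n)
  have hΔ : ∀ y : OqGL q n, y * detGL q n ^ k = detGL q n ^ k * y := fun y =>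
    ((detGL_commute hq₀ y).pow_left k).eq.symm
  -- Multiply `x` and all the `ν p` by a common power of `Δ` to bring them into the filtration.
  have hν0 : ∀ p, ν p = 0 := fun p => by
    have := eq_zero_of_ad_eq_mul hq₀ hq hn (ν := fun p => detGL q n ^ k * (ν p : OqGL q n))
      (fun p => Subalgebra.mul_mem _ (Subalgebra.pow_mem _ (detGL_mem_center q n hq₀) k) (ν p).2)
      (fun p => hk (some p) (Finset.mem_univ _)) e.toNat.succ
      (by push_cast; have := Int.self_le_toNat e; omega) (hk none (Finset.mem_univ _))
      (fun p => by
        have h1 := hx p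
        rw [ad_apply] at h1
        rw [ad_apply, mul_assoc (detGL q n ^ k) (ν p : OqGL q n), ← h1, mul_sub, mul_assoc,
          ← mul_assoc (YGL q n p.1 p.2), hΔ, mul_assoc]
        rfl) p
    apply Subtype.ext
    rw [← detInvGL_pow_mul_detGL_pow_mul hq₀ k (ν p : OqGL q n), this, mul_zero]
    rfl
  set z : Fin n := ⟨0, by omega⟩
  have hc : colIdx z = midIdx n hn := by simp [colIdx, midIdx, z]
  have hr : rowIdx z = midIdx n hn := by simp [rowIdx, midIdx, z]
  -- At the entry `(0, 0)` the three indices coincide, so the relation reads `μ` of the middle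
  -- index. The other coefficients follow from the first row and the first column.
  have h0 : μ (midIdx n hn) = 0 := by
    have := hν0 (z, z)
    simp only [hνdef, hc, hr, add_sub_cancel_right] at this
    exact this
  funext j
  by_cases hj : (j : ℕ) < n
  · have e1 : colIdx ⟨n - 1 - j, by omega⟩ = j := by simp only [colIdx, Fin.ext_iff]; omega
    have := hν0 (z, ⟨n - 1 - j, by omega⟩)
    simp only [hνdef, hr, h0, e1, add_zero, sub_zero] at this
    exact this
  · have e1 : rowIdx ⟨j - (n - 1), by omega⟩ = j := by simp only [rowIdx, Fin.ext_iff]; omega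
    have := hν0 (⟨j - (n - 1), by omega⟩, z)
    simp only [hνdef, hc, h0, e1, zero_add, sub_zero] at this
    exact this

theorem nontrivial_OqGL (hq₀ : q ≠ 0) : Nontrivial (OqGL q n) := by
  refine ⟨1, 0, fun h => ?_⟩
  have := coef_one (n := n) hq₀ (m := 0) (by rw [mdeg_zero])
  rw [h, map_zero, if_pos rfl] at this
  exact zero_ne_one this

/-- Every derivation is uniquely the sum of an inner derivation and a combination of the `D_j`. -/
theorem existsUnique_decomposition (hq₀ : q ≠ 0) (hq : ∀ m : ℕ, 0 < m → q ^ m ≠ 1) (hn : 1 < n)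
    (D : Der K (OqGL q n)) :
    ∃! p : InnDer K (OqGL q n) × (Fin (2 * n - 1) → Subalgebra.center K (OqGL q n)),
      D = p.1 + ∑ j, p.2 j • derD q j := by
  have hD : D ∈ InnDer K (OqGL q n) ⊔ Submodule.span (Subalgebra.center K (OqGL q n))
      (Set.range (derD (n := n) q)) := by rw [InnDer_sup_span hq₀ hq hn]; exact Submodule.mem_top
  obtain ⟨y, hy, w, hw, rfl⟩ := Submodule.mem_sup.1 hD
  obtain ⟨μ, rfl⟩ := (Submodule.mem_span_range_iff_exists_fun _).1 hw
  refine ⟨(⟨y, hy⟩, μ), rfl, ?_⟩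
  rintro ⟨⟨y', hy'⟩, μ'⟩ h
  dsimp only at h
  obtain ⟨x, hx⟩ := Submodule.sub_mem _ hy' hy
  have h1 : ∑ j, (μ - μ') j • derD q j = ad K x := by
    rw [hx]
    simp only [Pi.sub_apply, sub_smul, Finset.sum_sub_distrib]
    rw [sub_eq_sub_iff_add_eq_add, add_comm, h, add_comm]
  have h2 : μ = μ' := sub_eq_zero.1 (eq_zero_of_sum_smul_derD_eq_ad hq₀ hq hn h1)
  subst h2
  have h3 := add_right_cancel h
  subst h3
  rfl

/-- The classes of the `D_j` form a basis of `HH¹`. -/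
theorem exists_basis_HH1 (hq₀ : q ≠ 0) (hq : ∀ m : ℕ, 0 < m → q ^ m ≠ 1) (hn : 1 < n) :
    ∃ b : Module.Basis (Fin (2 * n - 1)) (Subalgebra.center K (OqGL q n)) (HH1 K (OqGL q n)),
      ∀ j, b j = HH1.mk K (OqGL q n) (derD q j) := by
  have hli : LinearIndependent (Subalgebra.center K (OqGL q n))
      fun j => HH1.mk K (OqGL q n) (derD q j) := by
    refine Fintype.linearIndependent_iff.2 fun μ h j => ?_
    have h1 : HH1.mk K (OqGL q n) (∑ j, μ j • derD q j) = 0 := by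
      rw [← h, map_sum]
      simp only [map_smul]
    obtain ⟨x, hx⟩ := (Submodule.Quotient.mk_eq_zero _).1 h1
    rw [eq_zero_of_sum_smul_derD_eq_ad hq₀ hq hn hx.symm]
    rfl
  refine ⟨Module.Basis.mk hli fun v _ => ?_, fun j => Module.Basis.mk_apply ..⟩
  obtain ⟨D, rfl⟩ := Submodule.Quotient.mk_surjective _ v
  obtain ⟨⟨y, μ⟩, h, -⟩ := existsUnique_decomposition hq₀ hq hn D
  have h1 : HH1.mk K (OqGL q n) D = ∑ j, μ j • HH1.mk K (OqGL q n) (derD q j) := by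
    conv_lhs => rw [h]
    rw [map_add, map_sum, show HH1.mk K (OqGL q n) (y : Der K (OqGL q n)) = 0 from
      (Submodule.Quotient.mk_eq_zero _).2 y.2, zero_add]
    simp only [map_smul]
  exact (Submodule.mem_span_range_iff_exists_fun _).2 ⟨μ, h1.symm⟩

end Independence

end

end QuantumGL

theorem mainTheorem2 {K : Type*} [Field K] [CharZero K] (q : K) (hq₀ : q ≠ 0)
    (hq : ∀ m : ℕ, 0 < m → q ^ m ≠ 1) (n : ℕ) (hn : 1 < n) :
    -- the centre is the Laurent polynomial algebra `K[Δ_n^{±1}]`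
    (Subalgebra.center K (QuantumGL.OqGL q n)
        = Algebra.adjoin K {QuantumGL.detGL q n, QuantumGL.detInvGL q n} ∧
      Transcendental K (QuantumGL.detGL q n)) ∧
    -- every derivation is uniquely of the form `ad_x + ∑ μ_j D_j`
    (∀ D : QuantumGL.Der K (QuantumGL.OqGL q n),
      ∃! p : QuantumGL.InnDer K (QuantumGL.OqGL q n) ×
          (Fin (2 * n - 1) → Subalgebra.center K (QuantumGL.OqGL q n)),
        D = p.1 + ∑ j, p.2 j • QuantumGL.derD q j) ∧
    -- `HH¹` is free of rank `2n-1` over the centre, with basis the classes of the `D_j`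
    (Module.Free (Subalgebra.center K (QuantumGL.OqGL q n))
        (QuantumGL.HH1 K (QuantumGL.OqGL q n)) ∧
      Module.finrank (Subalgebra.center K (QuantumGL.OqGL q n))
        (QuantumGL.HH1 K (QuantumGL.OqGL q n)) = 2 * n - 1 ∧
      ∃ b : Module.Basis (Fin (2 * n - 1)) (Subalgebra.center K (QuantumGL.OqGL q n))
          (QuantumGL.HH1 K (QuantumGL.OqGL q n)),
        ∀ j, b j = QuantumGL.HH1.mk K (QuantumGL.OqGL q n) (QuantumGL.derD q j)) := by
  have := QuantumGL.nontrivial_OqGL (n := n) hq₀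
  obtain ⟨b, hb⟩ := QuantumGL.exists_basis_HH1 hq₀ hq hn
  exact ⟨⟨QuantumGL.center_eq hq₀ hq hn, QuantumGL.transcendental_detGL hq₀ hn⟩,
    QuantumGL.existsUnique_decomposition hq₀ hq hn, Module.Free.of_basis b,
    (Module.finrank_eq_card_basis b).trans (Fintype.card_fin _), b, hb⟩
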